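/- Let $p$ be a prime number, let $X$ be a Noetherian regular $\mathbf F_p$-scheme which is $F$-finite (its Frobenius $F$ is a finite morphism), let $e\ge1$, $q=p^e$, and let $F_q=F^e$. Assume that the invertible $\mathcal O_X$-module $\mathcal C_X=\mathcal{H}om_{\mathcal O_X}(F_{q*}\mathcal O_X,\mathcal O_X)$, on which $\mathcal O_X$ acts through the source, is free, and fix a generator $\eta$ of it. Let $f\in\Gamma(X,\mathcal O_X)$. Let $\mathscr M$ be a unit $F^e$-module on $X$: a quasi-coherent $\mathcal O_X$-module with a $q$-Frobenius-semilinear endomorphism whose linearization $F_q^*\mathscr M\to\mathscr M$ is an isomorphism; let $\theta\colon\mathscr M\to F_q^*\mathscr M$ denote its inverse. Let $M\subset\mathscr M$ be an $\mathcal O_X$-submodule (a subsheaf, not necessarily quasi-coherent). The module $\mathscr M$ carries two further structures. * It is a $q$-Cartier module through the $p^{-e}$-linear operator $C=(\eta\otimes\mathrm{id})\circ\theta\colon\mathscr M\to\mathscr M$. * Let $\mathcal D_X$ be the sheaf of (Grothendieck) differential operators of $X$, and let $\mathcal D_X^{(m)}\subset\mathcal D_X$ be the subring of $\mathcal O_X^{p^m}$-linear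 operators, so that $\mathcal D_X=\bigcup_m\mathcal D_X^{(m)}$. Then $\mathscr M$ is a $\mathcal D_X$-module: $P\in\mathcal D_X^{(en)}$ acts as $P\otimes\mathrm{id}$ on $F_q^{n*}\mathscr M=\mathcal O_X\otimes_{F_q^n}\mathscr M$, which is identified with $\mathscr M$ by the linearization of the $n$-th iterate of the structure map (the result is independent of $n$). Define the following sets. * For $m\ge1$, $\nu_f(q^m;M)=\{n\in\mathbf Z_{\ge0}\mid C^m(f^nM)\ne C^m(f^{n+1}M)\}$. * $\nu_f(q^\infty;M)$ is the set of $\alpha\in\mathbf Z_p$ such that for every $m\ge1$ there is $n\in\nu_f(q^m;M)$ with $\alpha\equiv n \pmod{q^m\mathbf Z_p}$. * For $m\ge0$, $\mathrm{BSR}^{(m)}(M,f)=\{n\in\mathbf Z_{\ge0}\mid \mathcal D_X^{(m)}f^{n+1}M\subsetneq\mathcal D_X^{(m)}f^nM\}$. * Let $\mathscr C$ be the ring of locally constant functions $\mathbf Z_p\to\mathbf F_p$. Let $\gamma_+\mathscr M=\mathscr M[t,\tfrac1{f-t}]/\mathscr M[t]$, with the induced action of $\mathcal D_X$ (extending the coefficientwise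 action on $\mathscr M[t]$) and of $\mathscr C$, where $\varphi\in\mathscr C$ acts by the differential operator given by $x\,t^i\mapsto\varphi(-i-1)\,x\,t^i$ on $\mathscr M[t]$; a differential operator commuting with $p^k$-th powers is extended to fractions by writing the denominator as a $p^k$-th power. Let $\delta_0=\tfrac1{f-t}$, and let $N_f(M)\subset\gamma_+\mathscr M$ be the $\mathcal D_X\otimes_{\mathbf F_p}\mathscr C$-submodule generated by $M\delta_0$. For $\alpha\in\mathbf Z_p$ put $N_f(M)_\alpha=N_f(M)\otimes_{\mathscr C,\mathrm{ev}_\alpha}\mathbf F_p$, where $\mathrm{ev}_\alpha\colon\mathscr C\to\mathbf F_p$ is evaluation at $\alpha$; since $\mathrm{ev}_\alpha$ is flat, this is a subsheaf of $(\gamma_+\mathscr M)_\alpha=\gamma_+\mathscr M\otimes_{\mathscr C,\mathrm{ev}_\alpha}\mathbf F_p$. Finally, $\mathrm{BSR}(M,f)=\{\alpha\in\mathbf Z_p\mid N_f(fM)_\alpha\subsetneq N_f(M)_\alpha\}$. Then $$\nu_f(q^m;M)=\mathrm{BSR}^{(em)}(M,f)\quad\text{for every } m\ge1,\qquad \mathrm{BSR}(M,f)\subset\nu_f(q^\infty;M),$$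 and if $M$ is locally finitely generated as an $\mathcal O_X$-module, then $\mathrm{BSR}(M,f)=\nu_f(q^\infty;M)$. -/

import Mathlib

open AlgebraicGeometry CategoryTheory TopologicalSpace
open scoped TensorProduct

universe u

noncomputable section

namespace BSRoots

/-- A ring in which `p = 0`. -/
class IsFpRing (p : ℕ) (R : Type*) [Ring R] : Prop where
  cast_eq_zero : (p : R) = 0

set_option linter.unusedSectionVars false

section Ring

variable (p : ℕ) [hp : Fact p.Prime]

theorem IsFpRing.subsingleton_or_charP (R : Type*) [Ring R] [h : IsFpRing p R] :
    Subsingleton R ∨ CharP R p := by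
  rcases (Nat.dvd_prime hp.out).1 (ringChar.dvd h.cast_eq_zero) with h1 | h1
  · left
    have : CharP R 1 := h1 ▸ ringChar.charP R
    exact CharP.CharOne.subsingleton
  · right
    exact h1 ▸ ringChar.charP R

theorem IsFpRing.add_pow {R : Type*} [CommRing R] [IsFpRing p R] (n : ℕ) (a b : R) :
    (a + b) ^ p ^ n = a ^ p ^ n + b ^ p ^ n := by
  rcases IsFpRing.subsingleton_or_charP p R with h | h
  · exact Subsingleton.elim _ _
  · exact add_pow_char_pow a b p n

/-- The `p ^ n`-th power Frobenius endomorphism of a commutative ring in which `p = 0`. -/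
def frob (n : ℕ) (R : Type*) [CommRing R] [IsFpRing p R] : R →+* R where
  toFun a := a ^ p ^ n
  map_one' := one_pow _
  map_mul' a b := mul_pow a b _
  map_zero' := zero_pow (pow_ne_zero _ hp.out.ne_zero)
  map_add' := IsFpRing.add_pow p n

/-- The unique ring homomorphism `𝔽_p → R`. -/
def fpCast (R : Type*) [CommRing R] [h : IsFpRing p R] : ZMod p →+* R :=
  ZMod.castHom (ringChar.dvd h.cast_eq_zero) R

/-- The ring `R`, regarded as an `R`-algebra through the `p ^ n`-th power Frobenius. -/
@[nolint unusedArguments]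
def FrobTwist (_p _n : ℕ) (R : Type*) : Type _ := R

/-- An element of `R`, viewed in `FrobTwist p n R`. -/
def twist (p n : ℕ) {R : Type*} (a : R) : FrobTwist p n R := a

/-- An element of `FrobTwist p n R`, viewed in `R`. -/
def untwist {p n : ℕ} {R : Type*} (a : FrobTwist p n R) : R := a

instance (n : ℕ) (R : Type*) [CommRing R] : CommRing (FrobTwist p n R) :=
  inferInstanceAs (CommRing R)

instance (n : ℕ) (R : Type*) [CommRing R] [IsFpRing p R] : Algebra R (FrobTwist p n R) :=
  (frob p n R).toAlgebra

variable {p}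

theorem FrobTwist.smul_def {n : ℕ} {R : Type*} [CommRing R] [IsFpRing p R] (r : R)
    (a : FrobTwist p n R) : r • a = twist p n (r ^ p ^ n * untwist a) := rfl

variable {R : Type*} [CommRing R] [IsFpRing p R] {M : Type*} [AddCommGroup M] [Module R M]

/-- The linearization `F_q^* M = R ⊗_{F_q} M → M`, `a ⊗ x ↦ a φ(x)`, of a Frobenius-semilinear
map `φ`, where `q = p ^ n`. -/
def linearize (n : ℕ) (φ : M →+ M) (hφ : ∀ (r : R) (x : M), φ (r • x) = r ^ p ^ n • φ x) :
    FrobTwist p n R ⊗[R] M →+ M :=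
  TensorProduct.liftAddHom
    { toFun := fun a => (DistribSMul.toAddMonoidHom M (untwist a)).comp φ
      map_zero' := by ext x; exact zero_smul R _
      map_add' := fun a b => by ext x; exact add_smul (R := R) _ _ _ }
    (fun r a x => by
      change ((r ^ p ^ n * (untwist a) : R)) • φ x = (untwist a) • φ (r • x)
      rw [hφ, smul_smul, mul_comm])

@[simp] theorem linearize_tmul (n : ℕ) (φ : M →+ M)
    (hφ : ∀ (r : R) (x : M), φ (r • x) = r ^ p ^ n • φ x) (a : R) (x : M) :
    linearize n φ hφ ((twist p n a) ⊗ₜ x) = a • φ x := rfl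

/-- For additive `P : R → R` commuting with `p ^ n`-th powers, `P ⊗ id` on `R ⊗_{F^n} M`. -/
def twistMap (n : ℕ) (P : R →+ R) (hP : ∀ a b : R, P (a ^ p ^ n * b) = a ^ p ^ n * P b) :
    FrobTwist p n R ⊗[R] M →+ FrobTwist p n R ⊗[R] M :=
  TensorProduct.liftAddHom
    { toFun := fun a => (TensorProduct.mk R (FrobTwist p n R) M
        (twist p n <|P (untwist a))).toAddMonoidHom
      map_zero' := by
        ext x
        change (twist p n <|P (0 : R)) ⊗ₜ[R] x = 0
        rw [map_zero]; exact TensorProduct.zero_tmul _ _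
      map_add' := fun a b => by
        ext x
        change (twist p n <|P ((untwist a) + (untwist b))) ⊗ₜ[R] x = _
        rw [map_add]; exact TensorProduct.add_tmul _ _ _ }
    (fun r a x => by
      change (twist p n <|P (r ^ p ^ n * (untwist a))) ⊗ₜ[R] x =
        (twist p n <|P (untwist a)) ⊗ₜ[R] (r • x)
      rw [hP, ← TensorProduct.smul_tmul]; rfl)

@[simp] theorem twistMap_tmul (n : ℕ) (P : R →+ R)
    (hP : ∀ a b : R, P (a ^ p ^ n * b) = a ^ p ^ n * P b) (a : R) (x : M) :
    twistMap n P hP ((twist p n a) ⊗ₜ[R] x) =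
      (twist p n <|P a) ⊗ₜ[R] x := rfl

/-- For a `p⁻ⁿ`-linear `η : R → R`, the map `η ⊗ id : R ⊗_{F^n} M → M`, `a ⊗ x ↦ η(a) x`. -/
def cartierEval (n : ℕ) (η : R →+ R) (hη : ∀ a b : R, η (a ^ p ^ n * b) = a * η b) :
    FrobTwist p n R ⊗[R] M →+ M :=
  TensorProduct.liftAddHom
    { toFun := fun a => DistribSMul.toAddMonoidHom M (η (untwist a))
      map_zero' := by
        ext x
        change (η (0 : R)) • x = 0
        rw [map_zero, zero_smul]
      map_add' := fun a b => by
        ext x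
        change (η ((untwist a) + (untwist b))) • x = _
        rw [map_add, add_smul]; rfl }
    (fun r a x => by
      change (η (r ^ p ^ n * (untwist a))) • x = η (untwist a) • (r • x)
      rw [hη, smul_smul, mul_comm])

@[simp] theorem cartierEval_tmul (n : ℕ) (η : R →+ R)
    (hη : ∀ a b : R, η (a ^ p ^ n * b) = a * η b) (a : R) (x : M) :
    cartierEval n η hη ((twist p n a) ⊗ₜ[R] x) = η a • x := rfl

/-- An `F^e`-module structure on an `R`-module, that is, a Frobenius-semilinear additive map. -/
structure FMod (p e : ℕ) (R M : Type*) [CommRing R] [AddCommGroup M] [Module R M] where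
  φ : M →+ M
  map_smul' : ∀ (r : R) (x : M), φ (r • x) = r ^ p ^ e • φ x

namespace FMod

variable {e : ℕ} (Φ : FMod p e R M)

/-- The `n`-th iterate of the structure map. -/
def iter : ℕ → (M →+ M)
  | 0 => AddMonoidHom.id M
  | n + 1 => (iter n).comp Φ.φ

theorem iter_smul (n : ℕ) : ∀ (r : R) (x : M),
    Φ.iter n (r • x) = r ^ p ^ (e * n) • Φ.iter n x := by
  induction n with
  | zero => intro r x; simp [iter]
  | succ n ih =>
    intro r x
    simp only [iter, AddMonoidHom.comp_apply]
    rw [Φ.map_smul', ih, ← pow_mul, ← pow_add, mul_add, mul_one, add_comm e]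

/-- The linearization `F_q^{n*} M → M` of the `n`-th iterate, where `q = p ^ e`. -/
def lin (n : ℕ) : FrobTwist p (e * n) R ⊗[R] M →+ M :=
  linearize (e * n) (Φ.iter n) (Φ.iter_smul n)

/-- The `F^e`-module is unit: `F_q^* M → M` is an isomorphism. -/
def IsUnit : Prop := Function.Bijective (linearize e Φ.φ Φ.map_smul')

/-- Multiplication by `r : R` on the first factor of `F_q^* M`. -/
def twistSMul (r : R) : FrobTwist p e R ⊗[R] M →+ FrobTwist p e R ⊗[R] M :=
  twistMap e (AddMonoidHom.mulLeft r) (fun a b => by simp [mul_left_comm])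

theorem linearize_twistSMul (r : R) (t : FrobTwist p e R ⊗[R] M) :
    linearize e Φ.φ Φ.map_smul' (twistSMul r t) = r • linearize e Φ.φ Φ.map_smul' t := by
  induction t using TensorProduct.induction_on with
  | zero => simp
  | tmul a x => exact mul_smul r (untwist a) _
  | add s t hs ht => simp only [map_add, hs, ht, smul_add]

/-- The map `b ⊗ y ↦ a b ^ (q ^ n) ⊗ y`. -/
def raise (n : ℕ) (a : R) : FrobTwist p e R ⊗[R] M →+ FrobTwist p (e * (n + 1)) R ⊗[R] M :=
  TensorProduct.liftAddHom
    { toFun := fun b => (TensorProduct.mk R (FrobTwist p (e * (n + 1)) R) M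
        (twist p (e * (n + 1)) (a * frob p (e * n) R (untwist b)))).toAddMonoidHom
      map_zero' := by
        ext x
        change (twist p (e * (n + 1)) (a * frob p (e * n) R (0 : R))) ⊗ₜ[R] x = 0
        rw [map_zero, mul_zero]; exact TensorProduct.zero_tmul _ _
      map_add' := fun b c => by
        ext x
        change (twist p (e * (n + 1)) (a * frob p (e * n) R ((untwist b) + (untwist c)))) ⊗ₜ[R] x = _
        rw [map_add, mul_add a]
        exact TensorProduct.add_tmul (R := R)
          (twist p (e * (n + 1)) (a * frob p (e * n) R (untwist b)))
          (twist p (e * (n + 1)) (a * frob p (e * n) R (untwist c))) x }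
    (fun r b x => by
      change (twist p (e * (n + 1)) (a * frob p (e * n) R (r ^ p ^ e * (untwist b)))) ⊗ₜ[R] x =
        (twist p (e * (n + 1)) (a * frob p (e * n) R (untwist b))) ⊗ₜ[R] (r • x)
      rw [← TensorProduct.smul_tmul, FrobTwist.smul_def]
      congr 1
      change a * (r ^ p ^ e * (untwist b)) ^ p ^ (e * n) =
        r ^ p ^ (e * (n + 1)) * (a * (untwist b) ^ p ^ (e * n))
      rw [mul_pow, ← pow_mul, ← pow_add, mul_add, mul_one, add_comm e]
      ring)

theorem raise_tmul (n : ℕ) (a b : R) (x : M) :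
    raise (p := p) (e := e) n a ((twist p e b) ⊗ₜ[R] x) =
      (twist p (e * (n + 1)) (a * b ^ p ^ (e * n))) ⊗ₜ[R] x := rfl

theorem raise_add (n : ℕ) (a b : R) (t : FrobTwist p e R ⊗[R] M) :
    raise n (a + b) t = raise n a t + raise n b t := by
  induction t using TensorProduct.induction_on with
  | zero => simp
  | tmul c x =>
    change (twist p (e * (n + 1)) ((a + b) * (untwist c) ^ p ^ (e * n))) ⊗ₜ[R] x = _
    rw [add_mul]; exact TensorProduct.add_tmul _ _ _
  | add s t hs ht => simp only [map_add, hs, ht]; abel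

theorem raise_twistSMul (n : ℕ) (a r : R) (t : FrobTwist p e R ⊗[R] M) :
    raise n (r ^ p ^ (e * n) * a) t = raise n a (twistSMul r t) := by
  induction t using TensorProduct.induction_on with
  | zero => simp
  | tmul c x =>
    change (twist p (e * (n + 1)) (r ^ p ^ (e * n) * a * (untwist c) ^ p ^ (e * n))) ⊗ₜ[R] x =
      (twist p (e * (n + 1)) (a * (r * (untwist c)) ^ p ^ (e * n))) ⊗ₜ[R] x
    rw [mul_pow]; congr 2; ring
  | add s t hs ht => simp only [map_add, hs, ht]

variable {Φ}

/-- The inverse `θ : M → F_q^* M` of the structure isomorphism of a unit `F^e`-module. -/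
def theta (hΦ : Φ.IsUnit) : M ≃+ FrobTwist p e R ⊗[R] M :=
  (AddEquiv.ofBijective (linearize e Φ.φ Φ.map_smul') hΦ).symm

theorem linearize_theta (hΦ : Φ.IsUnit) (x : M) :
    linearize e Φ.φ Φ.map_smul' (theta hΦ x) = x :=
  (AddEquiv.ofBijective (linearize e Φ.φ Φ.map_smul') hΦ).apply_symm_apply x

theorem theta_phi (hΦ : Φ.IsUnit) (a : R) (x : M) :
    theta hΦ (a • Φ.φ x) = (twist p e a) ⊗ₜ[R] x :=
  (AddEquiv.ofBijective (linearize e Φ.φ Φ.map_smul') hΦ).symm_apply_apply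
    ((twist p e a) ⊗ₜ[R] x)

theorem theta_smul (hΦ : Φ.IsUnit) (r : R) (x : M) :
    theta hΦ (r • x) = twistSMul r (theta hΦ x) := by
  apply hΦ.1
  rw [linearize_theta, linearize_twistSMul, linearize_theta]

theorem lin_tmul (n : ℕ) (a : R) (x : M) :
    Φ.lin n ((twist p (e * n) a) ⊗ₜ[R] x) = a • Φ.iter n x := rfl

/-- The map `F_q^{n*} M → F_q^{(n+1)*} M` induced by `θ`. -/
def up (hΦ : Φ.IsUnit) (n : ℕ) :
    FrobTwist p (e * n) R ⊗[R] M →+ FrobTwist p (e * (n + 1)) R ⊗[R] M :=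
  TensorProduct.liftAddHom
    { toFun := fun a => (raise n (untwist a)).comp (theta hΦ).toAddMonoidHom
      map_zero' := by
        ext x
        have h := raise_add (p := p) (e := e) n 0 (0 : R) (theta hΦ x)
        rw [add_zero] at h
        exact left_eq_add.1 h
      map_add' := fun a b => by ext x; exact raise_add n _ _ _ }
    (fun r a x => by
      change raise n (r ^ p ^ (e * n) * (untwist a)) (theta hΦ x) =
        raise n (untwist a) (theta hΦ (r • x))
      rw [theta_smul, raise_twistSMul])

theorem lin_bijective (hΦ : Φ.IsUnit) (n : ℕ) : Function.Bijective (Φ.lin n) := by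
  induction n with
  | zero =>
    have h1 : ∀ t : FrobTwist p (e * 0) R ⊗[R] M,
        t = (twist p (e * 0) (1 : R)) ⊗ₜ[R] Φ.lin 0 t := by
      intro t
      induction t using TensorProduct.induction_on with
      | zero => simp
      | tmul a x =>
        change _ = _ ⊗ₜ[R] ((untwist a) • x)
        rw [← TensorProduct.smul_tmul, FrobTwist.smul_def]
        congr 1
        simp only [mul_zero, pow_zero, pow_one]
        exact (mul_one (untwist a)).symm
      | add s t hs ht => rw [map_add, TensorProduct.tmul_add, ← hs, ← ht]
    refine ⟨fun s t h => ?_, fun x => ⟨(twist p (e * 0) (1 : R)) ⊗ₜ[R] x, ?_⟩⟩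
    · rw [h1 s, h1 t, h]
    · rw [lin_tmul, one_smul]; rfl
  | succ n ih =>
    have key : ∀ t : FrobTwist p (e * (n + 1)) R ⊗[R] M, ∃ s : FrobTwist p (e * n) R ⊗[R] M,
        Φ.lin n s = Φ.lin (n + 1) t ∧ up hΦ n s = t := by
      intro t
      induction t using TensorProduct.induction_on with
      | zero => exact ⟨0, by simp⟩
      | tmul a x =>
        refine ⟨(twist p (e * n) (untwist a)) ⊗ₜ[R] Φ.φ x, rfl, ?_⟩
        change raise n (untwist a) (theta hΦ (Φ.φ x)) = _
        rw [← one_smul R (Φ.φ x), theta_phi, raise_tmul]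
        congr 1
        simp
        rfl
      | add s t hs ht =>
        obtain ⟨s', h1, h2⟩ := hs
        obtain ⟨t', h3, h4⟩ := ht
        exact ⟨s' + t', by simp [h1, h3], by simp [h2, h4]⟩
    refine ⟨fun s t h => ?_, fun x => ?_⟩
    · obtain ⟨s', h1, h2⟩ := key s
      obtain ⟨t', h3, h4⟩ := key t
      have : s' = t' := ih.1 (by rw [h1, h3, h])
      rw [← h2, ← h4, this]
    · obtain ⟨s, rfl⟩ := ih.2 x
      induction s using TensorProduct.induction_on with
      | zero => exact ⟨0, by simp⟩
      | tmul a y =>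
        obtain ⟨t, rfl⟩ := hΦ.2 y
        change ∃ z, _ = (untwist a) • Φ.iter n _
        induction t using TensorProduct.induction_on with
        | zero => exact ⟨0, by simp⟩
        | tmul b z =>
          refine ⟨(twist p (e * (n + 1)) ((untwist a) * (untwist b) ^ p ^ (e * n))) ⊗ₜ[R] z, ?_⟩
          change _ = (untwist a) • Φ.iter n ((untwist b) • Φ.φ z)
          rw [lin_tmul, iter_smul, smul_smul]; rfl
        | add s t hs ht =>
          obtain ⟨s', h1⟩ := hs
          obtain ⟨t', h2⟩ := ht
          exact ⟨s' + t', by simp only [map_add, smul_add, h1, h2]⟩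
      | add s t hs ht =>
        obtain ⟨s', h1⟩ := hs
        obtain ⟨t', h2⟩ := ht
        exact ⟨s' + t', by simp only [map_add, h1, h2]⟩


/-- The associated `p⁻ᵉ`-linear operator `C = (η ⊗ id) ∘ θ` of a unit `F^e`-module. -/
def cartier (hΦ : Φ.IsUnit) (η : R →+ R) (hη : ∀ a b : R, η (a ^ p ^ e * b) = a * η b) :
    M →+ M :=
  (cartierEval e η hη).comp (theta hΦ).toAddMonoidHom

theorem cartier_phi (hΦ : Φ.IsUnit) (η : R →+ R)
    (hη : ∀ a b : R, η (a ^ p ^ e * b) = a * η b) (a : R) (x : M) :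
    cartier hΦ η hη (a • Φ.φ x) = η a • x := by
  change cartierEval e η hη (theta hΦ _) = _
  rw [theta_phi]; rfl

theorem induction_iter (hΦ : Φ.IsUnit) (n : ℕ) {Q : M → Prop} (h0 : Q 0)
    (h1 : ∀ (a : R) (x : M), Q (a • Φ.iter n x)) (h2 : ∀ x y, Q x → Q y → Q (x + y)) (x : M) :
    Q x := by
  obtain ⟨t, rfl⟩ := (lin_bijective hΦ n).2 x
  induction t using TensorProduct.induction_on with
  | zero => rwa [map_zero]
  | tmul a x => exact h1 (untwist a) x
  | add s t hs ht => rw [map_add]; exact h2 _ _ hs ht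

theorem induction_phi (hΦ : Φ.IsUnit) {Q : M → Prop} (h0 : Q 0)
    (h1 : ∀ (a : R) (x : M), Q (a • Φ.φ x)) (h2 : ∀ x y, Q x → Q y → Q (x + y)) (x : M) :
    Q x := induction_iter hΦ 1 h0 h1 h2 x

theorem cartier_smul (hΦ : Φ.IsUnit) (η : R →+ R)
    (hη : ∀ a b : R, η (a ^ p ^ e * b) = a * η b) (r : R) (x : M) :
    cartier hΦ η hη (r ^ p ^ e • x) = r • cartier hΦ η hη x := by
  induction x using induction_phi hΦ with
  | h0 => simp
  | h1 a x => rw [smul_smul, cartier_phi, cartier_phi, hη, mul_smul]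
  | h2 x y hx hy => simp only [smul_add, map_add, hx, hy]

end FMod

/-- The ring of additive endomorphisms of an `A`-module `E` which commute with `p ^ m`-th powers
of elements of `A`, for some `m`. -/
def pLinEnd (p : ℕ) (A E : Type*) [CommRing A] [AddCommGroup E] [Module A E] :
    Subring (AddMonoid.End E) where
  carrier := {T | ∃ m : ℕ, ∀ (a : A) (x : E), T (a ^ p ^ m • x) = a ^ p ^ m • T x}
  one_mem' := ⟨0, fun _ _ => rfl⟩
  zero_mem' := ⟨0, fun _ _ => (smul_zero _).symm⟩
  neg_mem' := by
    rintro T ⟨m, h⟩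
    refine ⟨m, fun a x => ?_⟩
    change -T _ = _ • -T x
    rw [h, smul_neg]
  mul_mem' := by
    rintro S T ⟨m, hS⟩ ⟨n, hT⟩
    refine ⟨m + n, fun a x => ?_⟩
    change S (T _) = _ • S (T x)
    have h1 : a ^ p ^ (m + n) = (a ^ p ^ n) ^ p ^ m := by rw [← pow_mul, ← pow_add, add_comm]
    have h2 : a ^ p ^ (m + n) = (a ^ p ^ m) ^ p ^ n := by rw [← pow_mul, ← pow_add]
    rw [h2, hT, ← h2, h1, hS]
  add_mem' := by
    rintro S T ⟨m, hS⟩ ⟨n, hT⟩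
    refine ⟨m + n, fun a x => ?_⟩
    change S _ + T _ = _ • (S x + T x)
    have h1 : a ^ p ^ (m + n) = (a ^ p ^ n) ^ p ^ m := by rw [← pow_mul, ← pow_add, add_comm]
    have h2 : a ^ p ^ (m + n) = (a ^ p ^ m) ^ p ^ n := by rw [← pow_mul, ← pow_add]
    rw [smul_add]
    congr 1
    · rw [h1, hS]
    · rw [h2, hT]

theorem pLin_mono {p : ℕ} {A E : Type*} [CommRing A] [AddCommGroup E] [Module A E]
    {T : AddMonoid.End E} {m n : ℕ} (hmn : m ≤ n)
    (h : ∀ (a : A) (x : E), T (a ^ p ^ m • x) = a ^ p ^ m • T x) (a : A) (x : E) :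
    T (a ^ p ^ n • x) = a ^ p ^ n • T x := by
  obtain ⟨k, rfl⟩ := Nat.exists_eq_add_of_le hmn
  have h1 : a ^ p ^ (m + k) = (a ^ p ^ k) ^ p ^ m := by rw [← pow_mul, ← pow_add, add_comm]
  rw [h1, h]

namespace FMod

variable {e : ℕ} {Φ : FMod p e R M}

/-- The composite `M ≅ F_q^{n*} M → F_q^{n*} M ≅ M` of `P ⊗ id` with the structure isomorphism
and its inverse, for `P` commuting with `q ^ n`-th powers. -/
def actLevel (hΦ : Φ.IsUnit) (n : ℕ) (P : AddMonoid.End R)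
    (hP : ∀ a b : R, P (a ^ p ^ (e * n) * b) = a ^ p ^ (e * n) * P b) : AddMonoid.End M :=
  (Φ.lin n).comp ((twistMap (e * n) P hP).comp
    (AddEquiv.ofBijective (Φ.lin n) (lin_bijective hΦ n)).symm.toAddMonoidHom)

theorem actLevel_iter (hΦ : Φ.IsUnit) (n : ℕ) (P : AddMonoid.End R)
    (hP : ∀ a b : R, P (a ^ p ^ (e * n) * b) = a ^ p ^ (e * n) * P b) (a : R) (x : M) :
    actLevel hΦ n P hP (a • Φ.iter n x) = P a • Φ.iter n x := by
  have h : (AddEquiv.ofBijective (Φ.lin n) (lin_bijective hΦ n)).symm (a • Φ.iter n x) =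
      twist p (e * n) a ⊗ₜ[R] x :=
    (AddEquiv.ofBijective (Φ.lin n) (lin_bijective hΦ n)).symm_apply_apply
      (twist p (e * n) a ⊗ₜ[R] x)
  change Φ.lin n (twistMap (e * n) P hP
    ((AddEquiv.ofBijective (Φ.lin n) (lin_bijective hΦ n)).symm (a • Φ.iter n x))) = _
  rw [h]; rfl

/-- A level `n` at which `P` can act. -/
theorem exists_level (he : 0 < e) (P : pLinEnd p R R) :
    ∃ n : ℕ, ∀ a b : R, P.1 (a ^ p ^ (e * n) * b) = a ^ p ^ (e * n) * P.1 b := by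
  obtain ⟨m, hm⟩ := P.2
  exact ⟨m, pLin_mono (Nat.le_mul_of_pos_left m he) hm⟩

theorem iter_add (Φ : FMod p e R M) (m n : ℕ) (x : M) :
    Φ.iter (m + n) x = Φ.iter m (Φ.iter n x) := by
  induction n generalizing x with
  | zero => rfl
  | succ n ih => exact ih (Φ.φ x)

/-- The endomorphism `P̃` of `M` attached to `P`. -/
def actFun (he : 0 < e) (hΦ : Φ.IsUnit) (P : pLinEnd p R R) : AddMonoid.End M :=
  actLevel hΦ (exists_level he P).choose P.1 (exists_level he P).choose_spec

/-- `P̃` does not depend on the choice of the level. -/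
theorem actFun_eq (he : 0 < e) (hΦ : Φ.IsUnit) (P : pLinEnd p R R) (n : ℕ)
    (hP : ∀ a b : R, P.1 (a ^ p ^ (e * n) * b) = a ^ p ^ (e * n) * P.1 b) :
    actFun he hΦ P = actLevel hΦ n P.1 hP := by
  ext x
  let m := (exists_level he P).choose
  induction x using induction_iter hΦ (m + n) with
  | h0 => simp
  | h1 a x =>
    rw [iter_add]
    change actLevel hΦ m P.1 _ _ = _
    rw [actLevel_iter, ← iter_add, add_comm m n, iter_add, actLevel_iter]
  | h2 x y hx hy => simp only [map_add, hx, hy]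

theorem actFun_iter (he : 0 < e) (hΦ : Φ.IsUnit) (P : pLinEnd p R R) (n : ℕ)
    (hP : ∀ a b : R, P.1 (a ^ p ^ (e * n) * b) = a ^ p ^ (e * n) * P.1 b) (a : R) (x : M) :
    actFun he hΦ P (a • Φ.iter n x) = P.1 a • Φ.iter n x := by
  rw [actFun_eq he hΦ P n hP, actLevel_iter]

/-- The ring homomorphism `P ↦ P̃`. -/
def act (he : 0 < e) (hΦ : Φ.IsUnit) : pLinEnd p R R →+* AddMonoid.End M where
  toFun P := actFun he hΦ P
  map_one' := by
    ext x
    induction x using induction_iter hΦ 0 with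
    | h0 => simp
    | h1 a x => rw [actFun_iter he hΦ 1 0 (fun _ _ => rfl)]; rfl
    | h2 x y hx hy => rw [map_add, map_add, hx, hy]
  map_zero' := by
    ext x
    induction x using induction_iter hΦ 0 with
    | h0 => simp
    | h1 a x => rw [actFun_iter he hΦ 0 0 (fun _ _ => (mul_zero _).symm)]; exact zero_smul R _
    | h2 x y hx hy => simp only [map_add, hx, hy]
  map_mul' P Q := by
    ext x
    obtain ⟨m, hm⟩ := exists_level he P
    obtain ⟨n, hn⟩ := exists_level he Q
    have hm' := pLin_mono (T := P.1) (Nat.mul_le_mul_left e (Nat.le_add_right m n)) hm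
    have hn' := pLin_mono (T := Q.1) (Nat.mul_le_mul_left e (Nat.le_add_left n m)) hn
    induction x using induction_iter hΦ (m + n) with
    | h0 => simp
    | h1 a x =>
      change _ = actFun he hΦ P (actFun he hΦ Q _)
      rw [actFun_iter he hΦ Q _ hn', actFun_iter he hΦ P _ hm', actFun_iter he hΦ (P * Q) _]
      · rfl
      · intro a b
        change P.1 (Q.1 _) = _ * P.1 (Q.1 _)
        exact (congrArg P.1 (hn' a b)).trans (hm' a _)
    | h2 x y hx hy => simp only [map_add, hx, hy]
  map_add' P Q := by
    ext x
    obtain ⟨m, hm⟩ := exists_level he P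
    obtain ⟨n, hn⟩ := exists_level he Q
    have hm' := pLin_mono (T := P.1) (Nat.mul_le_mul_left e (Nat.le_add_right m n)) hm
    have hn' := pLin_mono (T := Q.1) (Nat.mul_le_mul_left e (Nat.le_add_left n m)) hn
    induction x using induction_iter hΦ (m + n) with
    | h0 => simp
    | h1 a x =>
      change _ = actFun he hΦ P _ + actFun he hΦ Q _
      rw [actFun_iter he hΦ Q _ hn', actFun_iter he hΦ P _ hm', actFun_iter he hΦ (P + Q) _]
      · exact add_smul _ _ _
      · intro a b
        change P.1 _ + Q.1 _ = _ * (P.1 _ + Q.1 _)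
        exact (congrArg₂ (· + ·) (hm' a b) (hn' a b)).trans (mul_add _ _ _).symm
    | h2 x y hx hy => simp only [map_add, hx, hy]

end FMod

/-! ### Differential operators -/

/-- `IsDiffOp n P` says that all `n`-fold iterated commutators of `P` with multiplications vanish,
that is, `P` is a differential operator of order `< n`. -/
def IsDiffOp {A : Type*} [CommRing A] : ℕ → AddMonoid.End A → Prop
  | 0, P => P = 0
  | n + 1, P => ∀ a : A, IsDiffOp n
      (P * Module.toAddMonoidEnd A A a - Module.toAddMonoidEnd A A a * P)

theorem commutator_neg {E : Type*} [Ring E] (P c : E) :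
    -P * c - c * -P = -(P * c - c * P) := by
  rw [neg_mul, mul_neg]; abel

theorem commutator_mul {E : Type*} [Ring E] (P Q c : E) :
    P * Q * c - c * (P * Q) = P * (Q * c - c * Q) + (P * c - c * P) * Q := by
  rw [mul_sub, sub_mul]; simp only [mul_assoc]; abel

namespace IsDiffOp

variable {A : Type*} [CommRing A]

theorem zero (n : ℕ) : IsDiffOp n (0 : AddMonoid.End A) := by
  induction n with
  | zero => rfl
  | succ n ih => intro a; simpa using ih

theorem succ {n : ℕ} {P : AddMonoid.End A} (h : IsDiffOp n P) : IsDiffOp (n + 1) P := by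
  induction n generalizing P with
  | zero => intro a; rw [show P = 0 from h]; simpa using zero 0
  | succ n ih => intro a; exact ih (h a)

theorem mono {m n : ℕ} (hmn : m ≤ n) {P : AddMonoid.End A} (h : IsDiffOp m P) : IsDiffOp n P := by
  induction hmn with
  | refl => exact h
  | step _ ih => exact ih.succ

theorem add {n : ℕ} {P Q : AddMonoid.End A} (hP : IsDiffOp n P) (hQ : IsDiffOp n Q) :
    IsDiffOp n (P + Q) := by
  induction n generalizing P Q with
  | zero => rw [show P = 0 from hP, show Q = 0 from hQ]; exact add_zero _
  | succ n ih =>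
    intro a
    have := ih (hP a) (hQ a)
    convert this using 1
    noncomm_ring

theorem neg {n : ℕ} {P : AddMonoid.End A} (hP : IsDiffOp n P) : IsDiffOp n (-P) := by
  induction n generalizing P with
  | zero => rw [show P = 0 from hP]; exact neg_zero
  | succ n ih =>
    intro a
    have := ih (hP a)
    rwa [← commutator_neg] at this

theorem mul {m n : ℕ} {P Q : AddMonoid.End A} (hP : IsDiffOp m P) (hQ : IsDiffOp n Q) :
    IsDiffOp (m + n) (P * Q) := by
  induction m generalizing P Q n with
  | zero => rw [show P = 0 from hP, zero_mul]; exact zero _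
  | succ m ihm =>
    induction n generalizing Q with
    | zero => rw [show Q = 0 from hQ, mul_zero]; exact zero _
    | succ n ihn =>
      intro a
      have h1 : IsDiffOp (m + 1 + n) _ := ihn (hQ a)
      have h2 : IsDiffOp (m + (n + 1)) _ := ihm (hP a) hQ
      rw [show m + (n + 1) = m + 1 + n by ring] at h2
      have h3 := h1.add h2
      rwa [← commutator_mul] at h3

theorem toAddMonoidEnd (a : A) : IsDiffOp 1 (Module.toAddMonoidEnd A A a) := by
  intro b
  change _ - _ = _
  rw [← map_mul, ← map_mul, mul_comm, sub_self]

/-- A differential operator in characteristic `p` commutes with high `p`-power powers. -/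
theorem pLin (p : ℕ) [hp : Fact p.Prime] [hA : IsFpRing p A] {m n : ℕ} (hn : n ≤ p ^ m)
    {P : AddMonoid.End A} (hP : IsDiffOp n P) (a b : A) :
    P (a ^ p ^ m * b) = a ^ p ^ m * P b := by
  set μ : AddMonoid.End A := Module.toAddMonoidEnd A A a with hμ
  have hE : IsFpRing p (AddMonoid.End (AddMonoid.End A)) := ⟨by
    ext Q x
    have h : (p : AddMonoid.End (AddMonoid.End A)) = p • 1 := by simp
    rw [h]
    change (p • Q) x = 0
    change p • Q x = 0
    rw [nsmul_eq_mul, hA.cast_eq_zero, zero_mul]⟩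
  set l : AddMonoid.End (AddMonoid.End A) := AddMonoidHom.mulLeft μ
  set r : AddMonoid.End (AddMonoid.End A) := AddMonoidHom.mulRight μ
  have hc : Commute r l := by
    ext Q : 1
    exact (mul_assoc μ Q μ)
  have key : ∀ n (Q : AddMonoid.End A), IsDiffOp n Q → ((r - l) ^ n) Q = 0 := by
    intro n
    induction n with
    | zero => intro Q hQ; rw [show Q = 0 from hQ, map_zero]
    | succ n ih =>
      intro Q hQ
      rw [pow_succ]
      exact ih _ (hQ a)
  have h1 : ((r - l) ^ p ^ m) P = 0 := key _ _ (hP.mono hn)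
  have h2 : (r - l) ^ p ^ m = r ^ p ^ m - l ^ p ^ m := by
    rcases IsFpRing.subsingleton_or_charP p (AddMonoid.End (AddMonoid.End A)) with h | h
    · exact Subsingleton.elim _ _
    · exact sub_pow_char_pow_of_commute p m hc
  have h3 : ∀ k (Q : AddMonoid.End A), (r ^ k) Q = Q * μ ^ k := by
    intro k
    induction k with
    | zero => intro Q; simp
    | succ k ih => intro Q; rw [pow_succ, pow_succ']; exact (ih _).trans (mul_assoc _ _ _)
  have h4 : ∀ k (Q : AddMonoid.End A), (l ^ k) Q = μ ^ k * Q := by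
    intro k
    induction k with
    | zero => intro Q; simp
    | succ k ih => intro Q; rw [pow_succ, pow_succ]; exact (ih _).trans (mul_assoc _ _ _).symm
  have h5 : P * μ ^ p ^ m = μ ^ p ^ m * P := by
    rw [h2] at h1
    have : (r ^ p ^ m) P - (l ^ p ^ m) P = 0 := h1
    rwa [h3, h4, sub_eq_zero] at this
  rw [hμ, ← map_pow] at h5
  exact DFunLike.congr_fun h5 b

end IsDiffOp


/-! ### Extending operators to localizations -/

section Localization

variable {A E : Type*} [CommRing A] [AddCommGroup E] [Module A E] (S : Submonoid A)

/-- A level of an operator. -/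
def pLinEnd.level (T : pLinEnd p A E) : ℕ := T.2.choose

theorem pLinEnd.level_spec (T : pLinEnd p A E) (a : A) (x : E) :
    T.1 (a ^ p ^ (pLinEnd.level T) • x) = a ^ p ^ (pLinEnd.level T) • T.1 x := T.2.choose_spec a x

/-- If `T` commutes with `N`-th powers for some `N ≥ 1`, it extends to the localization by
`T (z / s) = T (s ^ (N - 1) z) / s ^ N`. -/
theorem loc_wd {N : ℕ} (hN : 0 < N) {T : AddMonoid.End E}
    (hT : ∀ (a : A) (x : E), T (a ^ N • x) = a ^ N • T x) (z z' : E) (s s' : S)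
    (h : LocalizedModule.mk z s = LocalizedModule.mk z' s') :
    LocalizedModule.mk (T ((s : A) ^ (N - 1) • z)) (s ^ N) =
      LocalizedModule.mk (T ((s' : A) ^ (N - 1) • z')) (s' ^ N) := by
  obtain ⟨u, hu⟩ := LocalizedModule.mk_eq.1 h
  obtain ⟨k, rfl⟩ : ∃ k, N = k + 1 := ⟨_, (Nat.sub_add_cancel hN).symm⟩
  rw [LocalizedModule.mk_eq]
  refine ⟨u ^ (k + 1), ?_⟩
  have hu' : ((u : A) * (s' : A)) • z = ((u : A) * (s : A)) • z' := by
    simpa only [Submonoid.smul_def, smul_smul] using hu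
  simp only [Submonoid.smul_def, SubmonoidClass.coe_pow, ← hT, smul_smul, Nat.add_sub_cancel]
  congr 1
  have e1 : (u : A) ^ (k + 1) * ((s' : A) ^ (k + 1) * (s : A) ^ k) =
      ((u : A) ^ k * (s' : A) ^ k * (s : A) ^ k) * (u * s') := by ring
  have e2 : (u : A) ^ (k + 1) * ((s : A) ^ (k + 1) * (s' : A) ^ k) =
      ((u : A) ^ k * (s' : A) ^ k * (s : A) ^ k) * (u * s) := by ring
  rw [e1, e2, mul_smul _ ((u : A) * s'), mul_smul _ ((u : A) * s), hu']

/-- The extension of `T` to the localization `S⁻¹E`: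
`z / s = s ^ (N - 1) z / s ^ N ↦ T (s ^ (N - 1) z) / s ^ N` whenever `T` commutes with `N`-th
powers. -/
def locFun (T : pLinEnd p A E) : AddMonoid.End (LocalizedModule S E) where
  toFun w := LocalizedModule.liftOn w
    (fun zs => LocalizedModule.mk (T.1 ((zs.2 : A) ^ (p ^ (pLinEnd.level T) - 1) • zs.1))
      (zs.2 ^ p ^ (pLinEnd.level T)))
    (fun zs zs' h => loc_wd S (pow_pos hp.out.pos _) (pLinEnd.level_spec T) _ _ _ _
      (LocalizedModule.mk_eq.2 h))
  map_zero' := by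
    rw [← LocalizedModule.zero_mk 1, LocalizedModule.liftOn_mk]
    simp
  map_add' := by
    intro w w'
    induction w, w' using LocalizedModule.induction_on₂ with
    | h z z' s s' =>
      rw [LocalizedModule.mk_add_mk]
      simp only [LocalizedModule.liftOn_mk]
      rw [LocalizedModule.mk_add_mk, mul_pow, smul_add, map_add]
      congr 2
      · simp only [Submonoid.smul_def, SubmonoidClass.coe_pow, ← (pLinEnd.level_spec T), smul_smul,
          Submonoid.coe_mul]
        congr 2
        obtain ⟨k, hk⟩ : ∃ j, p ^ (pLinEnd.level T) = j + 1 :=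
          ⟨_, (Nat.sub_add_cancel (pow_pos hp.out.pos _)).symm⟩
        rw [hk, Nat.add_sub_cancel]; ring
      · simp only [Submonoid.smul_def, SubmonoidClass.coe_pow, ← (pLinEnd.level_spec T), smul_smul,
          Submonoid.coe_mul]
        congr 2
        obtain ⟨k, hk⟩ : ∃ j, p ^ (pLinEnd.level T) = j + 1 :=
          ⟨_, (Nat.sub_add_cancel (pow_pos hp.out.pos _)).symm⟩
        rw [hk, Nat.add_sub_cancel]; ring

theorem locFun_mk (T : pLinEnd p A E) {m : ℕ}
    (hT : ∀ (a : A) (x : E), T.1 (a ^ p ^ m • x) = a ^ p ^ m • T.1 x) (z : E) (s : S) :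
    locFun S T (LocalizedModule.mk z s) =
      LocalizedModule.mk (T.1 ((s : A) ^ (p ^ m - 1) • z)) (s ^ p ^ m) := by
  change LocalizedModule.mk (T.1 ((s : A) ^ (p ^ (pLinEnd.level T) - 1) • z)) (s ^ p ^ (pLinEnd.level T)) = _
  rw [LocalizedModule.mk_eq]
  refine ⟨1, ?_⟩
  simp only [one_smul, Submonoid.smul_def, SubmonoidClass.coe_pow, ← (pLinEnd.level_spec T), ← hT, smul_smul]
  congr 2
  obtain ⟨k, hk⟩ : ∃ j, p ^ (pLinEnd.level T) = j + 1 :=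
    ⟨_, (Nat.sub_add_cancel (pow_pos hp.out.pos _)).symm⟩
  obtain ⟨l, hl⟩ : ∃ j, p ^ m = j + 1 :=
    ⟨_, (Nat.sub_add_cancel (pow_pos hp.out.pos _)).symm⟩
  rw [hk, hl, Nat.add_sub_cancel, Nat.add_sub_cancel]; ring

/-- When the denominator is an `N`-th power, with `T` commuting with `N`-th powers, `T` acts on
the numerator. -/
theorem locFun_mk_pow (T : pLinEnd p A E) {m : ℕ}
    (hT : ∀ (a : A) (x : E), T.1 (a ^ p ^ m • x) = a ^ p ^ m • T.1 x) (z : E) (s : S) :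
    locFun S T (LocalizedModule.mk z (s ^ p ^ m)) = LocalizedModule.mk (T.1 z) (s ^ p ^ m) := by
  rw [locFun_mk S T hT, LocalizedModule.mk_eq]
  refine ⟨1, ?_⟩
  obtain ⟨l, hl⟩ : ∃ j, p ^ m = j + 1 :=
    ⟨_, (Nat.sub_add_cancel (pow_pos hp.out.pos _)).symm⟩
  simp only [one_smul, Submonoid.smul_def, SubmonoidClass.coe_pow, ← hT, smul_smul]
  rw [← pow_mul, mul_comm (p ^ m) (p ^ m - 1), pow_mul, ← mul_pow, hT, ← hT]
  congr 2
  rw [hl, Nat.add_sub_cancel]; ring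

/-- Extension of operators to the localization is a ring homomorphism. -/
def locEnd : pLinEnd p A E →+* AddMonoid.End (LocalizedModule S E) where
  toFun := locFun S
  map_one' := by
    ext w
    induction w using LocalizedModule.induction_on with
    | h z s =>
      rw [locFun_mk S 1 (m := 0) (fun _ _ => rfl)]
      simp
  map_zero' := by
    ext w
    induction w using LocalizedModule.induction_on with
    | h z s =>
      rw [locFun_mk S 0 (m := 0) (fun _ _ => (smul_zero _).symm)]
      exact LocalizedModule.zero_mk _
  map_mul' T T' := by
    ext w
    obtain ⟨m, hm⟩ := T.2
    obtain ⟨n, hn⟩ := T'.2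
    have hm' := pLin_mono (Nat.le_add_right m n) hm
    have hn' := pLin_mono (Nat.le_add_left n m) hn
    induction w using LocalizedModule.induction_on with
    | h z s =>
      change _ = locFun S T (locFun S T' (LocalizedModule.mk z s))
      rw [locFun_mk S T' hn', locFun_mk_pow S T hm', locFun_mk S (T * T') (m := m + n)]
      · rfl
      · intro a x
        exact (congrArg T.1 (hn' a x)).trans (hm' a _)
  map_add' T T' := by
    ext w
    obtain ⟨m, hm⟩ := T.2
    obtain ⟨n, hn⟩ := T'.2
    have hm' := pLin_mono (Nat.le_add_right m n) hm
    have hn' := pLin_mono (Nat.le_add_left n m) hn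
    induction w using LocalizedModule.induction_on with
    | h z s =>
      change _ = locFun S T (LocalizedModule.mk z s) + locFun S T' (LocalizedModule.mk z s)
      rw [locFun_mk S T' hn', locFun_mk S T hm', locFun_mk S (T + T') (m := m + n)]
      · rw [LocalizedModule.mk_add_mk, ← smul_add, LocalizedModule.mk_cancel_common_left]; rfl
      · intro a x
        exact (congrArg₂ (· + ·) (hm' a x) (hn' a x)).trans (smul_add _ _ _).symm

end Localization

/-! ### Operators on `M[t]` -/

section Poly

open Polynomial

variable (R M) in
/-- The operator `x t ^ i ↦ T i x t ^ i` on `M[t]`. -/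
def graded (T : ℕ → AddMonoid.End M) : AddMonoid.End (PolynomialModule R M) :=
  (PolynomialModule.coeffAddEquiv (R := R) (M := M)).symm.toAddMonoidHom.comp
    ((Finsupp.liftAddHom fun i => (Finsupp.singleAddHom i).comp (T i)).comp
      (PolynomialModule.coeffAddEquiv (R := R) (M := M)).toAddMonoidHom)

theorem graded_single (T : ℕ → AddMonoid.End M) (i : ℕ) (x : M) :
    graded R M T (PolynomialModule.single R i x) = PolynomialModule.single R i (T i x) := by
  change PolynomialModule.ofCoeff R (Finsupp.liftAddHom
    (fun i => (Finsupp.singleAddHom i).comp (T i)) (Finsupp.single i x)) = _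
  rw [Finsupp.liftAddHom_apply_single]; rfl

theorem graded_ext {S T : AddMonoid.End (PolynomialModule R M)}
    (h : ∀ i x, S (PolynomialModule.single R i x) = T (PolynomialModule.single R i x)) :
    S = T := by
  refine DFunLike.ext _ _ fun z => ?_
  induction z using PolynomialModule.induction_linear with
  | zero => rw [map_zero, map_zero]
  | add x y hx hy => rw [map_add, map_add, hx, hy]
  | single i x => exact h i x

instance : IsFpRing p R[X] := ⟨by
  rw [← map_natCast (C : R →+* R[X]), IsFpRing.cast_eq_zero (p := p) (R := R), map_zero]⟩

theorem graded_pLin {m : ℕ} {T : ℕ → AddMonoid.End M}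
    (h : ∀ (k i : ℕ) (a : R) (x : M), T (k * p ^ m + i) (a ^ p ^ m • x) = a ^ p ^ m • T i x)
    (g : R[X]) (z : PolynomialModule R M) :
    graded R M T (g ^ p ^ m • z) = g ^ p ^ m • graded R M T z := by
  induction g using Polynomial.induction_on' with
  | add g g' hg hg' => rw [IsFpRing.add_pow p, add_smul, map_add, hg, hg', add_smul]
  | monomial k a =>
    induction z using PolynomialModule.induction_linear with
    | zero => rw [smul_zero, map_zero, smul_zero]
    | add x y hx hy => rw [smul_add, map_add, hx, hy, map_add, smul_add]
    | single i x =>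
      rw [monomial_pow, PolynomialModule.monomial_smul_single, graded_single, graded_single,
        PolynomialModule.monomial_smul_single, h]

variable (p R M) in
/-- The action of an operator `T` of `M` on `M[t]`, coefficientwise. -/
def polyEnd : pLinEnd p R M →+* pLinEnd p R[X] (PolynomialModule R M) where
  toFun T := ⟨graded R M fun _ => T.1, by
    obtain ⟨m, hm⟩ := T.2
    exact ⟨m, graded_pLin fun _ _ a x => hm a x⟩⟩
  map_one' := Subtype.ext (graded_ext fun i x => graded_single _ i x)
  map_zero' := Subtype.ext (graded_ext fun i x =>
    (graded_single _ i x).trans (PolynomialModule.single_zero i))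
  map_mul' S T := Subtype.ext (graded_ext fun i x => by
    change graded R M _ _ = graded R M _ (graded R M _ _)
    rw [graded_single, graded_single, graded_single]; rfl)
  map_add' S T := Subtype.ext (graded_ext fun i x => by
    change graded R M _ _ = graded R M _ _ + graded R M _ _
    rw [graded_single, graded_single, graded_single, ← PolynomialModule.single_add]; rfl)

variable (p) in
/-- The ring `𝒞 = C(ℤ_p, 𝔽_p)` of locally constant functions. -/
abbrev LC : Type := LocallyConstant ℤ_[p] (ZMod p)

/-- A locally constant function on `ℤ_p` factors through `ℤ / p ^ m`, for some `m`. -/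
theorem LC.exists_level (φ : LC p) :
    ∃ m : ℕ, ∀ a b : ℤ_[p], (p : ℤ_[p]) ^ m ∣ a - b → φ a = φ b := by
  obtain ⟨δ, hδ, h⟩ := lebesgue_number_lemma_of_metric (isCompact_univ (X := ℤ_[p]))
    (c := fun y : ZMod p => φ ⁻¹' {y}) (fun y => φ.isLocallyConstant.isOpen_fiber y)
    (fun x _ => Set.mem_iUnion.2 ⟨φ x, rfl⟩)
  obtain ⟨m, hm⟩ := PadicInt.exists_pow_neg_lt p hδ
  refine ⟨m, fun a b hab => ?_⟩
  obtain ⟨y, hy⟩ := h b (Set.mem_univ _)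
  have h1 : a ∈ Metric.ball b δ := by
    rw [Metric.mem_ball, dist_eq_norm]
    exact lt_of_le_of_lt ((PadicInt.norm_le_pow_iff_mem_span_pow _ _).2
      (Ideal.mem_span_singleton.2 hab)) hm
  exact (hy h1).trans (hy (Metric.mem_ball_self hδ)).symm

variable (p R M) in
/-- The action of `𝒞` on `M[t]` by `φ · x t ^ i = φ(-i-1) x t ^ i`, through the isomorphism of
`𝒞` with the ring of degree-preserving differential operators on `𝔽_p[t]`. -/
def lcEnd : LC p →+* pLinEnd p R[X] (PolynomialModule R M) where
  toFun φ := ⟨graded R M fun i =>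
      Module.toAddMonoidEnd R M (fpCast p R (φ (-(i : ℤ_[p]) - 1))), by
    obtain ⟨m, hm⟩ := LC.exists_level φ
    refine ⟨m, graded_pLin fun k i a x => ?_⟩
    have : φ (-((k * p ^ m + i : ℕ) : ℤ_[p]) - 1) = φ (-(i : ℤ_[p]) - 1) :=
      hm _ _ ⟨-k, by push_cast; ring⟩
    rw [this]
    exact smul_comm _ _ _⟩
  map_one' := Subtype.ext (graded_ext fun i x => by
    rw [graded_single]
    change PolynomialModule.single R i (fpCast p R 1 • x) = _
    rw [map_one, one_smul]; rfl)
  map_zero' := Subtype.ext (graded_ext fun i x => by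
    rw [graded_single]
    change PolynomialModule.single R i (fpCast p R 0 • x) = 0
    rw [map_zero, zero_smul, PolynomialModule.single_zero])
  map_mul' φ ψ := Subtype.ext (graded_ext fun i x => by
    change graded R M _ _ = graded R M _ (graded R M _ _)
    rw [graded_single, graded_single, graded_single]
    change PolynomialModule.single R i (fpCast p R (φ _ * ψ _) • x) = _
    rw [map_mul, mul_smul]; rfl)
  map_add' φ ψ := Subtype.ext (graded_ext fun i x => by
    change graded R M _ _ = graded R M _ _ + graded R M _ _
    rw [graded_single, graded_single, graded_single, ← PolynomialModule.single_add]
    change PolynomialModule.single R i (fpCast p R (φ _ + ψ _) • x) = _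
    rw [map_add, add_smul]; rfl)

/-! ### The graph construction -/

/-- The powers of `f - t` in `R[t]`. -/
abbrev graphPowers (f : R) : Submonoid R[X] := Submonoid.powers (C f - X)

/-- `γ_+ M = (R[t] ⊗ M) ⊗_{R[t]} B_f` with `B_f = R[t, 1/(f-t)] / R[t]`, written as the quotient
`M[t, 1/(f-t)] / M[t]`. -/
def GammaPlus (f : R) (M : Type*) [AddCommGroup M] [Module R M] : Type _ :=
  LocalizedModule (graphPowers f) (PolynomialModule R M) ⧸
    (LocalizedModule.mkLinearMap (graphPowers f) (PolynomialModule R M)).toAddMonoidHom.range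

instance (f : R) : AddCommGroup (GammaPlus f M) :=
  inferInstanceAs (AddCommGroup (LocalizedModule (graphPowers f) (PolynomialModule R M) ⧸
    (LocalizedModule.mkLinearMap (graphPowers f) (PolynomialModule R M)).toAddMonoidHom.range))

/-- The class in `γ_+ M` of the fraction `z / s`. -/
def GammaPlus.mk (f : R) : LocalizedModule (graphPowers f) (PolynomialModule R M) →+ GammaPlus f M :=
  QuotientAddGroup.mk' _

/-- The element `x δ_0` of `γ_+ M`, where `δ_0 = 1 / (f - t)`. -/
def GammaPlus.delta (f : R) (x : M) : GammaPlus f M :=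
  GammaPlus.mk f (LocalizedModule.mk (PolynomialModule.single R 0 x)
    ⟨C f - X, Submonoid.mem_powers _⟩)

theorem locFun_range (f : R) (T : pLinEnd p R[X] (PolynomialModule R M)) :
    (LocalizedModule.mkLinearMap (graphPowers f) (PolynomialModule R M)).toAddMonoidHom.range ≤
    (LocalizedModule.mkLinearMap (graphPowers f) (PolynomialModule R M)).toAddMonoidHom.range.comap
      (locFun (graphPowers f) T) := by
  rintro _ ⟨z, rfl⟩
  refine ⟨T.1 z, ?_⟩
  have h := locFun_mk (graphPowers f) T T.2.choose_spec z 1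
  simp only [OneMemClass.coe_one, one_pow, one_smul] at h
  exact h.symm

variable (p M) in
/-- The action on `γ_+ M` of operators on `M[t]`. -/
def gammaEnd (f : R) :
    pLinEnd p R[X] (PolynomialModule R M) →+* AddMonoid.End (GammaPlus f M) where
  toFun T := QuotientAddGroup.map _ _ (locFun (graphPowers f) T) (locFun_range f T)
  map_one' := by
    ext w
    obtain ⟨w, rfl⟩ := QuotientAddGroup.mk_surjective w
    exact congrArg (GammaPlus.mk f) (DFunLike.congr_fun (map_one (locEnd (graphPowers f))) w)
  map_zero' := by
    ext w
    obtain ⟨w, rfl⟩ := QuotientAddGroup.mk_surjective w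
    exact congrArg (GammaPlus.mk f) (DFunLike.congr_fun (map_zero (locEnd (graphPowers f))) w)
  map_mul' S T := by
    ext w
    obtain ⟨w, rfl⟩ := QuotientAddGroup.mk_surjective w
    exact congrArg (GammaPlus.mk f) (DFunLike.congr_fun (map_mul (locEnd (graphPowers f)) S T) w)
  map_add' S T := by
    ext w
    obtain ⟨w, rfl⟩ := QuotientAddGroup.mk_surjective w
    exact congrArg (GammaPlus.mk f) (DFunLike.congr_fun (map_add (locEnd (graphPowers f)) S T) w)

theorem gammaEnd_mk (f : R) (T : pLinEnd p R[X] (PolynomialModule R M))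
    (w : LocalizedModule (graphPowers f) (PolynomialModule R M)) :
    gammaEnd p M f T (GammaPlus.mk f w) = GammaPlus.mk f (locFun (graphPowers f) T w) := rfl

instance (f : R) : Module (LC p) (GammaPlus f M) :=
  Module.compHom (GammaPlus f M) ((gammaEnd p M f).comp (lcEnd p R M))

theorem GammaPlus.lc_smul_def (f : R) (φ : LC p) (w : GammaPlus f M) :
    φ • w = gammaEnd p M f (lcEnd p R M φ) w := rfl

end Poly
end Ring

section Functoriality

variable {p : ℕ} [hp : Fact p.Prime]

/-- The map `z / s ↦ ρ(z) / τ(s)` between localizations, for `ρ` semilinear over `τ`. -/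
def locMap {A A' E E' : Type*} [CommRing A] [CommRing A'] [AddCommGroup E] [AddCommGroup E']
    [Module A E] [Module A' E'] (τ : A →+* A') (ρ : E →+ E')
    (hρ : ∀ (a : A) (z : E), ρ (a • z) = τ a • ρ z) (S : Submonoid A) (S' : Submonoid A')
    (hS : S ≤ S'.comap τ) : LocalizedModule S E →+ LocalizedModule S' E' where
  toFun w := LocalizedModule.liftOn w
    (fun zs => LocalizedModule.mk (ρ zs.1) ⟨τ zs.2, hS zs.2.2⟩)
    (fun zs zs' h => by
      obtain ⟨u, hu⟩ := h
      rw [LocalizedModule.mk_eq]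
      refine ⟨⟨τ u, hS u.2⟩, ?_⟩
      simpa only [Submonoid.smul_def, hρ] using congrArg ρ hu)
  map_zero' := by
    rw [← LocalizedModule.zero_mk 1, LocalizedModule.liftOn_mk]
    simp
  map_add' := by
    intro w w'
    induction w, w' using LocalizedModule.induction_on₂ with
    | h z z' s s' =>
      rw [LocalizedModule.mk_add_mk]
      simp only [LocalizedModule.liftOn_mk]
      rw [LocalizedModule.mk_add_mk]
      simp only [Submonoid.smul_def, map_add, hρ, Submonoid.coe_mul, map_mul]
      rfl

theorem locMap_mk {A A' E E' : Type*} [CommRing A] [CommRing A'] [AddCommGroup E]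
    [AddCommGroup E'] [Module A E] [Module A' E'] (τ : A →+* A') (ρ : E →+ E')
    (hρ : ∀ (a : A) (z : E), ρ (a • z) = τ a • ρ z) (S : Submonoid A) (S' : Submonoid A')
    (hS : S ≤ S'.comap τ) (z : E) (s : S) :
    locMap τ ρ hρ S S' hS (LocalizedModule.mk z s) =
      LocalizedModule.mk (ρ z) ⟨τ s, hS s.2⟩ := rfl

theorem locMap_locFun {A A' E E' : Type*} [CommRing A] [CommRing A'] [AddCommGroup E]
    [AddCommGroup E'] [Module A E] [Module A' E'] (τ : A →+* A') (ρ : E →+ E')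
    (hρ : ∀ (a : A) (z : E), ρ (a • z) = τ a • ρ z) (S : Submonoid A) (S' : Submonoid A')
    (hS : S ≤ S'.comap τ) (T : pLinEnd p A E) (T' : pLinEnd p A' E')
    (hT : ∀ z, ρ (T.1 z) = T'.1 (ρ z)) (w : LocalizedModule S E) :
    locMap τ ρ hρ S S' hS (locFun S T w) = locFun S' T' (locMap τ ρ hρ S S' hS w) := by
  obtain ⟨m, hm⟩ := T.2
  obtain ⟨n, hn⟩ := T'.2
  have hm' := pLin_mono (Nat.le_add_right m n) hm
  have hn' := pLin_mono (Nat.le_add_left n m) hn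
  induction w using LocalizedModule.induction_on with
  | h z s =>
    rw [locFun_mk S T hm', locMap_mk, locMap_mk, locFun_mk S' T' hn', hT, hρ, map_pow]
    congr 1
    exact Subtype.ext (map_pow τ _ _)

variable {R R' M M' : Type*} [CommRing R] [CommRing R'] [AddCommGroup M] [AddCommGroup M']
  [Module R M] [Module R' M']

/-- The coefficientwise map `M[t] → M'[t]`. -/
def polyMap (R R' : Type*) [CommRing R] [CommRing R'] [Module R M] [Module R' M'] (ρ : M →+ M') :
    PolynomialModule R M →+ PolynomialModule R' M' :=
  (PolynomialModule.coeffAddEquiv (R := R') (M := M')).symm.toAddMonoidHom.comp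
    ((Finsupp.mapRange.addMonoidHom ρ).comp
      (PolynomialModule.coeffAddEquiv (R := R) (M := M)).toAddMonoidHom)

theorem polyMap_single (ρ : M →+ M') (i : ℕ) (x : M) :
    polyMap R R' ρ (PolynomialModule.single R i x) = PolynomialModule.single R' i (ρ x) := by
  change PolynomialModule.ofCoeff R' (Finsupp.mapRange ρ ρ.map_zero (Finsupp.single i x)) = _
  rw [Finsupp.mapRange_single]; rfl

theorem polyMap_smul (σ : R →+* R') (ρ : M →+ M') (hρ : ∀ (a : R) (x : M), ρ (a • x) = σ a • ρ x)
    (g : Polynomial R) (z : PolynomialModule R M) :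
    polyMap R R' ρ (g • z) = Polynomial.mapRingHom σ g • polyMap R R' ρ z := by
  induction g using Polynomial.induction_on' with
  | add g g' hg hg' => rw [add_smul, map_add, hg, hg', map_add, add_smul]
  | monomial k a =>
    induction z using PolynomialModule.induction_linear with
    | zero => rw [smul_zero, map_zero, smul_zero]
    | add x y hx hy => rw [smul_add, map_add, hx, hy, map_add, smul_add]
    | single i x =>
      rw [PolynomialModule.monomial_smul_single, polyMap_single, polyMap_single, hρ,
        Polynomial.coe_mapRingHom, Polynomial.map_monomial, PolynomialModule.monomial_smul_single]

theorem graphPowers_le (σ : R →+* R') {f : R} {f' : R'} (hf : σ f = f') :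
    graphPowers f ≤ (graphPowers f').comap (Polynomial.mapRingHom σ) := by
  rw [Submonoid.powers_le]
  refine ⟨1, ?_⟩
  simp [hf]

variable [IsFpRing p R] [IsFpRing p R']

variable (p) in
/-- The map `γ_+ M → γ_+ M'` induced by a semilinear map `M → M'`. -/
def gammaMap (σ : R →+* R') (ρ : M →+ M') (hρ : ∀ (a : R) (x : M), ρ (a • x) = σ a • ρ x)
    {f : R} {f' : R'} (hf : σ f = f') : GammaPlus f M →ₗ[LC p] GammaPlus f' M' where
  toFun := QuotientAddGroup.map _ _
    (locMap (Polynomial.mapRingHom σ) (polyMap R R' ρ) (polyMap_smul σ ρ hρ) _ _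
      (graphPowers_le σ hf)) (by
        rintro _ ⟨z, rfl⟩
        refine ⟨polyMap R R' ρ z, ?_⟩
        refine Eq.trans ?_ (locMap_mk _ _ (polyMap_smul σ ρ hρ) _ _
          (graphPowers_le σ hf) _ _).symm
        change LocalizedModule.mk _ _ = _
        congr 1
        exact Subtype.ext (map_one _).symm)
  map_add' := map_add _
  map_smul' φ w := by
    obtain ⟨w, rfl⟩ := QuotientAddGroup.mk_surjective w
    refine congrArg (GammaPlus.mk f') (locMap_locFun _ _ (polyMap_smul σ ρ hρ) _ _
      (graphPowers_le σ hf) (lcEnd p R M φ) (lcEnd p R' M' φ) (fun z => ?_) w)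
    induction z using PolynomialModule.induction_linear with
    | zero => simp only [map_zero]
    | add x y hx hy => simp only [map_add, hx, hy]
    | single i x =>
      change polyMap R R' ρ (graded R M _ _) = graded R' M' _ _
      rw [graded_single, polyMap_single, polyMap_single, graded_single]
      change PolynomialModule.single R' i (ρ (fpCast p R _ • x)) =
        PolynomialModule.single R' i (fpCast p R' _ • ρ x)
      rw [hρ]
      congr 2
      exact DFunLike.congr_fun (Subsingleton.elim (σ.comp (fpCast p R)) (fpCast p R')) _

variable (p) in
/-- The `𝒞`-module `𝔽_p`, where `𝒞` acts through the evaluation `ev_α` at `α ∈ ℤ_p`. -/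
@[nolint unusedArguments]
def EvalPt (_α : ℤ_[p]) : Type := ZMod p

instance (α : ℤ_[p]) : AddCommGroup (EvalPt p α) := inferInstanceAs (AddCommGroup (ZMod p))

instance (α : ℤ_[p]) : Module (LC p) (EvalPt p α) :=
  Module.compHom (ZMod p) (LocallyConstant.evalRingHom (Y := ZMod p) α)

/-- The fibre `(γ_+ M)_α = 𝔽_p ⊗_{ev_α, 𝒞} γ_+ M`. -/
abbrev GammaFibre (α : ℤ_[p]) (f : R) (M : Type*) [AddCommGroup M] [Module R M] : Type _ :=
  EvalPt p α ⊗[LC p] GammaPlus f M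

end Functoriality

section Sheaf

/-- A scheme over `𝔽_p`. -/
class IsFpScheme (p : ℕ) (X : Scheme.{u}) : Prop where
  cast_eq_zero : (p : Γ(X, ⊤)) = 0

variable {X : Scheme.{u}}

/-- Restriction of functions. -/
def res {V U : X.Opens} (h : V ≤ U) : Γ(X, U) →+* Γ(X, V) := (X.presheaf.map (homOfLE h).op).hom

theorem res_res {W V U : X.Opens} (h : V ≤ U) (h' : W ≤ V) (a : Γ(X, U)) :
    res h' (res h a) = res (h'.trans h) a := by
  change (X.presheaf.map (homOfLE h).op ≫ X.presheaf.map (homOfLE h').op).hom a = _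
  rw [← X.presheaf.map_comp]; rfl

theorem res_self {U : X.Opens} (h : U ≤ U) (a : Γ(X, U)) : res h a = a := by
  have : (homOfLE h).op = 𝟙 _ := rfl
  change (X.presheaf.map (homOfLE h).op).hom a = a
  rw [this, X.presheaf.map_id]; rfl

instance (p : ℕ) [h : IsFpScheme p X] (U : X.Opens) : IsFpRing p Γ(X, U) := ⟨by
  rw [← map_natCast (res (le_top : U ≤ ⊤)), h.cast_eq_zero, map_zero]⟩

variable {𝓜 : X.Modules}

/-- Restriction of sections of a sheaf of modules. -/
def mres {V U : X.Opens} (h : V ≤ U) : Γ(𝓜, U) →+ Γ(𝓜, V) :=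
  (𝓜.presheaf.map (homOfLE h).op).hom

theorem mres_mres {W V U : X.Opens} (h : V ≤ U) (h' : W ≤ V) (x : Γ(𝓜, U)) :
    mres h' (mres h x) = mres (h'.trans h) x := by
  change (𝓜.presheaf.map (homOfLE h).op ≫ 𝓜.presheaf.map (homOfLE h').op).hom x = _
  rw [← 𝓜.presheaf.map_comp]; rfl

theorem mres_smul {V U : X.Opens} (h : V ≤ U) (a : Γ(X, U)) (x : Γ(𝓜, U)) :
    mres h (a • x) = res h a • mres h x :=
  Scheme.Modules.map_smul 𝓜 (homOfLE h) a x

/-! ### Differential operators and modules over them -/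

variable (X) in
/-- The ring `𝓓_X(U)` of Grothendieck differential operators on `U`: endomorphisms of the sheaf of
abelian groups `𝓞_U` which are differential operators of bounded order on the sections over each
open subset. -/
def diffOps (U : X.Opens) : Subring (∀ V : {V : X.Opens // V ≤ U}, AddMonoid.End Γ(X, V.1)) where
  carrier := {P | (∀ (V W : {V : X.Opens // V ≤ U}) (h : W.1 ≤ V.1) (a : Γ(X, V.1)),
      res h (P V a) = P W (res h a)) ∧ ∃ n : ℕ, ∀ V, IsDiffOp n (P V)}
  one_mem' := ⟨fun _ _ _ _ => rfl, 1, fun V a => by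
    rw [Pi.one_apply, one_mul, mul_one, sub_self]; rfl⟩
  zero_mem' := ⟨fun _ _ h _ => map_zero (res h), 0, fun _ => rfl⟩
  neg_mem' := by
    rintro P ⟨hP, n, hn⟩
    refine ⟨fun V W h a => ?_, n, fun V => (hn V).neg⟩
    exact (map_neg (res h) (P V a)).trans (congrArg _ (hP V W h a))
  mul_mem' := by
    rintro P Q ⟨hP, m, hm⟩ ⟨hQ, n, hn⟩
    refine ⟨fun V W h a => ?_, m + n, fun V => (hm V).mul (hn V)⟩
    exact (hP V W h (Q V a)).trans (congrArg (P W) (hQ V W h a))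
  add_mem' := by
    rintro P Q ⟨hP, m, hm⟩ ⟨hQ, n, hn⟩
    refine ⟨fun V W h a => ?_, max m n, fun V =>
      ((hm V).mono (le_max_left _ _)).add ((hn V).mono (le_max_right _ _))⟩
    exact (map_add (res h) (P V a) (Q V a)).trans
      (congrArg₂ (· + ·) (hP V W h a) (hQ V W h a))

/-- The action of `P ∈ 𝓓_X(U)` on functions on `U`. -/
def diffOps.toEnd {U : X.Opens} : diffOps X U →+* AddMonoid.End Γ(X, U) :=
  (Pi.evalRingHom _ (⟨U, le_rfl⟩ : {V : X.Opens // V ≤ U})).comp (diffOps X U).subtype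

/-- Restriction of differential operators. -/
def diffRes {V U : X.Opens} (h : V ≤ U) : diffOps X U →+* diffOps X V where
  toFun P := ⟨fun W => P.1 ⟨W.1, W.2.trans h⟩, fun W W' hW a =>
    P.2.1 ⟨W.1, W.2.trans h⟩ ⟨W'.1, W'.2.trans h⟩ hW a,
    P.2.2.choose, fun _ => P.2.2.choose_spec _⟩
  map_one' := rfl
  map_zero' := rfl
  map_mul' _ _ := rfl
  map_add' _ _ := rfl

theorem toEnd_diffRes {V U : X.Opens} (h : V ≤ U) (P : diffOps X U) (a : Γ(X, U)) :
    res h (diffOps.toEnd P a) = diffOps.toEnd (diffRes h P) (res h a) :=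
  P.2.1 ⟨U, le_rfl⟩ ⟨V, h⟩ h a

/-- Multiplication by a function, as a differential operator. -/
def mulOp {U : X.Opens} (a : Γ(X, U)) : diffOps X U :=
  ⟨fun V => Module.toAddMonoidEnd Γ(X, V.1) Γ(X, V.1) (res V.2 a), fun V W h b => by
    change res h (res V.2 a * b) = res W.2 a * res h b
    rw [map_mul, res_res], 1, fun V => IsDiffOp.toAddMonoidEnd _⟩

/-- `P` belongs to `𝓓_X^{(m)}`, that is, `P` is linear over the `p ^ m`-th powers. -/
def IsLevel (p m : ℕ) {U : X.Opens} (P : diffOps X U) : Prop :=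
  ∀ (V : {V : X.Opens // V ≤ U}) (a b : Γ(X, V.1)),
    P.1 V (a ^ p ^ m * b) = a ^ p ^ m * P.1 V b

variable (𝓜) in
/-- A `𝓓_X`-module structure on an `𝓞_X`-module, extending the `𝓞_X`-module structure. It is given
on the sections over affine open subsets, compatibly with restriction. -/
structure DModuleStr where
  act (U : X.affineOpens) : diffOps X U.1 →+* AddMonoid.End Γ(𝓜, U.1)
  act_mulOp (U : X.affineOpens) (a : Γ(X, U.1)) (x : Γ(𝓜, U.1)) : act U (mulOp a) x = a • x
  act_res (U V : X.affineOpens) (h : V.1 ≤ U.1) (P : diffOps X U.1) (x : Γ(𝓜, U.1)) :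
    mres h (act U P x) = act V (diffRes h P) (mres h x)

section

variable (p : ℕ) [hp : Fact p.Prime] [IsFpScheme p X]

theorem diffOps.exists_level {U : X.Opens} (P : diffOps X U) : ∃ m : ℕ, IsLevel p m P := by
  obtain ⟨n, hn⟩ := P.2.2
  exact ⟨n, fun V a b => (hn V).pLin p (Nat.lt_pow_self hp.out.one_lt).le a b⟩

theorem diffOps.toEnd_mem {U : X.Opens} (P : diffOps X U) :
    diffOps.toEnd P ∈ pLinEnd p Γ(X, U) Γ(X, U) := by
  obtain ⟨m, hm⟩ := diffOps.exists_level p P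
  exact ⟨m, hm ⟨U, le_rfl⟩⟩

/-- The action on functions, with values in the operators linear over high `p`-power powers. -/
def diffOps.toPLin (U : X.Opens) : diffOps X U →+* pLinEnd p Γ(X, U) Γ(X, U) :=
  diffOps.toEnd.codRestrict _ (diffOps.toEnd_mem p)

theorem DModuleStr.act_mem (D : DModuleStr 𝓜) (U : X.affineOpens) (P : diffOps X U.1) :
    D.act U P ∈ pLinEnd p Γ(X, U.1) Γ(𝓜, U.1) := by
  obtain ⟨m, hm⟩ := diffOps.exists_level p P
  refine ⟨m, fun a x => ?_⟩
  have h : P * mulOp (a ^ p ^ m) = mulOp (a ^ p ^ m) * P := by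
    ext V b
    change P.1 V (res V.2 (a ^ p ^ m) * b) = res V.2 (a ^ p ^ m) * P.1 V b
    rw [map_pow]
    exact hm V _ _
  have h2 := DFunLike.congr_fun (congrArg (D.act U) h) x
  rw [map_mul, map_mul] at h2
  have h3 : D.act U P (D.act U (mulOp (a ^ p ^ m)) x) =
    D.act U (mulOp (a ^ p ^ m)) (D.act U P x) := h2
  rwa [D.act_mulOp, D.act_mulOp] at h3

/-- The action of a differential operator on `𝓜[t]`. -/
def DModuleStr.polyAct (D : DModuleStr 𝓜) (U : X.affineOpens) :
    diffOps X U.1 →+*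
      pLinEnd p (Polynomial Γ(X, U.1)) (PolynomialModule Γ(X, U.1) Γ(𝓜, U.1)) :=
  (polyEnd p Γ(X, U.1) Γ(𝓜, U.1)).comp ((D.act U).codRestrict _ (D.act_mem p U))

end

/-! ### Cartier modules and `F^e`-modules -/

variable (𝓜) in
/-- A `q`-Cartier module structure on an `𝓞_X`-module, where `q = p ^ e`: a `p⁻ᵉ`-linear operator,
given on the sections over affine open subsets, compatibly with restriction. -/
structure CartierStr (p e : ℕ) where
  op (U : X.affineOpens) : Γ(𝓜, U.1) →+ Γ(𝓜, U.1)
  op_smul (U : X.affineOpens) (a : Γ(X, U.1)) (x : Γ(𝓜, U.1)) :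
    op U (a ^ p ^ e • x) = a • op U x
  op_res (U V : X.affineOpens) (h : V.1 ≤ U.1) (x : Γ(𝓜, U.1)) :
    mres h (op U x) = op V (mres h x)

variable (𝓜) in
/-- An `𝓞_X[F^e]`-module structure: a `p ^ e`-Frobenius-semilinear endomorphism of the sheaf. -/
structure FModule (p e : ℕ) where
  φ (U : X.Opens) : Γ(𝓜, U) →+ Γ(𝓜, U)
  map_smul (U : X.Opens) (a : Γ(X, U)) (x : Γ(𝓜, U)) : φ U (a • x) = a ^ p ^ e • φ U x
  map_res (U V : X.Opens) (h : V ≤ U) (x : Γ(𝓜, U)) : mres h (φ U x) = φ V (mres h x)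

/-- The `F^e`-module of sections over `U`. -/
def FModule.sections {p e : ℕ} (Φ : FModule 𝓜 p e) (U : X.Opens) :
    FMod p e Γ(X, U) Γ(𝓜, U) := ⟨Φ.φ U, Φ.map_smul U⟩

variable {p : ℕ} [hp : Fact p.Prime] [IsFpScheme p X] {e : ℕ}

/-- The structure morphism `F_q^* 𝓜 → 𝓜` is an isomorphism; for quasi-coherent `𝓜` this is
a condition on sections over affine open subsets. -/
def FModule.IsUnit (Φ : FModule 𝓜 p e) : Prop := ∀ U : X.affineOpens, (Φ.sections U.1).IsUnit

theorem FModule.iter_res (Φ : FModule 𝓜 p e) {V U : X.Opens} (h : V ≤ U) (n : ℕ) :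
    ∀ x : Γ(𝓜, U), mres h ((Φ.sections U).iter n x) = (Φ.sections V).iter n (mres h x) := by
  induction n with
  | zero => intro x; rfl
  | succ n ih =>
    intro x
    change mres h ((Φ.sections U).iter n (Φ.φ U x)) =
      (Φ.sections V).iter n (Φ.φ V (mres h x))
    rw [ih, Φ.map_res]

/-- The `𝓓_X`-module structure of a unit `F^e`-module: if `P` commutes with `q ^ n`-th powers, it
acts as `P ⊗ id` on `F_q^{n*} 𝓜 ≅ 𝓜`. -/
def FModule.toDModule (Φ : FModule 𝓜 p e) (he : 0 < e) (hΦ : Φ.IsUnit) : DModuleStr 𝓜 where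
  act U := (FMod.act he (hΦ U)).comp (diffOps.toPLin p U.1)
  act_mulOp U a x := by
    have key : ∀ (b : Γ(X, U.1)) (y : Γ(𝓜, U.1)),
        FMod.actFun he (hΦ U) (diffOps.toPLin p U.1 (mulOp a)) (b • y) = a • b • y := by
      intro b y
      have h := FMod.actFun_iter he (hΦ U) (diffOps.toPLin p U.1 (mulOp a)) 0
        (fun c d => mul_left_comm (res le_rfl a) (c ^ p ^ (e * 0)) d) b y
      refine h.trans ?_
      change (res le_rfl a * b) • y = a • b • y
      rw [res_self, mul_smul]
    have h := key 1 x
    rw [one_smul] at h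
    exact h
  act_res U V h P x := by
    obtain ⟨m, hm⟩ := diffOps.exists_level p P
    have hm' : IsLevel p (e * m) P := fun W =>
      pLin_mono (T := P.1 W) (Nat.le_mul_of_pos_left m he) (hm W)
    change mres h (FMod.actFun he (hΦ U) (diffOps.toPLin p U.1 P) x) =
      FMod.actFun he (hΦ V) (diffOps.toPLin p V.1 (diffRes h P)) (mres h x)
    induction x using FMod.induction_iter (hΦ U) m with
    | h0 => simp only [map_zero]
    | h1 a x =>
      rw [FMod.actFun_iter he (hΦ U) _ m (hm' ⟨U.1, le_rfl⟩), mres_smul, mres_smul,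
        Φ.iter_res, FMod.actFun_iter he (hΦ V) _ m (hm' ⟨V.1, h⟩)]
      exact congrArg (· • _) (toEnd_diffRes h P a)
    | h2 x y hx hy => simp only [map_add, hx, hy]

variable (X p e) in
/-- A global section of the sheaf `𝓗om(F_{q*} 𝓞_X, 𝓞_X)`, where `q = p ^ e`. -/
structure TraceMap where
  η (U : X.Opens) : Γ(X, U) →+ Γ(X, U)
  map_pow_mul (U : X.Opens) (a b : Γ(X, U)) : η U (a ^ p ^ e * b) = a * η U b
  map_res (U V : X.Opens) (h : V ≤ U) (a : Γ(X, U)) : res h (η U a) = η V (res h a)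

/-- `η` generates `𝓗om(F_{q*} 𝓞_X, 𝓞_X)` as a module over `𝓞_X` acting on the source: each
`p⁻ᵉ`-linear map `ψ` on an affine open subset is `b ↦ η (a b)` for some `a`. -/
def TraceMap.IsGenerator (η : TraceMap X p e) : Prop :=
  ∀ (U : X.affineOpens) (ψ : Γ(X, U.1) →+ Γ(X, U.1)),
    (∀ a b : Γ(X, U.1), ψ (a ^ p ^ e * b) = a * ψ b) →
      ∃ a : Γ(X, U.1), ∀ b : Γ(X, U.1), ψ b = η.η U.1 (a * b)

/-- The `q`-Cartier module associated with a unit `F^e`-module, with `C = (η ⊗ id) ∘ θ`. -/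
def FModule.toCartier (Φ : FModule 𝓜 p e) (hΦ : Φ.IsUnit) (η : TraceMap X p e) :
    CartierStr 𝓜 p e where
  op U := FMod.cartier (hΦ U) (η.η U.1) (η.map_pow_mul U.1)
  op_smul U := FMod.cartier_smul (hΦ U) (η.η U.1) (η.map_pow_mul U.1)
  op_res U V h x := by
    induction x using FMod.induction_phi (hΦ U) with
    | h0 => simp only [map_zero]
    | h1 a x =>
      have e1 : mres h ((Φ.sections U.1).φ x) = (Φ.sections V.1).φ (mres h x) :=
        Φ.map_res U.1 V.1 h x
      rw [FMod.cartier_phi, mres_smul, mres_smul, e1, FMod.cartier_phi, η.map_res]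
    | h2 x y hx hy => simp only [map_add, hx, hy]

/-! ### Submodules -/

variable (𝓜) in
/-- An `𝓞_X`-submodule of `𝓜` (a subsheaf, not necessarily quasi-coherent). -/
structure SubmoduleSheaf where
  carrier (U : X.Opens) : Submodule Γ(X, U) Γ(𝓜, U)
  res_mem {U V : X.Opens} (h : V ≤ U) {x : Γ(𝓜, U)} (hx : x ∈ carrier U) : mres h x ∈ carrier V
  glue {U : X.Opens} {x : Γ(𝓜, U)}
    (hx : ∀ y ∈ U, ∃ (V : X.Opens) (h : V ≤ U), y ∈ V ∧ mres h x ∈ carrier V) : x ∈ carrier U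

namespace SubmoduleSheaf

/-- The submodule `f M`, generated by the products `f y` with local sections `y` of `M`. -/
def smul (f : Γ(X, ⊤)) (M : SubmoduleSheaf 𝓜) : SubmoduleSheaf 𝓜 where
  carrier U :=
    { carrier := {x | ∀ z ∈ U, ∃ (V : X.Opens) (h : V ≤ U), z ∈ V ∧
        ∃ y ∈ M.carrier V, mres h x = res le_top f • y}
      zero_mem' := fun z hz => ⟨U, le_rfl, hz, 0, zero_mem _, by rw [map_zero, smul_zero]⟩
      add_mem' := by
        intro a b ha hb z hz
        obtain ⟨V, h, hV, y, hy, e⟩ := ha z hz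
        obtain ⟨V', h', hV', y', hy', e'⟩ := hb z hz
        refine ⟨V ⊓ V', inf_le_left.trans h, ⟨hV, hV'⟩, mres inf_le_left y + mres inf_le_right y',
          add_mem (M.res_mem _ hy) (M.res_mem _ hy'), ?_⟩
        rw [map_add, ← mres_mres h inf_le_left, e, mres_smul, smul_add, res_res,
          ← mres_mres h' inf_le_right b, e', mres_smul, res_res]
      smul_mem' := by
        intro c a ha z hz
        obtain ⟨V, h, hV, y, hy, e⟩ := ha z hz
        exact ⟨V, h, hV, res h c • y, Submodule.smul_mem _ _ hy, by
          rw [mres_smul, e, smul_comm]⟩ }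
  res_mem := by
    intro U V h x hx z hz
    obtain ⟨W, hW, hzW, y, hy, e⟩ := hx z (h hz)
    refine ⟨W ⊓ V, inf_le_right, ⟨hzW, hz⟩, mres inf_le_left y, M.res_mem _ hy, ?_⟩
    rw [mres_mres, ← mres_mres hW inf_le_left, e, mres_smul, res_res]
  glue := by
    intro U x hx z hz
    obtain ⟨V, h, hV, hxV⟩ := hx z hz
    obtain ⟨W, hW, hzW, y, hy, e⟩ := hxV z hV
    exact ⟨W, hW.trans h, hzW, y, hy, by rw [← mres_mres h hW, e]⟩

/-- `M` is locally finitely generated: locally it is generated by finitely many sections. -/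
def LocallyFG (M : SubmoduleSheaf 𝓜) : Prop :=
  ∀ x : X, ∃ (U : X.Opens) (_ : x ∈ U) (S : Finset Γ(𝓜, U)), (∀ s ∈ S, s ∈ M.carrier U) ∧
    ∀ (V : X.Opens) (h : V ≤ U) (y : Γ(𝓜, V)), y ∈ M.carrier V →
      ∀ z ∈ V, ∃ (W : X.Opens) (hW : W ≤ V), z ∈ W ∧
        mres hW y ∈ Submodule.span Γ(X, W) (mres (hW.trans h) '' (S : Set Γ(𝓜, U)))

end SubmoduleSheaf

/-- The sheaf generated by a family `G` of local sections on affine open subsets of a sheaf on `X`,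
the latter being given by its sections over affine open subsets and its restriction maps `r`. -/
def localClosure {E : X.affineOpens → Type*} (r : ∀ U V : X.affineOpens, V.1 ≤ U.1 → E U → E V)
    (G : ∀ U, Set (E U)) (U : X.affineOpens) : Set (E U) :=
  {s | ∀ x ∈ U.1, ∃ (V : X.affineOpens) (h : V.1 ≤ U.1), x ∈ V.1 ∧ r U V h s ∈ G V}

/-! ### `ν`-invariants -/

namespace CartierStr

variable (C : CartierStr 𝓜 p e) (f : Γ(X, ⊤)) (M : SubmoduleSheaf 𝓜)

/-- The subsheaf `C^m(N)` of `𝓜`. -/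
def image (m : ℕ) (N : SubmoduleSheaf 𝓜) : ∀ U : X.affineOpens, Set Γ(𝓜, U.1) :=
  localClosure (fun _ _ h => mres h) fun U => (C.op U)^[m] '' (N.carrier U.1)

/-- `ν_f(q ^ m; M)`, the set of `n` with `C^m(f ^ n M) ≠ C^m(f ^ (n + 1) M)`. -/
def nu (m : ℕ) : Set ℕ :=
  {n | C.image m (M.smul (f ^ n)) ≠ C.image m (M.smul (f ^ (n + 1)))}

/-- `ν_f(q ^ ∞; M)`, the set of `p`-adic integers `α` which are congruent modulo `q ^ m` to some
element of `ν_f(q ^ m; M)`, for each `m ≥ 1`. -/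
def nuInfty : Set ℤ_[p] :=
  {α | ∀ m : ℕ, 1 ≤ m → ∃ n ∈ C.nu f M m, (p : ℤ_[p]) ^ (e * m) ∣ α - n}

end CartierStr

/-! ### Bernstein-Sato roots -/

namespace DModuleStr

variable (D : DModuleStr 𝓜) (f : Γ(X, ⊤)) (M : SubmoduleSheaf 𝓜)

variable (p) in
/-- The subsheaf `𝓓_X^{(m)} N` of `𝓜`. -/
def levelSpan (m : ℕ) (N : SubmoduleSheaf 𝓜) : ∀ U : X.affineOpens, Set Γ(𝓜, U.1) :=
  localClosure (fun _ _ h => mres h) fun U =>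
    (AddSubgroup.closure {y | ∃ P : diffOps X U.1, IsLevel p m P ∧
      ∃ x ∈ N.carrier U.1, y = D.act U P x} : Set Γ(𝓜, U.1))

variable (p) in
/-- The Bernstein-Sato roots `BSR^{(m)}(M, f)` of level `m`. -/
def bsrLevel (m : ℕ) : Set ℕ :=
  {n | D.levelSpan p m (M.smul (f ^ (n + 1))) < D.levelSpan p m (M.smul (f ^ n))}

variable (p) in
/-- Sections of `N_f(M) = (𝓓_X ⊗ 𝒞) · M δ_0 ⊂ γ_+ 𝓜`, locally. -/
def graphSpan (U : X.affineOpens) :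
    Submodule (LC p) (GammaPlus (res (le_top : U.1 ≤ ⊤) f) Γ(𝓜, U.1)) :=
  Submodule.span (LC p) {w | ∃ P : diffOps X U.1, ∃ x ∈ M.carrier U.1,
    w = gammaEnd p Γ(𝓜, U.1) (res le_top f) (D.polyAct p U P) (GammaPlus.delta _ x)}

variable (𝓜) in
/-- Restriction of sections of `(γ_+ 𝓜)_α`. -/
def fibreRes (α : ℤ_[p]) (U V : X.affineOpens) (h : V.1 ≤ U.1) :
    GammaFibre α (res (le_top : U.1 ≤ ⊤) f) Γ(𝓜, U.1) →
      GammaFibre α (res (le_top : V.1 ≤ ⊤) f) Γ(𝓜, V.1) :=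
  (gammaMap p (res h) (mres h) (mres_smul h) (res_res le_top h f)).lTensor (EvalPt p α)

/-- `N_f(M)_α = N_f(M) ⊗_{𝒞, ev_α} 𝔽_p`, as a subsheaf of `(γ_+ 𝓜)_α` (every `𝒞`-module is
flat). -/
def graphFibre (α : ℤ_[p]) :
    ∀ U : X.affineOpens, Set (GammaFibre α (res (le_top : U.1 ≤ ⊤) f) Γ(𝓜, U.1)) :=
  localClosure (fibreRes 𝓜 f α) fun U =>
    Set.range ((D.graphSpan p f M U).subtype.lTensor (EvalPt p α))

/-- The set `BSR(M, f) ⊂ ℤ_p` of Bernstein-Sato roots. -/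
def bsr : Set ℤ_[p] :=
  {α | D.graphFibre f (M.smul f) α < D.graphFibre f M α}

end DModuleStr

/-! ### Standing assumptions -/

variable (X) in
/-- A regular scheme. -/
def IsRegular : Prop := ∀ x : X, IsRegularLocalRing (X.presheaf.stalk x)

variable (X p) in
/-- An `F`-finite scheme: the Frobenius is a finite morphism. -/
def IsFFinite : Prop := ∀ U : X.affineOpens, (frob p 1 Γ(X, U.1)).Finite

end Sheaf

end BSRoots

end

/-!
# Bernstein-Sato roots and `ν`-invariants of unit `F^e`-modules

Everything rests on one consequence of regularity. A regular local ring `R` whose Frobenius is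
finite is free over its `q`-th powers (the flatness half of Kunz's theorem, `free_frobTwist`, by
induction on the dimension: if `u_i` lifts a basis for `R / x`, then the `u_i x ^ j` with `j < q`
form a basis for `R`). So the Frobenius is finite projective on affine opens, and a generator `η`
of `𝓗om(F_{q*} 𝓞_X, 𝓞_X)` provides finitely many `c_i`, `d_i` with `b = ∑ c_i η (d_i b) ^ q` for
all functions `b` (`TraceMap.HasDualBasis`); iterating, the same holds for `η ^ m` and `q ^ m`.

*Finite levels.* By the dual basis identity the operators `b ↦ a η ^ m (c b) ^ (q ^ m)` are
differential operators of level `em`, and every operator of level `em` is a sum of these. That they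
have finite order uses that in characteristic `p` an operator commuting with `q`-th powers is killed
by `q`-fold commutators with each of the finitely many `c_i`, which generate `𝓞_X` over the `q`-th
powers (`isDiffOp_of_pow_linear`). On a unit `F^e`-module these operators act through
`φ ^ m ∘ C ^ m`, so that `𝓓_X^{(em)} N ⊆ 𝓓_X^{(em)} N'` if and only if `C^m N ⊆ C^m N'`
(`FModule.levelSpan_le_of_image_le`, `FModule.image_le_of_levelSpan_le`). This gives
`ν_f(q ^ m; M) = BSR^{(em)}(M, f)`.

*Passage to the limit.* Write `Q = p ^ m`. Since `(f - t) ^ Q = f ^ Q - t ^ Q`,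
`x δ_0 = ∑_{n < Q} f ^ n x t ^ (Q - 1 - n) / (f - t) ^ Q`. Differential operators of level `m` act
on the numerators `f ^ n x`, while the characteristic function of `α + p ^ m ℤ_p` selects the term
with `n ≡ α` modulo `Q` (`ind_smul_gammaEnd_delta`); moreover the fraction
`x t ^ (Q - 1 - n) / (f - t) ^ Q` determines `x` (`GammaPlus.frac_injective`). The fibre at `α` of a
`𝒞`-module is its localization at `α`: an element dies in it exactly when one of these
characteristic functions kills it (`toFibre_eq_zero`). So, near `α`, the
sections of `N_f(M)` are the fractions with numerator in `𝓓_X^{(m)} f ^ n M`, for `m` large and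
`n ≡ α`. If the inclusion `𝓓_X^{(em)} f ^ n M ⊆ 𝓓_X^{(em)} f ^ (n + 1) M` holds for all `n ≡ α`
modulo `q ^ m`, for one `m`, then it holds at all higher levels, and `α` is not a root
(`DModuleStr.exists_mem_bsrLevel_of_mem_bsr`). Conversely, if `α` is not a root and `M` is locally
finitely generated, the inclusion only has to be checked for finitely many sections, as `X` is
quasi-compact, so it holds from some level on (`DModuleStr.mem_bsr_of_forall_exists`).
-/

set_option linter.unusedSectionVars false

noncomputable section

namespace BSRoots

/-! ### Regular local rings -/

section RegularLocal

open IsLocalRing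

variable {R : Type*} [CommRing R] [IsRegularLocalRing R]

theorem spanFinrank_maximalIdeal_quotient_lt {x : R} [IsLocalRing (R ⧸ Ideal.span {x})]
    (hx : x ∈ maximalIdeal R) (hx2 : x ∉ maximalIdeal R ^ 2) :
    (maximalIdeal (R ⧸ Ideal.span {x})).spanFinrank + 1 ≤ (maximalIdeal R).spanFinrank := by
  classical
  obtain ⟨s, hs, hspan⟩ := Submodule.FG.exists_span_finset_card_eq_spanFinrank
    (maximalIdeal R).fg_of_isNoetherianRing
  have hmem : ∀ y ∈ s, y ∈ maximalIdeal R := fun y hy => hspan ▸ Submodule.subset_span hy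
  obtain ⟨c, hc⟩ := Submodule.mem_span_finset'.1
    (hspan.symm ▸ hx : x ∈ Submodule.span R (s : Set R))
  -- Some coefficient of `x` in the minimal generators is a unit, so modulo `x` that generator is
  -- redundant.
  obtain ⟨i, hi⟩ : ∃ i, c i ∉ maximalIdeal R := by
    by_contra! h
    refine hx2 (hc ▸ Ideal.sum_mem _ fun i _ => ?_)
    rw [pow_two]
    exact Ideal.mul_mem_mul (h i) (hmem _ i.2)
  have hu : IsUnit (c i) := by simpa using hi
  have hsurj := Ideal.Quotient.mk_surjective (I := Ideal.span {x})
  have hmax : maximalIdeal (R ⧸ Ideal.span {x}) = (maximalIdeal R).map (Ideal.Quotient.mk _) :=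
    (IsLocalRing.map_maximalIdeal_of_surjective _ hsurj).symm
  have hle : maximalIdeal (R ⧸ Ideal.span {x}) ≤
      Submodule.span _ (((s.erase i.1).image (Ideal.Quotient.mk (Ideal.span {x})) : Finset _) :
        Set (R ⧸ Ideal.span {x})) := by
    rw [hmax, ← hspan]
    refine (Ideal.map_span _ _).trans_le (Ideal.span_le.2 ?_)
    have hothers : ∀ y ∈ s, y ≠ i.1 → Ideal.Quotient.mk (Ideal.span {x}) y ∈
        Submodule.span (R ⧸ Ideal.span {x})
        (((s.erase i.1).image (Ideal.Quotient.mk (Ideal.span {x})) : Finset _) :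
        Set (R ⧸ Ideal.span {x})) := fun y hy hne =>
      Submodule.subset_span
        (Finset.mem_coe.2 (Finset.mem_image_of_mem _ (Finset.mem_erase.2 ⟨hne, hy⟩)))
    rintro _ ⟨y, hy, rfl⟩
    by_cases hne : y = i.1
    · subst hne
      have h0 : Ideal.Quotient.mk (Ideal.span {x}) x = 0 :=
        Ideal.Quotient.eq_zero_iff_mem.2 (Ideal.mem_span_singleton_self x)
      rw [show Ideal.Quotient.mk (Ideal.span {x}) x = Ideal.Quotient.mk (Ideal.span {x}) (c i) *
          Ideal.Quotient.mk (Ideal.span {x}) i.1 + ∑ j ∈ Finset.univ.erase i,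
            Ideal.Quotient.mk (Ideal.span {x}) (c j • j.1) by
        rw [← map_mul, ← map_sum, ← map_add, ← smul_eq_mul,
          Finset.add_sum_erase _ (fun j => c j • j.1) (Finset.mem_univ i), hc]] at h0
      have hu' := hu.map (Ideal.Quotient.mk (Ideal.span {x}))
      rw [SetLike.mem_coe, ← Ideal.unit_mul_mem_iff_mem _ hu', eq_neg_of_add_eq_zero_left h0]
      refine neg_mem (Submodule.sum_mem _ fun j hj => ?_)
      rw [smul_eq_mul, map_mul]
      exact Ideal.mul_mem_left _ _
        (hothers _ j.2 fun h => (Finset.ne_of_mem_erase hj) (Subtype.ext h))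
    · exact hothers y hy hne
  have hle' : Submodule.span _
      (((s.erase i.1).image (Ideal.Quotient.mk (Ideal.span {x})) : Finset _) :
        Set (R ⧸ Ideal.span {x})) ≤ maximalIdeal (R ⧸ Ideal.span {x}) := by
    rw [Submodule.span_le]
    intro y hy
    obtain ⟨z, hz, rfl⟩ := Finset.mem_image.1 (Finset.mem_coe.1 hy)
    rw [hmax]
    exact Ideal.mem_map_of_mem _ (hmem _ (Finset.mem_of_mem_erase hz))
  rw [le_antisymm hle hle', ← hs]
  refine (Nat.add_le_add_right ((Submodule.spanFinrank_span_le_ncard_of_finite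
    (Finset.finite_toSet _)).trans ?_) 1).trans (Finset.card_erase_add_one i.2).le
  rw [Set.ncard_coe_finset]
  exact Finset.card_image_le

theorem isRegularLocalRing_quotient {x : R}
    (hx : x ∈ maximalIdeal R) (hx2 : x ∉ maximalIdeal R ^ 2) :
    IsRegularLocalRing (R ⧸ Ideal.span {x}) := by
  have hne : Ideal.span {x} ≠ ⊤ := fun h =>
    (maximalIdeal.isMaximal R).ne_top (top_le_iff.1 (h ▸ (Ideal.span_singleton_le_iff_mem _).2 hx))
  have : Nontrivial (R ⧸ Ideal.span {x}) := Ideal.Quotient.nontrivial_iff.2 hne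
  have : IsLocalRing (R ⧸ Ideal.span {x}) :=
    IsLocalRing.of_surjective' _ Ideal.Quotient.mk_surjective
  refine IsRegularLocalRing.of_spanFinrank_maximalIdeal_le _ ?_
  have h1 := spanFinrank_maximalIdeal_quotient_lt hx hx2
  have h2 := Ideal.height_le_ringKrullDim_quotient_add_one hx
  rw [IsLocalRing.maximalIdeal_height_eq_ringKrullDim,
    ← IsRegularLocalRing.spanFinrank_maximalIdeal] at h2
  have h3 : (((maximalIdeal (R ⧸ Ideal.span {x})).spanFinrank : WithBot ℕ∞)) + 1 ≤
      ringKrullDim (R ⧸ Ideal.span {x}) + 1 := le_trans (by exact_mod_cast h1) h2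
  have h4 : ((1 : ℕ∞) : WithBot ℕ∞) ≠ ⊤ := fun h => ENat.one_ne_top (WithBot.coe_injective h)
  exact (WithBot.add_le_add_iff_right' (α := ℕ) (WithBot.coe_ne_bot (a := (1 : ℕ∞))) h4).1 h3

/-- A regular local ring is a field or has a nonunit outside the square of the maximal ideal and
outside all minimal primes, by prime avoidance. -/
theorem exists_mem_maximalIdeal_notMem_sq (h : maximalIdeal R ≠ ⊥) :
    ∃ x ∈ maximalIdeal R, x ∉ maximalIdeal R ^ 2 ∧ ∀ P ∈ minimalPrimes R, x ∉ P := by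
  classical
  by_contra! hcon
  have hfin := minimalPrimes.finite_of_isNoetherianRing R
  have hsub : (maximalIdeal R : Set R) ⊆
      ⋃ I ∈ ((insert (maximalIdeal R ^ 2) hfin.toFinset : Finset (Ideal R)) : Set (Ideal R)),
        (I : Set R) := by
    intro x hx
    by_cases hx2 : x ∈ maximalIdeal R ^ 2
    · exact Set.mem_biUnion (by simp) hx2
    · obtain ⟨P, hP, hxP⟩ := hcon x hx hx2
      exact Set.mem_biUnion (by simp [hP]) hxP
  obtain ⟨I, hI, hle⟩ := (Ideal.subset_union_prime (f := fun I : Ideal R => I)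
    (maximalIdeal R ^ 2) (maximalIdeal R ^ 2) (fun I hI h1 _ =>
      ((hfin.mem_toFinset.1 ((Finset.mem_insert.1 hI).resolve_left h1)).1.1))).1 hsub
  rcases Finset.mem_insert.1 hI with rfl | hI
  · refine h (Submodule.eq_bot_of_le_smul_of_le_jacobson_bot (maximalIdeal R) _
      (maximalIdeal R).fg_of_isNoetherianRing ?_ (IsLocalRing.maximalIdeal_le_jacobson _))
    rwa [smul_eq_mul, ← pow_two]
  · have hmin := hfin.mem_toFinset.1 hI
    have heq : I = maximalIdeal R :=
      le_antisymm (IsLocalRing.le_maximalIdeal hmin.1.1.ne_top) hle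
    have h0 : (maximalIdeal R).height = 0 := by
      rw [Ideal.height_eq_zero_iff]
      exact heq ▸ hmin
    have h1 := IsRegularLocalRing.spanFinrank_maximalIdeal (R := R)
    rw [← IsLocalRing.maximalIdeal_height_eq_ringKrullDim, h0] at h1
    refine h ((Submodule.spanFinrank_eq_zero_iff_eq_bot
      (maximalIdeal R).fg_of_isNoetherianRing).1 ?_)
    exact_mod_cast h1

theorem isDomain_of_spanFinrank_eq (n : ℕ) : ∀ (R : Type*) [CommRing R] [IsRegularLocalRing R],
    (maximalIdeal R).spanFinrank = n → IsDomain R := by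
  induction n using Nat.strong_induction_on with
  | h n ih =>
    intro R _ _ hn
    by_cases h : maximalIdeal R = ⊥
    · exact (IsLocalRing.isField_iff_maximalIdeal_eq.2 h).isDomain
    · obtain ⟨x, hx, hx2, hxP⟩ := exists_mem_maximalIdeal_notMem_sq h
      have := isRegularLocalRing_quotient hx hx2
      have hlt := spanFinrank_maximalIdeal_quotient_lt hx hx2
      have hdom : IsDomain (R ⧸ Ideal.span {x}) := ih _ (by omega) _ rfl
      have hprime : (Ideal.span {x}).IsPrime := (Ideal.Quotient.isDomain_iff_prime _).1 hdom
      obtain ⟨P, hP, hPx⟩ := Ideal.exists_minimalPrimes_le (bot_le : ⊥ ≤ Ideal.span {x})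
      have hPp : P.IsPrime := hP.1.1
      have hbot : P = ⊥ := by
        refine Submodule.eq_bot_of_le_smul_of_le_jacobson_bot (maximalIdeal R) _
          P.fg_of_isNoetherianRing (fun y hy => ?_) (IsLocalRing.maximalIdeal_le_jacobson _)
        obtain ⟨z, rfl⟩ := Ideal.mem_span_singleton.1 (hPx hy)
        exact Ideal.mul_mem_mul hx ((hPp.mem_or_mem hy).resolve_left (hxP P hP))
      have : (⊥ : Ideal R).IsPrime := hbot ▸ hPp
      exact IsDomain.of_bot_isPrime R

/-- A regular local ring is a domain. -/
theorem isDomain_of_isRegularLocalRing : IsDomain R :=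
  isDomain_of_spanFinrank_eq _ R rfl

end RegularLocal

/-! ### Freeness of the Frobenius over a regular local ring -/

section FrobFree

open IsLocalRing

theorem IsFpRing.of_ringHom {p : ℕ} {R S : Type*} [CommRing R] [CommRing S] [h : IsFpRing p R]
    (σ : R →+* S) : IsFpRing p S :=
  ⟨by rw [← map_natCast σ, h.cast_eq_zero, map_zero]⟩

instance IsFpRing.quotient {p : ℕ} {R : Type*} [CommRing R] [h : IsFpRing p R] (I : Ideal R) :
    IsFpRing p (R ⧸ I) :=
  IsFpRing.of_ringHom (Ideal.Quotient.mk I)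


variable {p : ℕ} [hp : Fact p.Prime]

section

variable {R : Type*} [CommRing R] {ι : Type*} [Fintype ι] {Q : ℕ} {x : R} {u : ι → R}

/-- A relation over the `Q`-th powers between the `x ^ j u_i` with `j < Q` has coefficients
divisible by `x`, if the `u_i` are independent modulo `x` in the sense of `hu`: look at the relation
modulo `x ^ (j + 1)`, by induction on `j`. -/
theorem dvd_of_sum_pow_eq_zero [IsDomain R] (hx : x ≠ 0)
    (hu : ∀ c : ι → R, x ∣ ∑ i, c i ^ Q * u i → ∀ i, x ∣ c i) (c : ι → ℕ → R)
    (hc : ∑ j ∈ Finset.range Q, x ^ j * ∑ i, c i j ^ Q * u i = 0) :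
    ∀ j < Q, ∀ i, x ∣ c i j := by
  intro j
  induction j using Nat.strong_induction_on with
  | h j ih =>
    intro hj
    refine hu (fun i => c i j) ?_
    have h1 : x ^ (j + 1) ∣ x ^ j * ∑ i, c i j ^ Q * u i := by
      rw [← Finset.add_sum_erase _ _ (Finset.mem_range.2 hj)] at hc
      rw [eq_neg_of_add_eq_zero_left hc, dvd_neg]
      refine Finset.dvd_sum fun k hk => ?_
      obtain ⟨hkj, hk⟩ := Finset.mem_erase.1 hk
      rcases lt_or_gt_of_ne hkj with h | h
      · refine Dvd.dvd.mul_left (Finset.dvd_sum fun i _ => Dvd.dvd.mul_right ?_ _) _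
        exact (pow_dvd_pow x (Nat.succ_le_of_lt hj)).trans
          (pow_dvd_pow_of_dvd (ih k h (Finset.mem_range.1 hk) i) Q)
      · exact Dvd.dvd.mul_right (pow_dvd_pow x h) _
    rw [pow_succ] at h1
    exact (mul_dvd_mul_iff_left (pow_ne_zero j hx)).1 h1

/-- The `x ^ j u_i` with `j < Q` are linearly independent over the `Q`-th powers, if the `u_i` are
so modulo `x`: the coefficients can be divided by `x` again and again. -/
theorem eq_zero_of_sum_pow_eq_zero [IsDomain R] [IsNoetherianRing R] [IsLocalRing R] (hx : x ≠ 0)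
    (hxm : x ∈ maximalIdeal R)
    (hu : ∀ c : ι → R, x ∣ ∑ i, c i ^ Q * u i → ∀ i, x ∣ c i) (c : ι → ℕ → R)
    (hc : ∑ j ∈ Finset.range Q, x ^ j * ∑ i, c i j ^ Q * u i = 0) :
    ∀ j < Q, ∀ i, c i j = 0 := by
  have key : ∀ (k : ℕ) (c : ι → ℕ → R),
      ∑ j ∈ Finset.range Q, x ^ j * ∑ i, c i j ^ Q * u i = 0 →
      ∀ j < Q, ∀ i, x ^ k ∣ c i j := by
    intro k
    induction k with
    | zero => intro c _ j _ i; simp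
    | succ k ih =>
      intro c hc
      have h1 := dvd_of_sum_pow_eq_zero hx hu c hc
      have h2 : ∀ i j, ∃ d, j < Q → c i j = x * d := fun i j => by
        by_cases hj : j < Q
        · obtain ⟨d, hd⟩ := h1 j hj i
          exact ⟨d, fun _ => hd⟩
        · exact ⟨0, fun h => absurd h hj⟩
      choose d hd using h2
      have h3 : x ^ Q * ∑ j ∈ Finset.range Q, x ^ j * ∑ i, d i j ^ Q * u i = 0 := by
        rw [← hc, Finset.mul_sum]
        refine Finset.sum_congr rfl fun j hj => ?_
        rw [mul_left_comm, Finset.mul_sum]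
        congr 1
        refine Finset.sum_congr rfl fun i _ => ?_
        rw [hd i j (Finset.mem_range.1 hj), mul_pow, mul_assoc]
      intro j hj i
      rw [hd i j hj, pow_succ']
      exact mul_dvd_mul_left x
        (ih d ((mul_eq_zero.1 h3).resolve_left (pow_ne_zero Q hx)) j hj i)
  intro j hj i
  -- By Krull's intersection theorem it is enough to divide by all powers of `x`.
  have h := Ideal.iInf_pow_eq_bot_of_isLocalRing (Ideal.span {x}) (fun h =>
    (maximalIdeal.isMaximal R).ne_top
      (top_le_iff.1 (h ▸ (Ideal.span_singleton_le_iff_mem _).2 hxm)))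
  rw [← Ideal.mem_bot, ← h, Ideal.mem_iInf]
  intro k
  rw [Ideal.span_singleton_pow, Ideal.mem_span_singleton]
  exact key k c hc j hj i

theorem FrobTwist.sum_smul {R ι : Type*} [CommRing R] {n : ℕ} [IsFpRing p R] (s : Finset ι)
    (c : ι → R) (v : ι → R) :
    ∑ i ∈ s, c i • twist p n (v i) = twist p n (∑ i ∈ s, c i ^ p ^ n * v i) := rfl

/-- If the `u_i` form a basis of `R / x` over its `p ^ n`-th powers, then the `x ^ j u_i` with
`j < p ^ n` form a basis of `R` over its own. -/
theorem free_frobTwist_of_quotient [IsDomain R] [IsNoetherianRing R] [IsLocalRing R]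
    {n : ℕ} [IsFpRing p R] [Module.Finite R (FrobTwist p n R)] (hx : x ≠ 0)
    (hxm : x ∈ maximalIdeal R)
    (hu : ∀ c : ι → R, x ∣ ∑ i, c i ^ p ^ n * u i → ∀ i, x ∣ c i)
    (hspan : ∀ r : R, ∃ c : ι → R, x ∣ r - ∑ i, c i ^ p ^ n * u i) :
    Module.Free R (FrobTwist p n R) := by
  let v : ι × Fin (p ^ n) → FrobTwist p n R := fun ij => twist p n (x ^ (ij.2 : ℕ) * u ij.1)
  have hli : LinearIndependent R v := by
    rw [Fintype.linearIndependent_iff]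
    intro g hg
    have h1 : ∑ j : Fin (p ^ n), x ^ (j : ℕ) * ∑ i, g (i, j) ^ p ^ n * u i = 0 := by
      have h2 : ∑ ij, g ij ^ p ^ n * (x ^ (ij.2 : ℕ) * u ij.1) = 0 := hg
      rw [Fintype.sum_prod_type_right] at h2
      rw [← h2]
      refine Finset.sum_congr rfl fun j _ => ?_
      rw [Finset.mul_sum]
      exact Finset.sum_congr rfl fun i _ => mul_left_comm _ _ _
    let c : ι → ℕ → R := fun i j => if h : j < p ^ n then g (i, ⟨j, h⟩) else 0
    have h2 : ∑ j ∈ Finset.range (p ^ n), x ^ j * ∑ i, c i j ^ p ^ n * u i = 0 := by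
      rw [Finset.sum_range, ← h1]
      refine Finset.sum_congr rfl fun j _ => ?_
      simp [c]
    rintro ⟨i, j⟩
    have h3 := eq_zero_of_sum_pow_eq_zero hx hxm hu c h2 j j.2 i
    simpa [c] using h3
  have hsp : ⊤ ≤ Submodule.span R (Set.range v) := by
    refine Submodule.le_of_le_smul_of_le_jacobson_bot (I := maximalIdeal R) Module.Finite.fg_top
      (IsLocalRing.maximalIdeal_le_jacobson _) ?_
    have key : ∀ k ≤ p ^ n, ∀ r : R, ∃ s ∈ Submodule.span R (Set.range v), ∃ t : R,
        r = untwist s + x ^ k * t := by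
      intro k
      induction k with
      | zero =>
        intro _ r
        exact ⟨0, zero_mem _, r, by rw [pow_zero, one_mul]; exact (zero_add r).symm⟩
      | succ k ih =>
        intro hk r
        obtain ⟨s, hs, t, rfl⟩ := ih (by omega) r
        obtain ⟨c, t', ht⟩ := hspan t
        refine ⟨s + ∑ i, c i • v (i, ⟨k, hk⟩), add_mem hs (Submodule.sum_mem _ fun i _ =>
          Submodule.smul_mem _ _ (Submodule.subset_span ⟨_, rfl⟩)), t', ?_⟩
        have h1 : untwist (∑ i, c i • v (i, ⟨k, hk⟩)) = x ^ k * ∑ i, c i ^ p ^ n * u i := by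
          rw [Finset.mul_sum]
          refine (FrobTwist.sum_smul _ _ _).trans ?_
          exact Finset.sum_congr rfl fun i _ => mul_left_comm _ _ _
        change _ = untwist s + untwist (∑ i, c i • v (i, ⟨k, hk⟩)) + _
        rw [h1, eq_add_of_sub_eq ht]
        ring
    intro r _
    obtain ⟨s, hs, t, ht⟩ := key (p ^ n) le_rfl (untwist r)
    have h1 : r = s + x • twist p n t := ht
    rw [h1]
    exact Submodule.add_mem_sup hs (Submodule.smul_mem_smul hxm trivial)
  exact Module.Free.of_basis (Module.Basis.mk hli hsp)

end

/-- The ring homomorphism `σ`, as a semilinear map between the Frobenius twists. -/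
def frobTwistMap (n : ℕ) {R S : Type*} [CommRing R] [CommRing S] [IsFpRing p R] [IsFpRing p S]
    (σ : R →+* S) : FrobTwist p n R →ₛₗ[σ] FrobTwist p n S where
  toFun a := twist p n (σ (untwist a))
  map_add' a b := map_add σ _ _
  map_smul' r a := by
    change σ (r ^ p ^ n * untwist a) = σ r ^ p ^ n * σ (untwist a)
    rw [map_mul, map_pow]

theorem finite_frobTwist_quotient {R : Type*} [CommRing R] [IsFpRing p R] {n : ℕ}
    [Module.Finite R (FrobTwist p n R)] (I : Ideal R) :
    Module.Finite (R ⧸ I) (FrobTwist p n (R ⧸ I)) :=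
  Module.Finite.of_surjective (frobTwistMap n (Ideal.Quotient.mk I))
    (Ideal.Quotient.mk_surjective (I := I))

theorem free_frobTwist_of_spanFinrank_eq (n N : ℕ) : ∀ (R : Type*) [CommRing R] [IsFpRing p R]
    [IsRegularLocalRing R] [Module.Finite R (FrobTwist p n R)],
    (maximalIdeal R).spanFinrank = N → Module.Free R (FrobTwist p n R) := by
  induction N using Nat.strong_induction_on with
  | h N ih =>
    intro R _ _ _ _ hN
    by_cases h : maximalIdeal R = ⊥
    · let _ : Field R := (IsLocalRing.isField_iff_maximalIdeal_eq.2 h).toField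
      exact Module.Free.of_divisionRing R (FrobTwist p n R)
    · obtain ⟨x, hx, hx2, -⟩ := exists_mem_maximalIdeal_notMem_sq h
      have := isRegularLocalRing_quotient hx hx2
      have hlt := spanFinrank_maximalIdeal_quotient_lt hx hx2
      have := finite_frobTwist_quotient (p := p) (n := n) (Ideal.span {x})
      have hfree := ih _ (by omega) (R ⧸ Ideal.span {x}) rfl
      have hdom : IsDomain R := isDomain_of_isRegularLocalRing
      let b := Module.Free.chooseBasis (R ⧸ Ideal.span {x}) (FrobTwist p n (R ⧸ Ideal.span {x}))
      choose u hu using fun i => Ideal.Quotient.mk_surjective (I := Ideal.span {x}) (untwist (b i))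
      have hdvd : ∀ r : R, x ∣ r ↔ Ideal.Quotient.mk (Ideal.span {x}) r = 0 := fun r => by
        rw [Ideal.Quotient.eq_zero_iff_mem, Ideal.mem_span_singleton]
      have hsum : ∀ c : _ → R, Ideal.Quotient.mk (Ideal.span {x}) (∑ i, c i ^ p ^ n * u i) =
          untwist (∑ i, Ideal.Quotient.mk (Ideal.span {x}) (c i) • b i) := fun c => by
        rw [map_sum]
        refine Eq.trans ?_ (FrobTwist.sum_smul _ _ fun i => untwist (b i)).symm
        refine Finset.sum_congr rfl fun i _ => ?_
        rw [map_mul, map_pow, hu]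
      refine free_frobTwist_of_quotient (u := u) (x := x) (fun h0 => hx2 (h0 ▸ zero_mem _)) hx
        (fun c hc i => ?_) fun r => ?_
      · rw [hdvd, hsum] at hc
        exact (hdvd _).2 (Fintype.linearIndependent_iff.1 b.linearIndependent _ hc i)
      · choose c hc using fun i => Ideal.Quotient.mk_surjective (I := Ideal.span {x})
          (b.repr (twist p n (Ideal.Quotient.mk (Ideal.span {x}) r)) i)
        refine ⟨c, ?_⟩
        rw [hdvd, map_sub, hsum]
        simp only [hc, b.sum_repr]
        exact sub_self _

/-- The flatness half of Kunz's theorem, for an `F`-finite regular local ring. -/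
theorem free_frobTwist (n : ℕ) (R : Type*) [CommRing R] [IsFpRing p R]
    [IsRegularLocalRing R] [Module.Finite R (FrobTwist p n R)] : Module.Free R (FrobTwist p n R) :=
  free_frobTwist_of_spanFinrank_eq n _ R rfl

end FrobFree

/-! ### The Frobenius of a regular `F`-finite scheme -/

section FrobProjective

variable {p : ℕ} [hp : Fact p.Prime]

theorem finite_frobTwist {R : Type*} [CommRing R] [IsFpRing p R] (h : (frob p 1 R).Finite)
    (n : ℕ) : Module.Finite R (FrobTwist p n R) := by
  have key : (frob p n R).Finite := by
    induction n with
    | zero =>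
      have : frob p 0 R = RingHom.id R := by
        ext a
        exact (congrArg (a ^ ·) (pow_zero p)).trans (pow_one a)
      rw [this]
      exact RingHom.Finite.id R
    | succ n ih =>
      have : frob p (n + 1) R = (frob p 1 R).comp (frob p n R) := by
        ext a
        change a ^ p ^ (n + 1) = (a ^ p ^ n) ^ p ^ 1
        rw [← pow_mul, ← pow_add]
      rw [this]
      exact h.comp ih
  exact key

/-- The Frobenius of a Noetherian `F`-finite regular ring is projective: its localizations are the
Frobenius twists of the regular local rings. -/
theorem projective_frobTwist {R : Type*} [CommRing R] [IsFpRing p R] [IsNoetherianRing R] (n : ℕ)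
    [Module.Finite R (FrobTwist p n R)]
    (h : ∀ (P : Ideal R) [P.IsMaximal], IsRegularLocalRing (Localization.AtPrime P)) :
    Module.Projective R (FrobTwist p n R) := by
  have hFp : ∀ (P : Ideal R) [P.IsMaximal], IsFpRing p (Localization.AtPrime P) :=
    fun P _ => IsFpRing.of_ringHom (algebraMap R _)
  let hmod : ∀ (P : Ideal R) [P.IsMaximal], Module R (FrobTwist p n (Localization.AtPrime P)) :=
    fun P _ => Module.compHom _ (algebraMap R (Localization.AtPrime P))
  have htower : ∀ (P : Ideal R) [P.IsMaximal],
      IsScalarTower R (Localization.AtPrime P) (FrobTwist p n (Localization.AtPrime P)) :=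
    fun P _ => ⟨fun a b c => by
      rw [Algebra.smul_def a b]
      exact mul_smul (algebraMap R (Localization.AtPrime P) a) b c⟩
  let f : ∀ (P : Ideal R) [P.IsMaximal],
      FrobTwist p n R →ₗ[R] FrobTwist p n (Localization.AtPrime P) := fun P _ =>
    { toFun := frobTwistMap n (algebraMap R (Localization.AtPrime P))
      map_add' := map_add _
      map_smul' := (frobTwistMap n (algebraMap R (Localization.AtPrime P))).map_smul' }
  have hf : ∀ (P : Ideal R) [P.IsMaximal], IsLocalizedModule P.primeCompl (f P) := by
    intro P _
    refine ⟨fun s => ?_, fun y => ?_, fun {a b} hab => ?_⟩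
    · rw [Module.End.isUnit_iff]
      have hu : IsUnit (algebraMap R (Localization.AtPrime P) s ^ p ^ n) :=
        (IsLocalization.map_units (Localization.AtPrime P) s).pow _
      exact ⟨fun a b hab => hu.mul_left_cancel hab, fun a => by
        obtain ⟨w, hw⟩ := hu.exists_right_inv
        refine ⟨twist p n (w * untwist a), ?_⟩
        change algebraMap R (Localization.AtPrime P) s ^ p ^ n * (w * untwist a) = untwist a
        rw [← mul_assoc, hw, one_mul]⟩
    · obtain ⟨⟨a, s⟩, h1⟩ := IsLocalization.surj P.primeCompl (untwist y)
      refine ⟨⟨twist p n (a * s.1 ^ (p ^ n - 1)), s⟩, ?_⟩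
      change algebraMap R (Localization.AtPrime P) s ^ p ^ n * untwist y =
        algebraMap R (Localization.AtPrime P) (a * s.1 ^ (p ^ n - 1))
      obtain ⟨k, hk⟩ : ∃ k, p ^ n = k + 1 := ⟨_, (Nat.sub_add_cancel (pow_pos hp.out.pos _)).symm⟩
      rw [map_mul, ← h1, hk, map_pow, Nat.add_sub_cancel]
      ring
    · obtain ⟨c, hc⟩ := (IsLocalization.eq_iff_exists P.primeCompl (Localization.AtPrime P)
        (x := untwist a) (y := untwist b)).1 hab
      refine ⟨c, ?_⟩
      change c.1 ^ p ^ n * untwist a = c.1 ^ p ^ n * untwist b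
      obtain ⟨k, hk⟩ : ∃ k, p ^ n = k + 1 := ⟨_, (Nat.sub_add_cancel (pow_pos hp.out.pos _)).symm⟩
      rw [hk, pow_succ, mul_assoc, mul_assoc]
      exact congrArg _ hc
  have : Module.FinitePresentation R (FrobTwist p n R) := Module.finitePresentation_of_finite _ _
  refine @Module.projective_of_localization_maximal' R _ _ _ _
    (fun P _ => Localization.AtPrime P) _ _ _
    (fun P _ => FrobTwist p n (Localization.AtPrime P)) _ hmod
    (fun P _ => Algebra.toModule) htower f hf (fun P hP => ?_) _
  have hfin : Module.Finite (Localization.AtPrime P) (FrobTwist p n (Localization.AtPrime P)) :=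
    Module.Finite.of_isLocalizedModule P.primeCompl (f P)
  have := h P
  have := free_frobTwist (p := p) n (Localization.AtPrime P)
  exact Module.Projective.of_free

/-- A dual basis of the projective module `F_* R`, with the coordinate functions expressed through
a generator `η` of `Hom(F_* R, R)`. -/
theorem exists_sum_mul_pow {R : Type*} [CommRing R] [IsFpRing p R] (n : ℕ)
    [Module.Finite R (FrobTwist p n R)] [Module.Projective R (FrobTwist p n R)] (η : R →+ R)
    (hη : ∀ ψ : R →+ R, (∀ a b : R, ψ (a ^ p ^ n * b) = a * ψ b) → ∃ a, ∀ b, ψ b = η (a * b)) :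
    ∃ (r : ℕ) (c d : Fin r → R), ∀ b, ∑ i, c i * η (d i * b) ^ p ^ n = b := by
  obtain ⟨r, f, g, -, -, hfg⟩ := Module.Finite.exists_comp_eq_id_of_projective R (FrobTwist p n R)
  choose d hd using fun i => hη
    { toFun := fun b => g (twist p n b) i
      map_zero' := congrFun (map_zero g) i
      map_add' := fun a b => congrFun (map_add g (twist p n a) (twist p n b)) i }
    (fun a b => congrFun (map_smul g a (twist p n b)) i)
  refine ⟨r, fun i => untwist (f (Pi.single i 1)), d, fun b => ?_⟩
  have h1 : f (g (twist p n b)) = twist p n b := DFunLike.congr_fun hfg (twist p n b)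
  rw [← (Pi.basisFun R (Fin r)).sum_repr (g (twist p n b)), map_sum] at h1
  refine Eq.trans ?_ h1
  refine Finset.sum_congr rfl fun i _ => ?_
  rw [map_smul, Pi.basisFun_apply, Pi.basisFun_repr, ← hd]
  exact mul_comm _ _

theorem isRegularLocalRing_localization {X : Scheme.{u}} (hX : IsRegular X) (U : X.affineOpens)
    (P : Ideal Γ(X, U.1)) [P.IsPrime] : IsRegularLocalRing (Localization.AtPrime P) := by
  have hmem := (U.2.isoSpec.inv ⟨P, inferInstance⟩).2
  let x := U.2.fromSpec ⟨P, inferInstance⟩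
  let _ : Algebra Γ(X, U.1) (X.presheaf.stalk x) :=
    TopCat.Presheaf.algebra_section_stalk X.presheaf ⟨x, hmem⟩
  have hloc : IsLocalization.AtPrime (X.presheaf.stalk x) P :=
    U.2.isLocalization_stalk' ⟨P, inferInstance⟩ hmem
  have := hX x
  exact IsRegularLocalRing.of_ringEquiv
    (IsLocalization.algEquiv P.primeCompl (X.presheaf.stalk x) (Localization.AtPrime P)).toRingEquiv

/-- The generator `η` gives a dual basis of `𝓞_X` over its `q`-th powers on every affine open
subset. -/
theorem TraceMap.exists_sum_mul_pow {X : Scheme.{u}} [IsLocallyNoetherian X] [IsFpScheme p X]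
    (hX : IsRegular X) (hF : IsFFinite X p) {e : ℕ} {η : TraceMap X p e} (hη : η.IsGenerator)
    (U : X.affineOpens) : ∃ (r : ℕ) (c d : Fin r → Γ(X, U.1)), ∀ b,
      ∑ i, c i * η.η U.1 (d i * b) ^ p ^ e = b := by
  have := IsLocallyNoetherian.component_noetherian U
  have := finite_frobTwist (hF U) e
  have := projective_frobTwist (p := p) e fun P _ => isRegularLocalRing_localization hX U P
  exact BSRoots.exists_sum_mul_pow e (η.η U.1) (hη U)

end FrobProjective

/-! ### Order of operators linear over `q`-th powers -/

section Order

variable {A : Type*} [CommRing A]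

theorem IsDiffOp.mul_left {n : ℕ} {P : AddMonoid.End A} (hP : IsDiffOp n P) (s : A) :
    IsDiffOp n (Module.toAddMonoidEnd A A s * P) := by
  induction n generalizing P with
  | zero => rw [show P = 0 from hP, mul_zero]; exact IsDiffOp.zero 0
  | succ n ih =>
    intro a
    have h := ih (hP a)
    rwa [mul_sub, ← mul_assoc, ← mul_assoc, ← map_mul, mul_comm s a, map_mul, mul_assoc,
      mul_assoc (Module.toAddMonoidEnd A A a)] at h

theorem IsDiffOp.sum {n : ℕ} {ι : Type*} (s : Finset ι) {P : ι → AddMonoid.End A}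
    (hP : ∀ i ∈ s, IsDiffOp n (P i)) : IsDiffOp n (∑ i ∈ s, P i) :=
  Finset.sum_induction P (IsDiffOp n) (fun _ _ => IsDiffOp.add) (IsDiffOp.zero n) hP

/-- The commutator `P ↦ P a - a P`. -/
def ad (a : A) : AddMonoid.End (AddMonoid.End A) :=
  AddMonoidHom.mulRight (Module.toAddMonoidEnd A A a) -
    AddMonoidHom.mulLeft (Module.toAddMonoidEnd A A a)

theorem ad_apply (a : A) (P : AddMonoid.End A) (b : A) : ad a P b = P (a * b) - a * P b := rfl

theorem ad_commute (a b : A) : Commute (ad a) (ad b) := by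
  ext P x
  change ad a (ad b P) x = ad b (ad a P) x
  simp only [ad_apply, mul_sub]
  rw [mul_left_comm a b (P x), mul_left_comm b a x]
  abel

theorem ad_linear {Q : ℕ} {P : AddMonoid.End A} (hP : ∀ a b, P (a ^ Q * b) = a ^ Q * P b)
    (c a b : A) :
    ad c P (a ^ Q * b) = a ^ Q * ad c P b := by
  rw [ad_apply, ad_apply, mul_left_comm c, hP, hP, mul_sub, mul_left_comm c]

/-- In characteristic `p`, the `p ^ m`-th power of the commutator with `c` is the commutator with
`c ^ p ^ m`. -/
theorem ad_pow_eq_zero {p : ℕ} [hp : Fact p.Prime] [hA : IsFpRing p A] {m : ℕ} {P : AddMonoid.End A}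
    (hP : ∀ a b, P (a ^ p ^ m * b) = a ^ p ^ m * P b) (c : A) : (ad c ^ p ^ m) P = 0 := by
  have hE : IsFpRing p (AddMonoid.End (AddMonoid.End A)) := ⟨by
    ext Q x
    have h : (p : AddMonoid.End (AddMonoid.End A)) = p • 1 := by simp
    rw [h]
    change p • Q x = 0
    rw [nsmul_eq_mul, hA.cast_eq_zero, zero_mul]⟩
  set μ : AddMonoid.End A := Module.toAddMonoidEnd A A c with hμ
  let l : AddMonoid.End (AddMonoid.End A) := AddMonoidHom.mulLeft μ
  let r : AddMonoid.End (AddMonoid.End A) := AddMonoidHom.mulRight μ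
  have hc : Commute r l := by
    ext Q : 1
    exact (mul_assoc μ Q μ)
  have h2 : ad c ^ p ^ m = r ^ p ^ m - l ^ p ^ m := by
    change (r - l) ^ p ^ m = _
    rcases IsFpRing.subsingleton_or_charP p (AddMonoid.End (AddMonoid.End A)) with h | h
    · exact Subsingleton.elim _ _
    · exact sub_pow_char_pow_of_commute p m hc
  have h3 : ∀ k (Q : AddMonoid.End A), (r ^ k) Q = Q * μ ^ k := by
    intro k
    induction k with
    | zero => intro Q; simp
    | succ k ih => intro Q; rw [pow_succ, pow_succ']; exact (ih _).trans (mul_assoc _ _ _)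
  have h4 : ∀ k (Q : AddMonoid.End A), (l ^ k) Q = μ ^ k * Q := by
    intro k
    induction k with
    | zero => intro Q; simp
    | succ k ih => intro Q; rw [pow_succ, pow_succ]; exact (ih _).trans (mul_assoc _ _ _).symm
  rw [h2]
  change (r ^ p ^ m) P - (l ^ p ^ m) P = 0
  rw [h3, h4, hμ, ← map_pow, sub_eq_zero]
  ext b
  exact hP c b

variable {ι : Type*} [Fintype ι]

/-- If the ring is generated over its `Q`-th powers by the `c i`, an operator linear over the `Q`-th
powers and killed by the `k i`-th powers of the commutators with the `c i` has order at most
`∑ i, k i`: commuting it with any element gives a combination of operators with a smaller `k`. -/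
theorem isDiffOp_of_ad_pow_eq_zero {Q : ℕ} {c : ι → A} {ψ : ι → A → A}
    (hc : ∀ b, ∑ i, c i * ψ i b ^ Q = b) (N : ℕ) (k : ι → ℕ) (hk : ∑ i, k i = N)
    (P : AddMonoid.End A) (hP : ∀ a b, P (a ^ Q * b) = a ^ Q * P b)
    (had : ∀ i, (ad (c i) ^ k i) P = 0) : IsDiffOp (N + 1) P := by
  classical
  induction N generalizing k P with
  | zero =>
    have hk0 : ∀ i, k i = 0 := fun i => Finset.sum_eq_zero_iff.1 hk i (Finset.mem_univ i)
    have hP0 : ∀ i : ι, P = 0 := fun i => by simpa [hk0 i] using had i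
    intro a
    change ad a P = 0
    ext b
    rw [ad_apply, ← hc a, Finset.sum_mul, map_sum, Finset.sum_mul, ← Finset.sum_sub_distrib]
    refine Finset.sum_eq_zero fun i _ => ?_
    simp [hP0 i]
  | succ N ih =>
    intro a
    have h1 : P * Module.toAddMonoidEnd A A a - Module.toAddMonoidEnd A A a * P =
        ∑ i, Module.toAddMonoidEnd A A (ψ i a ^ Q) * ad (c i) P := by
      ext b
      refine Eq.trans ?_ (AddMonoidHom.finsetSum_apply _ _ _).symm
      change P (a * b) - a * P b = ∑ i, ψ i a ^ Q * ad (c i) P b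
      simp only [ad_apply, mul_sub, Finset.sum_sub_distrib]
      congr 1
      · conv_lhs => rw [← hc a]
        rw [Finset.sum_mul, map_sum]
        refine Finset.sum_congr rfl fun i _ => ?_
        rw [mul_assoc, mul_left_comm, hP]
      · conv_lhs => rw [← hc a]
        rw [Finset.sum_mul]
        refine Finset.sum_congr rfl fun i _ => ?_
        ring
    rw [h1]
    refine IsDiffOp.sum _ fun i _ => IsDiffOp.mul_left ?_ _
    rcases Nat.eq_zero_or_pos (k i) with h0 | hpos
    · have hP0 : P = 0 := by simpa [h0] using had i
      rw [hP0, map_zero]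
      exact IsDiffOp.zero _
    · refine ih (Function.update k i (k i - 1)) ?_ _ (ad_linear hP (c i)) fun j => ?_
      · rw [Finset.sum_update_of_mem (Finset.mem_univ i)]
        rw [← Finset.add_sum_erase _ _ (Finset.mem_univ i), Finset.erase_eq] at hk
        omega
      · by_cases hj : j = i
        · subst hj
          rw [Function.update_self]
          have h2 := had j
          rw [← Nat.sub_add_cancel hpos, pow_succ] at h2
          exact h2
        · rw [Function.update_of_ne hj]
          have h2 : (ad (c j) ^ k j * ad (c i)) P = (ad (c i) * ad (c j) ^ k j) P := by
            rw [((ad_commute (c j) (c i)).pow_left (k j)).eq]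
          refine h2.trans ?_
          change ad (c i) ((ad (c j) ^ k j) P) = 0
          rw [had j, map_zero]

/-- A ring generated by finitely many elements over its `p ^ m`-th powers has only differential
operators of bounded order among its operators linear over the `p ^ m`-th powers. -/
theorem isDiffOp_of_pow_linear {p : ℕ} [hp : Fact p.Prime] [hA : IsFpRing p A] {m : ℕ} {c : ι → A}
    {ψ : ι → A → A} (hc : ∀ b, ∑ i, c i * ψ i b ^ p ^ m = b)
    (P : AddMonoid.End A) (hP : ∀ a b, P (a ^ p ^ m * b) = a ^ p ^ m * P b) :
    IsDiffOp (Fintype.card ι * p ^ m + 1) P :=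
  isDiffOp_of_ad_pow_eq_zero hc _ (fun _ => p ^ m) (by simp) P hP fun i => ad_pow_eq_zero hP (c i)

end Order

/-! ### Differential operators from the trace map -/

section TraceIter

section Ring

variable {p : ℕ} {R : Type*} [CommRing R] {e : ℕ} {η : AddMonoid.End R}

theorem pow_apply_pow_mul (hη : ∀ a b, η (a ^ p ^ e * b) = a * η b) (m : ℕ) (a b : R) :
    (η ^ m) (a ^ p ^ (e * m) * b) = a * (η ^ m) b := by
  induction m generalizing a with
  | zero => simp
  | succ m ih =>
    rw [pow_succ']
    change η ((η ^ m) _) = a * η ((η ^ m) b)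
    rw [← hη, ← ih (a ^ p ^ e), ← pow_mul, ← pow_add, mul_add, mul_one, add_comm e]

/-- Substituting a dual basis identity into itself gives one for the iterates of `η`. -/
theorem exists_sum_mul_pow_iterate [Fact p.Prime] [IsFpRing p R]
    (hη : ∀ a b, η (a ^ p ^ e * b) = a * η b)
    (h : ∃ (ι : Type) (_ : Fintype ι) (c d : ι → R), ∀ b, ∑ i, c i * η (d i * b) ^ p ^ e = b)
    (m : ℕ) : ∃ (ι : Type) (_ : Fintype ι) (c d : ι → R),
      ∀ b, ∑ i, c i * (η ^ m) (d i * b) ^ p ^ (e * m) = b := by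
  obtain ⟨ι, _, c, d, hcd⟩ := h
  induction m with
  | zero => exact ⟨Unit, inferInstance, 1, 1, fun b => by simp⟩
  | succ m ih =>
    obtain ⟨κ, _, c', d', hcd'⟩ := ih
    refine ⟨κ × ι, inferInstance, fun ij => c' ij.1 * c ij.2 ^ p ^ (e * m),
      fun ij => d ij.2 ^ p ^ (e * m) * d' ij.1, fun b => ?_⟩
    rw [Fintype.sum_prod_type]
    refine Eq.trans (Finset.sum_congr rfl fun i _ => ?_) (hcd' b)
    conv_rhs => rw [← hcd ((η ^ m) (d' i * b))]
    change _ = c' i * frob p (e * m) R (∑ j, _)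
    rw [map_sum, Finset.mul_sum]
    refine Finset.sum_congr rfl fun j _ => ?_
    change _ = c' i * (c j * η (d j * (η ^ m) (d' i * b)) ^ p ^ e) ^ p ^ (e * m)
    rw [mul_pow, mul_assoc (d j ^ _), pow_succ']
    change _ * η ((η ^ m) _) ^ _ = _
    rw [pow_apply_pow_mul hη, ← pow_mul, ← pow_add, mul_assoc, mul_add, mul_one, add_comm (e * m)]

end Ring

variable {p : ℕ} [hp : Fact p.Prime] {X : Scheme.{u}} [IsFpScheme p X] {e : ℕ}

/-- The `m`-th iterate of a `p⁻ᵉ`-linear map. -/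
def TraceMap.iter (η : TraceMap X p e) (m : ℕ) : TraceMap X p (e * m) where
  η U := HPow.hPow (α := AddMonoid.End Γ(X, U)) (η.η U) m
  map_pow_mul U := pow_apply_pow_mul (η := η.η U) (η.map_pow_mul U) m
  map_res U V h a := by
    induction m generalizing a with
    | zero => rfl
    | succ m ih =>
      refine (congrArg (res h) (DFunLike.congr_fun
        (pow_succ (M := AddMonoid.End Γ(X, U)) (η.η U) m) a)).trans ?_
      refine Eq.trans ?_ (DFunLike.congr_fun
        (pow_succ (M := AddMonoid.End Γ(X, V)) (η.η V) m) (res h a)).symm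
      exact (ih (η.η U a)).trans (congrArg _ (η.map_res U V h a))

theorem res_pow_mul_eq {U : X.Opens} (hU : IsAffineOpen U) (g : Γ(X, U))
    (b : Γ(X, X.basicOpen g)) :
    ∃ (k : ℕ) (r : Γ(X, U)), res (X.basicOpen_le g) g ^ k * b = res (X.basicOpen_le g) r := by
  have := hU.isLocalization_basicOpen g
  obtain ⟨k, r, h⟩ := IsLocalization.Away.surj g b
  exact ⟨k, r, (mul_comm _ _).trans h⟩

theorem isUnit_res_basicOpen {U : X.Opens} (g : Γ(X, U)) :
    IsUnit (res (X.basicOpen_le g) g) := RingedSpace.isUnit_res_basicOpen _ g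

theorem eq_of_locally_res_eq {V : X.Opens} {a b : Γ(X, V)}
    (h : ∀ x ∈ V, ∃ (W : X.Opens) (hW : W ≤ V), x ∈ W ∧ res hW a = res hW b) : a = b := by
  refine TopCat.Presheaf.section_ext X.sheaf V a b fun x hx => ?_
  obtain ⟨W, hW, hxW, hab⟩ := h x hx
  have h1 := congrArg (X.presheaf.germ W x hxW) hab
  have h2 := fun c => TopCat.Presheaf.germ_res_apply X.presheaf (homOfLE hW) x hxW c
  exact (h2 a).symm.trans (h1.trans (h2 b))

/-- A dual basis over an affine open subset is a dual basis over all smaller open subsets: this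
passes to localizations because the maps are linear over `q`-th powers. -/
theorem TraceMap.sum_mul_pow_res (η : TraceMap X p e) {U : X.Opens} (hU : IsAffineOpen U)
    {ι : Type*} [Fintype ι] {c d : ι → Γ(X, U)}
    (h : ∀ b, ∑ i, c i * η.η U (d i * b) ^ p ^ e = b) {V : X.Opens} (hV : V ≤ U) (b : Γ(X, V)) :
    ∑ i, res hV (c i) * η.η V (res hV (d i) * b) ^ p ^ e = b := by
  refine eq_of_locally_res_eq fun x hx => ?_
  obtain ⟨g, hgV, hxg⟩ := hU.exists_basicOpen_le ⟨x, hx⟩ (hV hx)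
  refine ⟨X.basicOpen g, hgV, hxg, ?_⟩
  obtain ⟨k, r, hr⟩ := res_pow_mul_eq hU g (res hgV b)
  set W := X.basicOpen g
  set s : Γ(X, W) := res (X.basicOpen_le g) g with hs
  obtain ⟨l, hl⟩ : ∃ l, p ^ e = l + 1 := ⟨_, (Nat.sub_add_cancel (pow_pos hp.out.pos _)).symm⟩
  have hr' : (s ^ k) ^ p ^ e * res hgV b = res (X.basicOpen_le g) (g ^ (k * l) * r) := by
    rw [map_mul, ← hr, map_pow, ← hs, ← pow_mul, ← mul_assoc, ← pow_add, hl, mul_add, mul_one]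
  have hu : IsUnit ((s ^ k) ^ p ^ e) := ((isUnit_res_basicOpen g).pow k).pow _
  refine hu.mul_left_cancel ?_
  rw [hr', ← h (g ^ (k * l) * r), map_sum, map_sum, Finset.mul_sum]
  refine Finset.sum_congr rfl fun i _ => ?_
  rw [map_mul, map_pow, η.map_res _ _ hgV, map_mul (res hgV), res_res, res_res]
  rw [map_mul (res (X.basicOpen_le g)) (c i), map_pow, η.map_res _ _ (X.basicOpen_le g),
    map_mul (res (X.basicOpen_le g)) (d i), ← hr', mul_left_comm, ← mul_pow,
    ← η.map_pow_mul, mul_left_comm ((s ^ k) ^ p ^ e)]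

/-- The differential operator `b ↦ a η(c b) ^ q`; its order is finite because `𝓞_X` is finitely
generated over its `q`-th powers. -/
def TraceMap.diffOp (η : TraceMap X p e) {U : X.Opens} (hU : IsAffineOpen U)
    (h : ∃ (ι : Type) (_ : Fintype ι) (c d : ι → Γ(X, U)),
      ∀ b, ∑ i, c i * η.η U (d i * b) ^ p ^ e = b) (a c : Γ(X, U)) : diffOps X U :=
  ⟨fun V => (Module.toAddMonoidEnd Γ(X, V.1) Γ(X, V.1) (res V.2 a)).comp
      ((frob p e Γ(X, V.1) : Γ(X, V.1) →+ Γ(X, V.1)).comp ((η.η V.1).comp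
        (Module.toAddMonoidEnd Γ(X, V.1) Γ(X, V.1) (res V.2 c)))), by
    refine ⟨fun V W hW b => ?_, ?_⟩
    · change res hW (res V.2 a * η.η V.1 (res V.2 c * b) ^ p ^ e) =
        res W.2 a * η.η W.1 (res W.2 c * res hW b) ^ p ^ e
      rw [map_mul, map_pow, η.map_res _ _ hW, map_mul, res_res, res_res]
    · obtain ⟨ι, _, c', d, hcd⟩ := h
      refine ⟨Fintype.card ι * p ^ e + 1, fun V => ?_⟩
      refine isDiffOp_of_pow_linear (p := p) (m := e) (η.sum_mul_pow_res hU hcd V.2) _ fun x y => ?_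
      change res V.2 a * η.η V.1 (res V.2 c * (x ^ p ^ e * y)) ^ p ^ e =
        x ^ p ^ e * (res V.2 a * η.η V.1 (res V.2 c * y) ^ p ^ e)
      rw [mul_left_comm (res V.2 c), η.map_pow_mul, mul_pow, mul_left_comm]⟩

theorem TraceMap.diffOp_apply (η : TraceMap X p e) {U : X.Opens} (hU : IsAffineOpen U)
    (h : ∃ (ι : Type) (_ : Fintype ι) (c d : ι → Γ(X, U)),
      ∀ b, ∑ i, c i * η.η U (d i * b) ^ p ^ e = b) (a c : Γ(X, U)) (V : {V : X.Opens // V ≤ U})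
    (b : Γ(X, V.1)) :
    (η.diffOp hU h a c).1 V b = res V.2 a * η.η V.1 (res V.2 c * b) ^ p ^ e := rfl

theorem TraceMap.isLevel_diffOp (η : TraceMap X p e) {U : X.Opens} (hU : IsAffineOpen U)
    (h : ∃ (ι : Type) (_ : Fintype ι) (c d : ι → Γ(X, U)),
      ∀ b, ∑ i, c i * η.η U (d i * b) ^ p ^ e = b) (a c : Γ(X, U)) :
    IsLevel p e (η.diffOp hU h a c) := fun V x y => by
  rw [diffOp_apply, diffOp_apply, mul_left_comm (res V.2 c), η.map_pow_mul, mul_pow, mul_left_comm]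

end TraceIter

/-! ### Sheaves generated by local sections -/

section LocalClosure

variable {X : Scheme.{u}} {𝓜 : X.Modules}

theorem exists_affineOpens_le {x : X} {U : X.Opens} (hx : x ∈ U) :
    ∃ V : X.affineOpens, x ∈ V.1 ∧ V.1 ≤ U := by
  obtain ⟨W, hW, hxW, hWU⟩ := exists_isAffineOpen_mem_and_subset hx
  exact ⟨⟨W, hW⟩, hxW, hWU⟩

variable {E E' : X.affineOpens → Type*} {r : ∀ U V : X.affineOpens, V.1 ≤ U.1 → E U → E V}
  {r' : ∀ U V : X.affineOpens, V.1 ≤ U.1 → E' U → E' V} {G : ∀ U, Set (E U)} {G' : ∀ U, Set (E' U)}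

theorem subset_localClosure {U : X.affineOpens} {s : E U} (h : ∀ V hV, r U V hV s ∈ G V) :
    s ∈ localClosure r G U := fun _ hx => ⟨U, le_rfl, hx, h U le_rfl⟩

/-- A family of maps compatible with restriction sends the sheaf generated by `G` to the sheaf
generated by `G'`, as soon as it sends `G` to the latter. -/
theorem map_mem_localClosure
    (hr' : ∀ U V W (h : V.1 ≤ U.1) (h' : W.1 ≤ V.1) s,
      r' V W h' (r' U V h s) = r' U W (h'.trans h) s)
    {U : X.affineOpens} {s : E U} {t : E' U} (hs : s ∈ localClosure r G U)
    (h : ∀ (V : X.affineOpens) (hV : V.1 ≤ U.1), r U V hV s ∈ G V →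
      r' U V hV t ∈ localClosure r' G' V) : t ∈ localClosure r' G' U := by
  intro x hx
  obtain ⟨V, hV, hxV, hsV⟩ := hs x hx
  obtain ⟨W, hW, hxW, htW⟩ := h V hV hsV x hxV
  exact ⟨W, hW.trans hV, hxW, by rwa [hr'] at htW⟩

theorem localClosure_mono {G' : ∀ U, Set (E U)}
    (hr : ∀ U V W (h : V.1 ≤ U.1) (h' : W.1 ≤ V.1) s, r V W h' (r U V h s) = r U W (h'.trans h) s)
    (h : ∀ U, G U ⊆ localClosure r G' U) : localClosure r G ≤ localClosure r G' :=
  fun _ _ hs => map_mem_localClosure hr hs fun V _ hsV => h V hsV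

theorem add_mem_localClosure {U : X.affineOpens} [∀ U, AddCommGroup (E U)]
    {G : ∀ U, AddSubgroup (E U)} (hadd : ∀ U V h s t, r U V h (s + t) = r U V h s + r U V h t)
    (hr : ∀ U V W (h : V.1 ≤ U.1) (h' : W.1 ≤ V.1) s, r V W h' (r U V h s) = r U W (h'.trans h) s)
    (hG : ∀ U V (h : V.1 ≤ U.1), ∀ s ∈ G U, r U V h s ∈ G V) {s t : E U}
    (hs : s ∈ localClosure r (fun U => (G U : Set (E U))) U)
    (ht : t ∈ localClosure r (fun U => (G U : Set (E U))) U) :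
    s + t ∈ localClosure r (fun U => (G U : Set (E U))) U := by
  intro x hx
  obtain ⟨V, hV, hxV, hsV⟩ := hs x hx
  obtain ⟨W, hW, hxW, htW⟩ := ht x hx
  obtain ⟨Z, hxZ, hZ⟩ := exists_affineOpens_le (U := V.1 ⊓ W.1) ⟨hxV, hxW⟩
  refine ⟨Z, (hZ.trans inf_le_left).trans hV, hxZ, ?_⟩
  rw [hadd]
  have h1 := hG V Z (hZ.trans inf_le_left) _ hsV
  have h2 := hG W Z (hZ.trans inf_le_right) _ htW
  rw [hr] at h1 h2
  exact add_mem h1 h2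

/-- The sections over `U` of the sheaf generated by additive subgroups compatible with
restriction. -/
def localSubgroup [∀ U, AddCommGroup (E U)] (r : ∀ U V : X.affineOpens, V.1 ≤ U.1 → E U →+ E V)
    (G : ∀ U, AddSubgroup (E U))
    (hr : ∀ U V W (h : V.1 ≤ U.1) (h' : W.1 ≤ V.1) s, r V W h' (r U V h s) = r U W (h'.trans h) s)
    (hG : ∀ U V (h : V.1 ≤ U.1), ∀ s ∈ G U, r U V h s ∈ G V) (U : X.affineOpens) :
    AddSubgroup (E U) where
  carrier := localClosure (fun U V h => r U V h) (fun U => (G U : Set (E U))) U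
  zero_mem' := subset_localClosure fun V hV => by rw [map_zero]; exact zero_mem _
  add_mem' := add_mem_localClosure (fun U V h => map_add (r U V h)) hr hG
  neg_mem' {s} hs := map_mem_localClosure (E := E) hr hs fun V hV hsV =>
    subset_localClosure fun W hW => hG V W hW _ (by rw [map_neg]; exact neg_mem hsV)

theorem SubmoduleSheaf.smul_mem_smul (M : SubmoduleSheaf 𝓜) (g : Γ(X, ⊤)) {U : X.Opens}
    {y : Γ(𝓜, U)} (hy : y ∈ M.carrier U) : (res le_top g : Γ(X, U)) • y ∈ (M.smul g).carrier U :=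
  fun _ hz => ⟨U, le_rfl, hz, mres le_rfl y, M.res_mem le_rfl hy, by rw [mres_smul, res_res]⟩

theorem SubmoduleSheaf.smul_mul_le (M : SubmoduleSheaf 𝓜) (g h : Γ(X, ⊤)) (U : X.Opens) :
    (M.smul (g * h)).carrier U ≤ (M.smul g).carrier U := by
  intro x hx z hz
  obtain ⟨V, hV, hzV, y, hy, e⟩ := hx z hz
  exact ⟨V, hV, hzV, res le_top h • y, Submodule.smul_mem _ _ hy, by
    rw [e, map_mul, mul_smul]⟩

end LocalClosure

section DModule

variable {X : Scheme.{u}} {𝓜 : X.Modules} {p : ℕ}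

/-- The subgroup of `Γ(U, 𝓜)` generated by the `P x` with `P ∈ 𝓓_X^{(m)}` and `x` in `N`. -/
def DModuleStr.levelSubgroup (p : ℕ) (D : DModuleStr 𝓜) (m : ℕ) (N : SubmoduleSheaf 𝓜)
    (U : X.affineOpens) : AddSubgroup Γ(𝓜, U.1) :=
  AddSubgroup.closure
    {y | ∃ P : diffOps X U.1, IsLevel p m P ∧ ∃ x ∈ N.carrier U.1, y = D.act U P x}

variable {D : DModuleStr 𝓜} {N : SubmoduleSheaf 𝓜} {m : ℕ}

theorem DModuleStr.mres_mem_levelSubgroup {U V : X.affineOpens} (h : V.1 ≤ U.1) {s : Γ(𝓜, U.1)}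
    (hs : s ∈ D.levelSubgroup p m N U) : mres h s ∈ D.levelSubgroup p m N V := by
  suffices D.levelSubgroup p m N U ≤ (D.levelSubgroup p m N V).comap (mres h) from this hs
  refine (AddSubgroup.closure_le _).2 ?_
  rintro _ ⟨P, hP, x, hx, rfl⟩
  refine AddSubgroup.subset_closure ⟨diffRes h P, fun W => hP ⟨W.1, W.2.trans h⟩, mres h x,
    N.res_mem h hx, D.act_res U V h P x⟩

/-- The sections of `𝓓_X^{(m)} N`, as a subgroup. -/
def DModuleStr.levelSections (p : ℕ) (D : DModuleStr 𝓜) (m : ℕ) (N : SubmoduleSheaf 𝓜)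
    (U : X.affineOpens) : AddSubgroup Γ(𝓜, U.1) :=
  localSubgroup (fun _ _ h => mres h) (D.levelSubgroup p m N)
    (fun _ _ _ h h' s => mres_mres h h' s) (fun _ _ h _ hs => mres_mem_levelSubgroup h hs) U

theorem DModuleStr.act_mem_levelSubgroup {U : X.affineOpens} {P : diffOps X U.1}
    (hP : IsLevel p m P) {x : Γ(𝓜, U.1)} (hx : x ∈ N.carrier U.1) :
    D.act U P x ∈ D.levelSubgroup p m N U :=
  AddSubgroup.subset_closure ⟨P, hP, x, hx, rfl⟩

theorem DModuleStr.levelSubgroup_le_levelSections (U : X.affineOpens) :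
    D.levelSubgroup p m N U ≤ D.levelSections p m N U := fun _ hs =>
  subset_localClosure (r := fun _ _ h => mres h)
    (G := fun U => (D.levelSubgroup p m N U : Set Γ(𝓜, U.1)))
    fun _ h => mres_mem_levelSubgroup h hs

theorem IsLevel.one {U : X.Opens} : IsLevel p m (1 : diffOps X U) := fun _ _ _ => rfl

theorem DModuleStr.mem_levelSubgroup {U : X.affineOpens} {x : Γ(𝓜, U.1)} (hx : x ∈ N.carrier U.1) :
    x ∈ D.levelSubgroup p m N U := by
  have h := act_mem_levelSubgroup (D := D) (N := N) (IsLevel.one (p := p) (m := m)) hx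
  rwa [map_one] at h

theorem DModuleStr.levelSpan_mono {N' : SubmoduleSheaf 𝓜}
    (h : ∀ U : X.affineOpens, N.carrier U.1 ≤ N'.carrier U.1) :
    D.levelSpan p m N ≤ D.levelSpan p m N' := by
  intro U s hs x hx
  obtain ⟨V, hV, hxV, hsV⟩ := hs x hx
  refine ⟨V, hV, hxV, AddSubgroup.closure_mono ?_ hsV⟩
  rintro _ ⟨P, hP, y, hy, rfl⟩
  exact ⟨P, hP, y, h V hy, rfl⟩

theorem DModuleStr.levelSpan_smul_mul_le (M : SubmoduleSheaf 𝓜) (g h : Γ(X, ⊤)) :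
    D.levelSpan p m (M.smul (g * h)) ≤ D.levelSpan p m (M.smul g) :=
  levelSpan_mono fun U => M.smul_mul_le g h U.1

/-- To compare `𝓓_X^{(m)} N` with the sheaf generated by subgroups `G'` it is enough to look at
the generators `P x`. -/
theorem DModuleStr.levelSpan_le {G : ∀ U : X.affineOpens, AddSubgroup Γ(𝓜, U.1)}
    (hG : ∀ (U V : X.affineOpens) (h : V.1 ≤ U.1), ∀ s ∈ G U, mres h s ∈ G V)
    (h : ∀ (U : X.affineOpens) (P : diffOps X U.1), IsLevel p m P → ∀ x ∈ N.carrier U.1,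
      D.act U P x ∈ localClosure (fun _ _ h => mres h) (fun U => (G U : Set Γ(𝓜, U.1))) U) :
    D.levelSpan p m N ≤ localClosure (fun _ _ h => mres h) (fun U => (G U : Set Γ(𝓜, U.1))) := by
  refine localClosure_mono (fun _ _ _ h h' s => mres_mres h h' s) fun U => ?_
  refine (AddSubgroup.closure_le (localSubgroup (fun _ _ h => mres h) G
    (fun _ _ _ h h' s => mres_mres h h' s) hG U)).2 ?_
  rintro _ ⟨P, hP, x, hx, rfl⟩
  exact h U P hP x hx

end DModule

/-! ### Images under `C^m` and `𝓓_X^{(em)}`-submodules -/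

theorem FMod.cartier_iterate_iter {p e : ℕ} {R M : Type*} [Fact p.Prime] [CommRing R] [IsFpRing p R]
    [AddCommGroup M] [Module R M] {Φ : FMod p e R M} (hΦ : Φ.IsUnit) (η : R →+ R)
    (hη : ∀ a b : R, η (a ^ p ^ e * b) = a * η b) (m : ℕ) (a : R) (x : M) :
    (cartier hΦ η hη)^[m] (a • Φ.iter m x) = η^[m] a • x := by
  induction m generalizing x with
  | zero => rfl
  | succ m ih =>
    rw [Function.iterate_succ_apply', Function.iterate_succ_apply']
    change cartier hΦ η hη ((cartier hΦ η hη)^[m] (a • Φ.iter m (Φ.φ x))) = _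
    rw [ih, cartier_phi]

theorem CartierStr.iterate_res {X : Scheme.{u}} {𝓜 : X.Modules} {p e : ℕ} (C : CartierStr 𝓜 p e)
    {U V : X.affineOpens} (h : V.1 ≤ U.1) (m : ℕ) (x : Γ(𝓜, U.1)) :
    mres h ((C.op U)^[m] x) = (C.op V)^[m] (mres h x) := by
  induction m with
  | zero => rfl
  | succ m ih => rw [Function.iterate_succ_apply', Function.iterate_succ_apply', C.op_res, ih]

theorem CartierStr.iterate_smul {X : Scheme.{u}} {𝓜 : X.Modules} {p e : ℕ} (C : CartierStr 𝓜 p e)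
    (U : X.affineOpens) (m : ℕ) (a : Γ(X, U.1)) (x : Γ(𝓜, U.1)) :
    (C.op U)^[m] (a ^ p ^ (e * m) • x) = a • (C.op U)^[m] x := by
  induction m generalizing x with
  | zero => simp
  | succ m ih =>
    rw [Function.iterate_succ_apply, Function.iterate_succ_apply, ← ih, ← C.op_smul, ← pow_mul,
      ← pow_add, mul_add, mul_one]

section UnitModule

variable {X : Scheme.{u}} {p : ℕ} [Fact p.Prime] [IsFpScheme p X] {e : ℕ}

theorem TraceMap.iter_apply (η : TraceMap X p e) (m : ℕ) (U : X.Opens) (a : Γ(X, U)) :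
    (η.iter m).η U a = (η.η U)^[m] a :=
  congrFun (AddMonoid.End.coe_pow (M := Γ(X, U)) (η.η U) m) a

/-- On an affine open subset, the `q`-th power map has a dual basis given by `η`. -/
def TraceMap.HasDualBasis (η : TraceMap X p e) : Prop :=
  ∀ U : X.affineOpens, ∃ (ι : Type) (_ : Fintype ι) (c d : ι → Γ(X, U.1)),
    ∀ b, ∑ i, c i * η.η U.1 (d i * b) ^ p ^ e = b

theorem TraceMap.HasDualBasis.iter {η : TraceMap X p e} (h : η.HasDualBasis) (m : ℕ) :
    (η.iter m).HasDualBasis := fun U =>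
  exists_sum_mul_pow_iterate (η := η.η U.1) (η.map_pow_mul U.1) (h U) m

theorem TraceMap.IsGenerator.hasDualBasis [IsLocallyNoetherian X]
    (hX : IsRegular X) (hF : IsFFinite X p) {η : TraceMap X p e} (hη : η.IsGenerator) :
    η.HasDualBasis := fun U => by
  obtain ⟨r, c, d, h⟩ := TraceMap.exists_sum_mul_pow hX hF hη U
  exact ⟨Fin r, inferInstance, c, d, h⟩

variable {𝓜 : X.Modules} (Φ : FModule 𝓜 p e) (he : 0 < e) (hΦ : Φ.IsUnit) (η : TraceMap X p e)

theorem FModule.toCartier_iterate_iter (m : ℕ) (U : X.affineOpens) (a : Γ(X, U.1)) (x : Γ(𝓜, U.1)) :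
    ((Φ.toCartier hΦ η).op U)^[m] (a • (Φ.sections U.1).iter m x) = (η.iter m).η U.1 a • x := by
  rw [TraceMap.iter_apply]
  exact FMod.cartier_iterate_iter (hΦ U) (η.η U.1) (η.map_pow_mul U.1) m a x

theorem FModule.act_iter {m : ℕ} {U : X.affineOpens} {P : diffOps X U.1}
    (hP : IsLevel p (e * m) P) (a : Γ(X, U.1)) (x : Γ(𝓜, U.1)) :
    (Φ.toDModule he hΦ).act U P (a • (Φ.sections U.1).iter m x) =
      diffOps.toEnd P a • (Φ.sections U.1).iter m x :=
  FMod.actFun_iter he (hΦ U) (diffOps.toPLin p U.1 P) m (hP ⟨U.1, le_rfl⟩) a x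

variable {η}

/-- The operator `b ↦ a η^m(c b)^{q^m}` acts as `x ↦ a φ^m(C^m(c x))`. -/
theorem FModule.act_diffOp (hη : η.HasDualBasis) (m : ℕ) (U : X.affineOpens) (a c : Γ(X, U.1))
    (x : Γ(𝓜, U.1)) :
    (Φ.toDModule he hΦ).act U ((η.iter m).diffOp U.2 (hη.iter m U) a c) x =
      a • (Φ.sections U.1).iter m (((Φ.toCartier hΦ η).op U)^[m] (c • x)) := by
  induction x using FMod.induction_iter (hΦ U) m with
  | h0 => rw [map_zero, smul_zero, iterate_map_zero, map_zero, smul_zero]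
  | h1 b x =>
    rw [FModule.act_iter Φ he hΦ ((η.iter m).isLevel_diffOp U.2 (hη.iter m U) a c), smul_smul,
      FModule.toCartier_iterate_iter, FMod.iter_smul, smul_smul]
    change (res le_rfl a * (η.iter m).η U.1 (res le_rfl c * b) ^ p ^ (e * m)) • _ = _
    rw [res_self, res_self]
  | h2 x y hx hy => simp only [map_add, hx, hy, smul_add, iterate_map_add]

/-- Every `P ∈ 𝓓_X^{(em)}` acts through `C^m`: expand in the dual basis. -/
theorem FModule.act_eq_sum {m : ℕ} {U : X.affineOpens} {ι : Type*} [Fintype ι] {c d : ι → Γ(X, U.1)}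
    (hcd : ∀ b, ∑ i, c i * (η.iter m).η U.1 (d i * b) ^ p ^ (e * m) = b) {P : diffOps X U.1}
    (hP : IsLevel p (e * m) P) (x : Γ(𝓜, U.1)) :
    (Φ.toDModule he hΦ).act U P x = ∑ i, diffOps.toEnd P (c i) •
      (Φ.sections U.1).iter m (((Φ.toCartier hΦ η).op U)^[m] (d i • x)) := by
  induction x using FMod.induction_iter (hΦ U) m with
  | h0 => simp only [map_zero, smul_zero, iterate_map_zero, Finset.sum_const_zero]
  | h1 b x =>
    rw [FModule.act_iter Φ he hΦ hP]
    conv_lhs => rw [← hcd b]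
    rw [map_sum, Finset.sum_smul]
    refine Finset.sum_congr rfl fun i _ => ?_
    rw [smul_smul, FModule.toCartier_iterate_iter, FMod.iter_smul, smul_smul, mul_comm (c i),
      mul_comm (diffOps.toEnd P (c i))]
    exact congrArg (· • _) (hP ⟨U.1, le_rfl⟩ _ _)
  | h2 x y hx hy =>
    simp only [map_add, hx, hy, smul_add, iterate_map_add, Finset.sum_add_distrib]

/-- `C^m(N)` determines `𝓓_X^{(em)} N`, which is generated by `φ^m(C^m(N))`. -/
theorem FModule.levelSpan_le_of_image_le (hη : η.HasDualBasis) {m : ℕ} {N N' : SubmoduleSheaf 𝓜}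
    (h : (Φ.toCartier hΦ η).image m N ≤ (Φ.toCartier hΦ η).image m N') :
    (Φ.toDModule he hΦ).levelSpan p (e * m) N ≤ (Φ.toDModule he hΦ).levelSpan p (e * m) N' := by
  refine DModuleStr.levelSpan_le (G := (Φ.toDModule he hΦ).levelSubgroup p (e * m) N')
    (fun _ _ h _ hs => DModuleStr.mres_mem_levelSubgroup h hs) fun U P hP x hx => ?_
  obtain ⟨ι, _, c, d, hcd⟩ := hη.iter m U
  rw [FModule.act_eq_sum Φ he hΦ hcd hP]
  refine AddSubgroup.sum_mem ((Φ.toDModule he hΦ).levelSections p (e * m) N' U) fun i _ => ?_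
  have h1 : ((Φ.toCartier hΦ η).op U)^[m] (d i • x) ∈ (Φ.toCartier hΦ η).image m N U :=
    subset_localClosure (r := fun _ _ h => mres h) fun V hV =>
      ⟨mres hV (d i • x), N.res_mem hV (Submodule.smul_mem _ _ hx),
        (CartierStr.iterate_res _ hV m _).symm⟩
  refine map_mem_localClosure (fun _ _ _ h h' s => mres_mres h h' s) (h U h1) ?_
  rintro V hV ⟨y, hy, hyx⟩
  rw [mres_smul, Φ.iter_res, ← hyx]
  have h2 := FModule.act_diffOp Φ he hΦ hη m V (res hV (diffOps.toEnd P (c i))) 1 y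
  rw [one_smul] at h2
  rw [← h2]
  exact DModuleStr.levelSubgroup_le_levelSections V (DModuleStr.act_mem_levelSubgroup
    ((η.iter m).isLevel_diffOp V.2 (hη.iter m V) _ _) hy)

/-- `𝓓_X^{(em)} N` determines `C^m(N)`, which is its image under `C^m`. -/
theorem FModule.image_le_of_levelSpan_le (hη : η.HasDualBasis) {m : ℕ} {N N' : SubmoduleSheaf 𝓜}
    (h : (Φ.toDModule he hΦ).levelSpan p (e * m) N ≤ (Φ.toDModule he hΦ).levelSpan p (e * m) N') :
    (Φ.toCartier hΦ η).image m N ≤ (Φ.toCartier hΦ η).image m N' := by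
  refine localClosure_mono (fun _ _ _ h h' s => mres_mres h h' s) fun U => ?_
  rintro _ ⟨x, hx, rfl⟩
  have h1 := h U (DModuleStr.levelSubgroup_le_levelSections U (DModuleStr.mem_levelSubgroup hx))
  refine map_mem_localClosure (fun _ _ _ h h' s => mres_mres h h' s) h1 fun V hV hxV => ?_
  obtain ⟨ι, _, c, d, hcd⟩ := hη.iter m V
  let T : Γ(𝓜, V.1) →+ Γ(𝓜, V.1) :=
    HPow.hPow (α := AddMonoid.End Γ(𝓜, V.1)) ((Φ.toCartier hΦ η).op V) m
  have hT : ∀ y, T y = ((Φ.toCartier hΦ η).op V)^[m] y :=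
    congrFun (AddMonoid.End.coe_pow (M := Γ(𝓜, V.1)) ((Φ.toCartier hΦ η).op V) m)
  have key : (Φ.toDModule he hΦ).levelSubgroup p (e * m) N' V ≤
      ((N'.carrier V.1).toAddSubgroup.map T).comap T := by
    refine (AddSubgroup.closure_le _).2 ?_
    rintro _ ⟨P, hP, w, hw, rfl⟩
    refine ⟨∑ i, ((η.iter m).η V.1 (diffOps.toEnd P (c i))) ^ p ^ (e * m) • d i • w,
      Submodule.sum_mem _ fun i _ => Submodule.smul_mem _ _ (Submodule.smul_mem _ _ hw), ?_⟩
    rw [FModule.act_eq_sum Φ he hΦ hcd hP, map_sum, map_sum]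
    refine Finset.sum_congr rfl fun i _ => ?_
    rw [hT, hT, FModule.toCartier_iterate_iter, CartierStr.iterate_smul]
  obtain ⟨y, hy, hyx⟩ := key hxV
  rw [CartierStr.iterate_res, ← hT, ← hyx, hT]
  exact subset_localClosure (r := fun _ _ h => mres h) fun W hW =>
      ⟨mres hW y, N'.res_mem hW hy, (CartierStr.iterate_res _ hW m _).symm⟩

/-- `ν_f(q^m; M) = BSR^{(em)}(M, f)`. -/
theorem FModule.nu_eq_bsrLevel (hη : η.HasDualBasis) (M : SubmoduleSheaf 𝓜) (f : Γ(X, ⊤)) (m : ℕ) :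
    (Φ.toCartier hΦ η).nu f M m = (Φ.toDModule he hΦ).bsrLevel p f M (e * m) := by
  ext n
  have hle : (Φ.toDModule he hΦ).levelSpan p (e * m) (M.smul (f ^ (n + 1))) ≤
      (Φ.toDModule he hΦ).levelSpan p (e * m) (M.smul (f ^ n)) := by
    rw [pow_succ]
    exact DModuleStr.levelSpan_smul_mul_le M _ _
  rw [CartierStr.nu, DModuleStr.bsrLevel, Set.mem_ofPred_eq, Set.mem_ofPred_eq, hle.lt_iff_ne,
    ne_comm, Ne, Ne, not_iff_not]
  constructor
  · intro h
    exact le_antisymm hle (levelSpan_le_of_image_le Φ he hΦ hη h.ge)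
  · intro h
    exact le_antisymm (image_le_of_levelSpan_le Φ he hΦ hη h.le)
      (image_le_of_levelSpan_le Φ he hΦ hη h.ge)

end UnitModule

/-! ### Fibres of modules over locally constant functions -/

section Fibre

variable {p : ℕ} [hp : Fact p.Prime]

theorem isClopen_setOf_pow_dvd_sub (α : ℤ_[p]) (m : ℕ) :
    IsClopen {β : ℤ_[p] | (p : ℤ_[p]) ^ m ∣ β - α} := by
  have : {β : ℤ_[p] | (p : ℤ_[p]) ^ m ∣ β - α} = Metric.closedBall α ((p : ℝ) ^ (-m : ℤ)) := by
    ext β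
    rw [Metric.mem_closedBall, dist_eq_norm, PadicInt.norm_le_pow_iff_mem_span_pow,
      Ideal.mem_span_singleton]
    rfl
  rw [this]
  exact IsUltrametricDist.isClopen_closedBall α
    (zpow_ne_zero _ (Nat.cast_ne_zero.2 hp.out.ne_zero))

/-- The characteristic function of `α + p ^ m ℤ_p`. -/
def LC.ind (α : ℤ_[p]) (m : ℕ) : LC p :=
  LocallyConstant.charFn (ZMod p) (isClopen_setOf_pow_dvd_sub α m)

theorem LC.ind_eq_one {α β : ℤ_[p]} {m : ℕ} (h : (p : ℤ_[p]) ^ m ∣ β - α) : LC.ind α m β = 1 :=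
  (LocallyConstant.charFn_eq_one (ZMod p) β (isClopen_setOf_pow_dvd_sub α m)).2 h

theorem LC.ind_eq_zero {α β : ℤ_[p]} {m : ℕ} (h : ¬ (p : ℤ_[p]) ^ m ∣ β - α) :
    LC.ind α m β = 0 :=
  (LocallyConstant.charFn_eq_zero (ZMod p) β (isClopen_setOf_pow_dvd_sub α m)).2 h

theorem LC.ind_self (α : ℤ_[p]) (m : ℕ) : LC.ind α m α = 1 := LC.ind_eq_one (by simp)

theorem LC.ind_level (α : ℤ_[p]) (m : ℕ) (a b : ℤ_[p]) (h : (p : ℤ_[p]) ^ m ∣ a - b) :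
    LC.ind α m a = LC.ind α m b := by
  by_cases hb : (p : ℤ_[p]) ^ m ∣ b - α
  · rw [LC.ind_eq_one hb, LC.ind_eq_one (by simpa using dvd_add h hb)]
  · rw [LC.ind_eq_zero hb, LC.ind_eq_zero fun ha => hb (by simpa using dvd_sub ha h)]

theorem LC.ind_mul {α : ℤ_[p]} {m : ℕ} {φ : LC p}
    (hφ : ∀ a b : ℤ_[p], (p : ℤ_[p]) ^ m ∣ a - b → φ a = φ b) :
    LC.ind α m * φ = (φ α).val • LC.ind α m := by
  ext β
  have e : ((φ α).val • LC.ind α m) β = (φ α).val • (LC.ind α m β) := rfl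
  rw [e, LocallyConstant.mul_apply]
  by_cases hb : (p : ℤ_[p]) ^ m ∣ β - α
  · rw [LC.ind_eq_one hb, hφ _ _ hb]; simp
  · rw [LC.ind_eq_zero hb]; simp

theorem LC.ind_mul_ind (α : ℤ_[p]) {m m' : ℕ} (h : m ≤ m') :
    LC.ind α m' * LC.ind α m = LC.ind α m' := by
  rw [LC.ind_mul fun a b hab => LC.ind_level α m a b ((pow_dvd_pow _ h).trans hab), LC.ind_self]
  have : Fact (1 < p) := ⟨hp.out.one_lt⟩
  rw [ZMod.val_one, one_smul]

variable {W : Type*} [AddCommGroup W] [Module (LC p) W] (α : ℤ_[p])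

/-- Near `α`, a locally constant function `φ` acts as the constant `φ α`. -/
theorem LC.ind_smul_smul {m : ℕ} {φ : LC p}
    (hφ : ∀ a b : ℤ_[p], (p : ℤ_[p]) ^ m ∣ a - b → φ a = φ b) (w : W) :
    LC.ind α m • φ • w = (φ α).val • (LC.ind α m • w) := by
  rw [smul_smul, LC.ind_mul hφ]
  exact smul_assoc _ _ _

theorem LC.ind_smul_ind_smul {m m' : ℕ} (h : m ≤ m') (w : W) :
    LC.ind α m' • LC.ind α m • w = LC.ind α m' • w := by
  rw [smul_smul, LC.ind_mul_ind α h]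

variable {α} in
/-- An element of `𝔽_p`, viewed in the `𝒞`-module `EvalPt p α`. -/
def EvalPt.of (c : ZMod p) : EvalPt p α := c

theorem EvalPt.smul_of (φ : LC p) (c : ZMod p) : φ • (EvalPt.of c : EvalPt p α) = .of (φ α * c) :=
  rfl

/-- The canonical map from a `𝒞`-module to its fibre at `α`. -/
def toFibre : W →+ EvalPt p α ⊗[LC p] W :=
  (TensorProduct.mk (LC p) (EvalPt p α) W (.of 1)).toAddMonoidHom

theorem toFibre_ind_smul (m : ℕ) (w : W) : toFibre α (LC.ind α m • w) = toFibre α w := by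
  change EvalPt.of 1 ⊗ₜ[LC p] (LC.ind α m • w) = EvalPt.of 1 ⊗ₜ[LC p] w
  rw [← TensorProduct.smul_tmul, EvalPt.smul_of, LC.ind_self, mul_one]

theorem toFibre_surjective : Function.Surjective (toFibre (W := W) α) := by
  intro t
  induction t using TensorProduct.induction_on with
  | zero => exact ⟨0, map_zero _⟩
  | tmul c w =>
    obtain ⟨c, rfl⟩ : ∃ d : ZMod p, EvalPt.of d = c := ⟨c, rfl⟩
    refine ⟨(LocallyConstant.const ℤ_[p] c : LC p) • w, ?_⟩
    change EvalPt.of 1 ⊗ₜ[LC p] ((LocallyConstant.const ℤ_[p] c : LC p) • w) = _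
    rw [← TensorProduct.smul_tmul, EvalPt.smul_of, mul_one]
    rfl
  | add s t hs ht =>
    obtain ⟨v, rfl⟩ := hs
    obtain ⟨w, rfl⟩ := ht
    exact ⟨v + w, map_add _ _ _⟩

/-- The elements of a `𝒞`-module which vanish near `α`. -/
def vanishing (W : Type*) [AddCommGroup W] [Module (LC p) W] (α : ℤ_[p]) : Submodule (LC p) W where
  carrier := {w | ∃ m, LC.ind α m • w = 0}
  zero_mem' := ⟨0, smul_zero _⟩
  add_mem' := by
    rintro v w ⟨m, hm⟩ ⟨n, hn⟩
    refine ⟨m + n, ?_⟩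
    rw [smul_add, ← LC.ind_smul_ind_smul α (Nat.le_add_right m n) v, hm,
      ← LC.ind_smul_ind_smul α (Nat.le_add_left n m) w, hn]
    simp
  smul_mem' := by
    rintro φ w ⟨m, hm⟩
    exact ⟨m, by rw [smul_comm, hm, smul_zero]⟩

/-- The fibre at `α` is the localization at `α`. -/
theorem toFibre_eq_zero {w : W} : toFibre α w = 0 ↔ ∃ m, LC.ind α m • w = 0 := by
  refine ⟨fun h => ?_, fun ⟨m, hm⟩ => by rw [← toFibre_ind_smul α m, hm, map_zero]⟩
  let g : EvalPt p α ⊗[LC p] W →+ W ⧸ vanishing W α := TensorProduct.liftAddHom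
    { toFun := fun c => (vanishing W α).mkQ.toAddMonoidHom.comp
        (DistribSMul.toAddMonoidHom W (LocallyConstant.const ℤ_[p] (id c : ZMod p) : LC p))
      map_zero' := by
        ext w
        change (vanishing W α).mkQ ((0 : LC p) • w) = 0
        rw [zero_smul, map_zero]
      map_add' := fun c d => by
        ext w
        change (vanishing W α).mkQ (((LocallyConstant.const ℤ_[p] (id c : ZMod p) : LC p) +
          (LocallyConstant.const ℤ_[p] (id d : ZMod p) : LC p)) • w) = _
        rw [add_smul, map_add]
        rfl }
    (fun φ c w => by
      obtain ⟨c, rfl⟩ : ∃ d : ZMod p, EvalPt.of d = c := ⟨c, rfl⟩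
      change (vanishing W α).mkQ ((LocallyConstant.const ℤ_[p] (φ α * c) : LC p) • w) =
        (vanishing W α).mkQ ((LocallyConstant.const ℤ_[p] c : LC p) • φ • w)
      refine (Submodule.Quotient.eq _).2 ?_
      obtain ⟨m, hm⟩ := LC.exists_level φ
      refine ⟨m, ?_⟩
      rw [smul_sub, LC.ind_smul_smul α (fun _ _ _ => rfl), smul_smul (LocallyConstant.const _ _),
        LC.ind_smul_smul α (fun a b h => ?_), sub_eq_zero]
      · congr 2
        change φ α * c = c * φ α
        exact mul_comm _ _
      · change c * φ a = c * φ b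
        rw [hm a b h])
  have h2 : g (toFibre α w) = 0 := by rw [h, map_zero]
  have h3 : (vanishing W α).mkQ ((LocallyConstant.const ℤ_[p] (1 : ZMod p) : LC p) • w) = 0 := h2
  rw [show (LocallyConstant.const ℤ_[p] (1 : ZMod p) : LC p) = 1 from rfl, one_smul] at h3
  exact (Submodule.Quotient.mk_eq_zero _).1 h3

theorem toFibre_mem_range {N : Submodule (LC p) W} {w : W} :
    toFibre α w ∈ Set.range (N.subtype.lTensor (EvalPt p α)) ↔ ∃ m, LC.ind α m • w ∈ N := by
  constructor
  · rintro ⟨t, ht⟩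
    obtain ⟨v, rfl⟩ := toFibre_surjective α t
    have h : toFibre α (w - v.1) = 0 := by
      rw [map_sub, ← ht, sub_eq_zero]; rfl
    obtain ⟨m, hm⟩ := (toFibre_eq_zero α).1 h
    rw [smul_sub, sub_eq_zero] at hm
    exact ⟨m, hm ▸ N.smul_mem _ v.2⟩
  · rintro ⟨m, hm⟩
    exact ⟨toFibre α ⟨_, hm⟩, toFibre_ind_smul α m w⟩

end Fibre

/-! ### Partial fractions with denominator `(f - t) ^ p ^ m` -/

section Frac

open Polynomial

variable {p : ℕ} [hp : Fact p.Prime] {R E : Type*} [CommRing R] [IsFpRing p R] [AddCommGroup E]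
  [Module R E] {f : R} {m n : ℕ}

theorem C_sub_X_pow (p : ℕ) [hp : Fact p.Prime] [IsFpRing p R] (f : R) (m : ℕ) :
    (C f - X : R[X]) ^ p ^ m = C (f ^ p ^ m) - X ^ p ^ m := by
  have h := IsFpRing.add_pow p m (C f - X) X
  rw [sub_add_cancel] at h
  rw [C_pow, h, add_sub_cancel_right]

/-- A multiple of `(f - t) ^ Q = f ^ Q - t ^ Q` of degree less than `Q = p ^ m` vanishes, and
`f - t` is not a zero divisor: the coefficients satisfy `z_j = f ^ Q z_{j + Q}`. -/
theorem eq_zero_of_coeff_smul_eq_zero {z : PolynomialModule R E}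
    (h : ∀ j, p ^ m ≤ j → ((C f - X : R[X]) ^ p ^ m • z).coeff j = 0) : z = 0 := by
  have hc : ∀ j, z.coeff j = f ^ p ^ m • z.coeff (j + p ^ m) := by
    intro j
    have h1 := h (j + p ^ m) (Nat.le_add_left _ _)
    rw [C_sub_X_pow, sub_smul, ← monomial_zero_left, ← monomial_one_right_eq_X_pow,
      sub_eq_add_neg, PolynomialModule.coeff_add, Finsupp.add_apply,
      PolynomialModule.monomial_smul_apply, if_pos (Nat.zero_le _), Nat.sub_zero, ← neg_smul,
      ← monomial_neg, PolynomialModule.monomial_smul_apply, if_pos (Nat.le_add_left _ _),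
      Nat.add_sub_cancel, neg_smul, one_smul] at h1
    exact (eq_of_sub_eq_zero ((sub_eq_add_neg _ _).trans h1)).symm
  have hk : ∀ k j, z.coeff j = f ^ (p ^ m * k) • z.coeff (j + p ^ m * k) := by
    intro k
    induction k with
    | zero => intro j; simp
    | succ k ih =>
      intro j
      rw [ih, hc (j + p ^ m * k), smul_smul, ← pow_add, mul_add, mul_one, ← add_assoc]
  ext j
  -- Beyond the support of `z` the coefficients vanish.
  rw [hk (z.coeff.support.sup id + 1) j, Finsupp.notMem_support_iff.1, smul_zero]
  · rfl
  · intro hmem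
    have h1 : j + p ^ m * (z.coeff.support.sup id + 1) ≤ z.coeff.support.sup id :=
      Finset.le_sup (f := id) hmem
    have h2 : 1 ≤ p ^ m := Nat.one_le_pow _ _ hp.out.pos
    nlinarith

theorem eq_zero_of_graphPowers_smul (p : ℕ) [hp : Fact p.Prime] [IsFpRing p R]
    {s : R[X]} (hs : s ∈ graphPowers f) {z : PolynomialModule R E}
    (h : s • z = 0) : z = 0 := by
  obtain ⟨k, rfl⟩ := hs
  have hk : k ≤ p ^ k := (Nat.lt_pow_self hp.out.one_lt).le
  refine eq_zero_of_coeff_smul_eq_zero (p := p) (f := f) (m := k) fun j _ => ?_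
  obtain ⟨l, hl⟩ := Nat.exists_eq_add_of_le' hk
  change (C f - X : R[X]) ^ k • z = 0 at h
  rw [hl, pow_add, mul_smul, h, smul_zero]
  rfl

/-- The element `f - t` of the multiplicative subset of its powers. -/
def graphElt (f : R) : graphPowers f := ⟨C f - X, Submonoid.mem_powers _⟩

/-- The class of `x t ^ (p ^ m - 1 - n) / (f - t) ^ p ^ m` in `γ_+ E`. The indexing by `n` is such
that functions `φ` of level `m` act on it by `φ n`. -/
def GammaPlus.frac (p : ℕ) (f : R) (m n : ℕ) : E →+ GammaPlus f E where
  toFun x := GammaPlus.mk f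
    (LocalizedModule.mk (PolynomialModule.single R (p ^ m - 1 - n) x) (graphElt f ^ p ^ m))
  map_zero' := by
    rw [PolynomialModule.single_zero, LocalizedModule.zero_mk, map_zero]
  map_add' x y := by
    rw [← map_add, LocalizedModule.mk_add_mk, ← smul_add, LocalizedModule.mk_cancel_common_left,
      PolynomialModule.single_add]

theorem GammaPlus.frac_apply (x : E) : GammaPlus.frac p f m n x = GammaPlus.mk f
    (LocalizedModule.mk (PolynomialModule.single R (p ^ m - 1 - n) x) (graphElt f ^ p ^ m)) := rfl

theorem GammaPlus.mk_eq_zero {w : LocalizedModule (graphPowers f) (PolynomialModule R E)} :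
    GammaPlus.mk f w = 0 ↔ ∃ z : PolynomialModule R E, LocalizedModule.mk z 1 = w :=
  QuotientAddGroup.eq_zero_iff w

theorem GammaPlus.frac_injective : Function.Injective (GammaPlus.frac (E := E) p f m n) := by
  refine (injective_iff_map_eq_zero _).2 fun x hx => ?_
  obtain ⟨z, hz⟩ := GammaPlus.mk_eq_zero.1 hx
  obtain ⟨u, hu⟩ := LocalizedModule.mk_eq.1 hz
  rw [one_smul, ← sub_eq_zero, ← smul_sub] at hu
  have h1 := sub_eq_zero.1 (eq_zero_of_graphPowers_smul p u.2 hu)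
  have h2 : (C f - X : R[X]) ^ p ^ m • z = PolynomialModule.single R (p ^ m - 1 - n) x := h1
  have h0 : z = 0 := by
    refine eq_zero_of_coeff_smul_eq_zero (p := p) (f := f) (m := m) fun j hj => ?_
    rw [h2, PolynomialModule.coeff_single, Finsupp.single_eq_of_ne]
    have : 1 ≤ p ^ m := Nat.one_le_pow _ _ hp.out.pos
    lia
  rw [h0, smul_zero] at h2
  have h3 := congrArg (fun z => z.coeff (p ^ m - 1 - n)) h2.symm
  simpa using h3

theorem gammaEnd_polyEnd_frac {T : pLinEnd p R E}
    (hT : ∀ (a : R) (x : E), T.1 (a ^ p ^ m • x) = a ^ p ^ m • T.1 x) (x : E) :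
    gammaEnd p E f (polyEnd p R E T) (GammaPlus.frac p f m n x) =
      GammaPlus.frac p f m n (T.1 x) := by
  rw [GammaPlus.frac_apply, gammaEnd_mk, locFun_mk_pow _ _ (m := m)]
  · change GammaPlus.mk f (LocalizedModule.mk (graded R E (fun _ => T.1) _) _) = _
    rw [graded_single]
    rfl
  · exact graded_pLin fun _ _ => hT

theorem lc_smul_frac (hn : n < p ^ m) {φ : LC p}
    (hφ : ∀ a b : ℤ_[p], (p : ℤ_[p]) ^ m ∣ a - b → φ a = φ b) (x : E) :
    φ • GammaPlus.frac p f m n x = GammaPlus.frac p f m n (fpCast p R (φ n) • x) := by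
  rw [GammaPlus.lc_smul_def, GammaPlus.frac_apply, gammaEnd_mk, locFun_mk_pow _ _ (m := m)]
  · change GammaPlus.mk f (LocalizedModule.mk (graded R E _ _) _) = _
    rw [graded_single]
    have e : φ (-((p ^ m - 1 - n : ℕ) : ℤ_[p]) - 1) = φ n := by
      refine hφ _ _ ⟨-1, ?_⟩
      rw [Nat.cast_sub (by lia), Nat.cast_sub (by lia)]
      push_cast
      ring
    rw [e]
    rfl
  · refine graded_pLin fun k i a x => ?_
    have e : φ (-((k * p ^ m + i : ℕ) : ℤ_[p]) - 1) = φ (-(i : ℤ_[p]) - 1) :=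
      hφ _ _ ⟨-k, by push_cast; ring⟩
    rw [e]
    exact smul_comm _ _ _

/-- `δ_0 = 1 / (f - t) = ∑ f ^ n t ^ (p ^ m - 1 - n) / (f - t) ^ p ^ m`. -/
theorem GammaPlus.delta_eq_sum (p : ℕ) [hp : Fact p.Prime] [IsFpRing p R] (f : R) (m : ℕ) (x : E) :
    GammaPlus.delta f x = ∑ n ∈ Finset.range (p ^ m), GammaPlus.frac p f m n (f ^ n • x) := by
  have hQ : 1 ≤ p ^ m := Nat.one_le_pow _ _ hp.out.pos
  have e1 : ∀ s : Finset ℕ, ∑ n ∈ s, GammaPlus.frac p f m n (f ^ n • x) =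
      GammaPlus.mk f (LocalizedModule.mk
        (∑ n ∈ s, PolynomialModule.single R (p ^ m - 1 - n) (f ^ n • x)) (graphElt f ^ p ^ m)) := by
    intro s
    induction s using Finset.induction_on with
    | empty => rw [Finset.sum_empty, Finset.sum_empty, LocalizedModule.zero_mk, map_zero]
    | insert a s ha ih =>
      rw [Finset.sum_insert ha, Finset.sum_insert ha, ih, GammaPlus.frac_apply, ← map_add,
        LocalizedModule.mk_add_mk, ← smul_add, LocalizedModule.mk_cancel_common_left]
  rw [e1]
  refine congrArg (GammaPlus.mk f) (LocalizedModule.mk_eq.2 ⟨1, ?_⟩)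
  rw [one_smul, one_smul]
  change (C f - X : R[X]) ^ p ^ m • PolynomialModule.single R 0 x = (C f - X : R[X]) • _
  have e2 : (∑ n ∈ Finset.range (p ^ m), PolynomialModule.single R (p ^ m - 1 - n) (f ^ n • x)) =
      (∑ n ∈ Finset.range (p ^ m), (C f) ^ n * X ^ (p ^ m - 1 - n) : R[X]) •
        PolynomialModule.single R 0 x := by
    rw [Finset.sum_smul]
    refine Finset.sum_congr rfl fun n _ => ?_
    rw [← C_pow, C_mul_X_pow_eq_monomial, PolynomialModule.monomial_smul_single, add_zero]
  rw [e2, smul_smul, mul_comm (C f - X), geom_sum₂_mul, C_sub_X_pow, C_pow]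

theorem appr_sub_dvd (α : ℤ_[p]) (m : ℕ) : (p : ℤ_[p]) ^ m ∣ (α.appr m : ℤ_[p]) - α := by
  rw [← dvd_neg, neg_sub]
  exact Ideal.mem_span_singleton.1 (PadicInt.appr_spec m α)

/-- `α.appr m` is the only representative of `α` modulo `p ^ m` in `[0, p ^ m)`. -/
theorem eq_appr {α : ℤ_[p]} (hn : n < p ^ m) (h : (p : ℤ_[p]) ^ m ∣ (n : ℤ_[p]) - α) :
    n = α.appr m := by
  have h1 : (p : ℤ_[p]) ^ m ∣ ((n - α.appr m : ℤ) : ℤ_[p]) := by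
    push_cast
    simpa using dvd_sub h (appr_sub_dvd α m)
  have h2 : ((p : ℤ) ^ m) ∣ (n - α.appr m : ℤ) := by
    have := (PadicInt.pow_p_dvd_int_iff m (n - α.appr m : ℤ)).1 h1
    exact_mod_cast this
  have h3 := α.appr_lt m
  have h4 := Int.eq_zero_of_abs_lt_dvd h2 (by rw [abs_lt]; zify at hn h3; constructor <;> lia)
  lia

/-- Near `α`, the section `T (x δ_0)` of `γ_+ E` is a single partial fraction. -/
theorem ind_smul_gammaEnd_delta {T : pLinEnd p R E}
    (hT : ∀ (a : R) (x : E), T.1 (a ^ p ^ m • x) = a ^ p ^ m • T.1 x) (α : ℤ_[p]) (x : E) :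
    LC.ind α m • gammaEnd p E f (polyEnd p R E T) (GammaPlus.delta f x) =
      GammaPlus.frac p f m (α.appr m) (T.1 (f ^ α.appr m • x)) := by
  rw [GammaPlus.delta_eq_sum p f m x, map_sum, Finset.smul_sum,
    Finset.sum_eq_single_of_mem _ (Finset.mem_range.2 (α.appr_lt m))]
  · rw [gammaEnd_polyEnd_frac hT, lc_smul_frac (α.appr_lt m) (LC.ind_level α m),
      LC.ind_eq_one (appr_sub_dvd α m), map_one, one_smul]
  · intro n hn hne
    rw [Finset.mem_range] at hn
    rw [gammaEnd_polyEnd_frac hT, lc_smul_frac hn (LC.ind_level α m),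
      LC.ind_eq_zero fun h => hne (eq_appr hn h), map_zero, zero_smul, map_zero]

variable {R' E' : Type*} [CommRing R'] [IsFpRing p R'] [AddCommGroup E'] [Module R' E']
  {σ : R →+* R'} {ρ : E →+ E'} (hρ : ∀ (a : R) (x : E), ρ (a • x) = σ a • ρ x) {f' : R'}
  (hf : σ f = f')

theorem gammaMap_mk (w : LocalizedModule (graphPowers f) (PolynomialModule R E)) :
    gammaMap p σ ρ hρ hf (GammaPlus.mk f w) = GammaPlus.mk f' (locMap (Polynomial.mapRingHom σ)
      (polyMap R R' ρ) (polyMap_smul σ ρ hρ) _ _ (graphPowers_le σ hf) w) := rfl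

theorem gammaMap_frac (x : E) :
    gammaMap p σ ρ hρ hf (GammaPlus.frac p f m n x) = GammaPlus.frac p f' m n (ρ x) := by
  rw [GammaPlus.frac_apply, gammaMap_mk, locMap_mk, polyMap_single, GammaPlus.frac_apply]
  congr 2
  exact Subtype.ext ((map_pow _ _ _).trans (congrArg (· ^ p ^ m) (by simp [graphElt, hf])))

theorem gammaMap_gammaMap {R'' E'' : Type*} [CommRing R''] [IsFpRing p R''] [AddCommGroup E'']
    [Module R'' E''] {σ' : R' →+* R''} {ρ' : E' →+ E''}
    (hρ' : ∀ (a : R') (x : E'), ρ' (a • x) = σ' a • ρ' x) {f'' : R''} (hf' : σ' f' = f'')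
    {τ : R →+* R''} {κ : E →+ E''} (hκ : ∀ (a : R) (x : E), κ (a • x) = τ a • κ x)
    (hf'' : τ f = f'') (hτ : ∀ a, σ' (σ a) = τ a) (h : ∀ x, ρ' (ρ x) = κ x) (w : GammaPlus f E) :
    gammaMap p σ' ρ' hρ' hf' (gammaMap p σ ρ hρ hf w) = gammaMap p τ κ hκ hf'' w := by
  obtain ⟨w, rfl⟩ : ∃ v, GammaPlus.mk f v = w := QuotientAddGroup.mk_surjective w
  rw [gammaMap_mk, gammaMap_mk, gammaMap_mk]
  congr 1
  induction w using LocalizedModule.induction_on with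
  | h z s =>
    rw [locMap_mk, locMap_mk, locMap_mk]
    congr 1
    · induction z using PolynomialModule.induction_linear with
      | zero => simp only [map_zero]
      | add x y hx hy => simp only [map_add, hx, hy]
      | single i x => rw [polyMap_single, polyMap_single, polyMap_single, h]
    · refine Subtype.ext ?_
      change Polynomial.mapRingHom σ' (Polynomial.mapRingHom σ s) = Polynomial.mapRingHom τ s
      rw [← RingHom.comp_apply, Polynomial.mapRingHom_comp,
        show σ'.comp σ = τ from RingHom.ext hτ]

end Frac

/-! ### Bernstein-Sato roots and their finite levels -/

section Roots

variable {X : Scheme.{u}} {𝓜 : X.Modules} {p : ℕ} [hp : Fact p.Prime] [IsFpScheme p X]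
  {D : DModuleStr 𝓜} {m : ℕ} {N M : SubmoduleSheaf 𝓜} {f g : Γ(X, ⊤)}

namespace DModuleStr

/-- An operator of level `m` acts linearly over the `p ^ m`-th powers. -/
theorem act_pow_smul {U : X.affineOpens} {P : diffOps X U.1} (hP : IsLevel p m P)
    (a : Γ(X, U.1)) (x : Γ(𝓜, U.1)) : D.act U P (a ^ p ^ m • x) = a ^ p ^ m • D.act U P x := by
  have h : P * mulOp (a ^ p ^ m) = mulOp (a ^ p ^ m) * P := by
    ext V b
    change P.1 V (res V.2 (a ^ p ^ m) * b) = res V.2 (a ^ p ^ m) * P.1 V b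
    rw [map_pow]
    exact hP V _ _
  have h2 := DFunLike.congr_fun (congrArg (D.act U) h) x
  rw [map_mul, map_mul] at h2
  have h3 : D.act U P (D.act U (mulOp (a ^ p ^ m)) x) =
    D.act U (mulOp (a ^ p ^ m)) (D.act U P x) := h2
  rwa [D.act_mulOp, D.act_mulOp] at h3

/-- The subgroup of `Γ(U, 𝓜)` generated by the `P (g x)` with `P ∈ 𝓓_X^{(m)}` and `x` in `N`. -/
def genSubgroup (p : ℕ) (D : DModuleStr 𝓜) (m : ℕ) (g : Γ(X, ⊤)) (N : SubmoduleSheaf 𝓜)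
    (U : X.affineOpens) : AddSubgroup Γ(𝓜, U.1) :=
  AddSubgroup.closure {y | ∃ P : diffOps X U.1, IsLevel p m P ∧ ∃ x ∈ N.carrier U.1,
    y = D.act U P ((res le_top g : Γ(X, U.1)) • x)}

theorem act_smul_mem_genSubgroup {U : X.affineOpens} {P : diffOps X U.1} (hP : IsLevel p m P)
    {x : Γ(𝓜, U.1)} (hx : x ∈ N.carrier U.1) :
    D.act U P ((res le_top g : Γ(X, U.1)) • x) ∈ D.genSubgroup p m g N U :=
  AddSubgroup.subset_closure ⟨P, hP, x, hx, rfl⟩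

theorem mres_mem_genSubgroup {U V : X.affineOpens} (h : V.1 ≤ U.1) {s : Γ(𝓜, U.1)}
    (hs : s ∈ D.genSubgroup p m g N U) : mres h s ∈ D.genSubgroup p m g N V := by
  suffices D.genSubgroup p m g N U ≤ (D.genSubgroup p m g N V).comap (mres h) from this hs
  refine (AddSubgroup.closure_le _).2 ?_
  rintro _ ⟨P, hP, x, hx, rfl⟩
  refine AddSubgroup.subset_closure ⟨diffRes h P, fun W => hP ⟨W.1, W.2.trans h⟩, mres h x,
    N.res_mem h hx, ?_⟩
  rw [D.act_res U V h P, mres_smul, res_res]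

theorem _root_.BSRoots.IsLevel.mul {U : X.Opens} {P Q : diffOps X U} (hP : IsLevel p m P)
    (hQ : IsLevel p m Q) : IsLevel p m (P * Q) := fun V a b =>
  (congrArg (P.1 V) (hQ V a b)).trans (hP V a _)

theorem _root_.BSRoots.IsLevel.mono {m' : ℕ} (h : m ≤ m') {U : X.Opens} {P : diffOps X U}
    (hP : IsLevel p m P) : IsLevel p m' P := fun V => pLin_mono h (hP V)

theorem _root_.BSRoots.IsLevel.mulOp {U : X.Opens} (a : Γ(X, U)) : IsLevel p m (mulOp a) :=
  fun V b c => mul_left_comm (res V.2 a) (b ^ p ^ m) c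

theorem act_mem_genSubgroup {U : X.affineOpens} {P : diffOps X U.1} (hP : IsLevel p m P)
    {z : Γ(𝓜, U.1)} (hz : z ∈ D.genSubgroup p m g N U) :
    D.act U P z ∈ D.genSubgroup p m g N U := by
  suffices D.genSubgroup p m g N U ≤ (D.genSubgroup p m g N U).comap (D.act U P) from this hz
  refine (AddSubgroup.closure_le _).2 ?_
  rintro _ ⟨Q, hQ, x, hx, rfl⟩
  refine AddSubgroup.subset_closure ⟨P * Q, hP.mul hQ, x, hx, ?_⟩
  rw [map_mul]
  rfl

theorem pow_smul_mem_genSubgroup {U : X.affineOpens} {z : Γ(𝓜, U.1)}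
    (hz : z ∈ D.genSubgroup p m g N U) (h : Γ(X, ⊤)) :
    (res le_top (h ^ p ^ m) : Γ(X, U.1)) • z ∈ D.genSubgroup p m (h ^ p ^ m * g) N U := by
  suffices D.genSubgroup p m g N U ≤ (D.genSubgroup p m (h ^ p ^ m * g) N U).comap
    (DistribSMul.toAddMonoidHom _ (res le_top (h ^ p ^ m) : Γ(X, U.1))) from this hz
  refine (AddSubgroup.closure_le _).2 ?_
  rintro _ ⟨Q, hQ, x, hx, rfl⟩
  refine AddSubgroup.subset_closure ⟨Q, hQ, x, hx, ?_⟩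
  rw [map_mul (res le_top), mul_smul, map_pow (res le_top), act_pow_smul hQ]
  rfl

/-- `𝓓_X^{(m)} g N` is generated by the sections `P (g x)`. -/
theorem levelSpan_smul_eq : D.levelSpan p m (N.smul g) = localClosure (fun _ _ h => mres h)
    (fun U => (D.genSubgroup p m g N U : Set Γ(𝓜, U.1))) := by
  refine le_antisymm (levelSpan_le (fun _ _ h _ hs => mres_mem_genSubgroup h hs) ?_) ?_
  · intro U P hP x hx z hz
    obtain ⟨V, hV, hzV, y, hy, e⟩ := hx z hz
    obtain ⟨W, hzW, hWV⟩ := exists_affineOpens_le hzV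
    refine ⟨W, hWV.trans hV, hzW, ?_⟩
    have e' : mres (hWV.trans hV) x = (res le_top g : Γ(X, W.1)) • mres hWV y := by
      rw [← mres_mres hV hWV, e, mres_smul, res_res]
    change mres _ _ ∈ D.genSubgroup p m g N W
    rw [D.act_res U W, e']
    exact act_smul_mem_genSubgroup (fun Z => hP ⟨Z.1, Z.2.trans (hWV.trans hV)⟩) (N.res_mem hWV hy)
  · refine localClosure_mono (fun _ _ _ h h' s => mres_mres h h' s) fun U => ?_
    refine (AddSubgroup.closure_le (D.levelSections p m (N.smul g) U)).2 ?_
    rintro _ ⟨P, hP, x, hx, rfl⟩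
    exact levelSubgroup_le_levelSections U (act_mem_levelSubgroup hP (N.smul_mem_smul g hx))

/-- `𝓓_X^{(m)} g h N` is generated by the sections `P (g x)` with `x` in `h N`. -/
theorem levelSpan_smul_mul_eq (h : Γ(X, ⊤)) :
    D.levelSpan p m (N.smul (g * h)) = localClosure (fun _ _ h => mres h)
      (fun U => (D.genSubgroup p m g (N.smul h) U : Set Γ(𝓜, U.1))) := by
  refine le_antisymm ?_ ?_
  · rw [levelSpan_smul_eq]
    refine localClosure_mono (fun _ _ _ h h' s => mres_mres h h' s) fun U s hs => ?_
    suffices D.genSubgroup p m (g * h) N U ≤ D.genSubgroup p m g (N.smul h) U from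
      subset_localClosure fun V hV => mres_mem_genSubgroup hV (this hs)
    refine AddSubgroup.closure_mono ?_
    rintro _ ⟨P, hP, x, hx, rfl⟩
    exact ⟨P, hP, _, N.smul_mem_smul h hx, by rw [map_mul (res le_top), mul_smul]⟩
  · refine localClosure_mono (fun _ _ _ h h' s => mres_mres h h' s) fun U => ?_
    refine (AddSubgroup.closure_le (D.levelSections p m (N.smul (g * h)) U)).2 ?_
    rintro _ ⟨P, hP, x, hx, rfl⟩
    refine levelSubgroup_le_levelSections U (act_mem_levelSubgroup hP fun z hz => ?_)
    obtain ⟨V, hV, hzV, y, hy, e⟩ := hx z hz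
    exact ⟨V, hV, hzV, y, hy, by rw [mres_smul, e, res_res, map_mul (res le_top), mul_smul]⟩

theorem notMem_bsrLevel {n : ℕ} : n ∉ D.bsrLevel p f M m ↔
    D.levelSpan p m (M.smul (f ^ n)) ≤ D.levelSpan p m (M.smul (f ^ n * f)) := by
  change ¬ (D.levelSpan p m (M.smul (f ^ (n + 1))) < D.levelSpan p m (M.smul (f ^ n))) ↔ _
  rw [pow_succ]
  constructor
  · intro h
    by_contra h'
    exact h (lt_of_le_not_ge (levelSpan_smul_mul_le M _ _) h')
  · exact fun h h' => h'.not_ge h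

/-- If the inclusion `𝓓_X^{(m)} N ⊆ 𝓓_X^{(m)} N'` holds at one level, it holds at all higher
ones. -/
theorem levelSpan_le_of_le {m' : ℕ} (hm : m ≤ m') {N' : SubmoduleSheaf 𝓜}
    (h : D.levelSpan p m N ≤ D.levelSpan p m N') :
    D.levelSpan p m' N ≤ D.levelSpan p m' N' := by
  refine levelSpan_le (G := D.levelSubgroup p m' N')
    (fun _ _ h _ hs => mres_mem_levelSubgroup h hs) ?_
  intro U P hP x hx
  have hx' : x ∈ D.levelSpan p m N' U :=
    h U (levelSubgroup_le_levelSections U (mem_levelSubgroup hx))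
  intro z hz
  obtain ⟨V, hV, hzV, hxV⟩ := hx' z hz
  refine ⟨V, hV, hzV, ?_⟩
  change mres _ _ ∈ D.levelSubgroup p m' N' V
  rw [D.act_res U V hV]
  suffices D.levelSubgroup p m N' V ≤
    (D.levelSubgroup p m' N' V).comap (D.act V (diffRes hV P)) from this hxV
  refine (AddSubgroup.closure_le _).2 ?_
  rintro _ ⟨Q, hQ, y, hy, rfl⟩
  refine AddSubgroup.subset_closure ⟨diffRes hV P * Q, IsLevel.mul
    (fun Z => hP ⟨Z.1, Z.2.trans hV⟩) (hQ.mono hm), y, hy, ?_⟩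
  rw [map_mul]
  rfl

/-- Near `α`, a section `P (x δ_0)` of `γ_+ 𝓜` is a single partial fraction. -/
theorem ind_smul_gammaEnd_polyAct {U : X.affineOpens} {P : diffOps X U.1} (hP : IsLevel p m P)
    (α : ℤ_[p]) (x : Γ(𝓜, U.1)) :
    LC.ind α m • gammaEnd p Γ(𝓜, U.1) (res le_top f) (D.polyAct p U P) (GammaPlus.delta _ x) =
      GammaPlus.frac p (res le_top f : Γ(X, U.1)) m (α.appr m)
        (D.act U P ((res le_top (f ^ α.appr m) : Γ(X, U.1)) • x)) := by
  rw [map_pow (res le_top)]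
  exact ind_smul_gammaEnd_delta (T := ⟨D.act U P, D.act_mem p U P⟩) (act_pow_smul hP) α x

theorem ind_smul_delta (U : X.affineOpens) (α : ℤ_[p]) (m : ℕ) (x : Γ(𝓜, U.1)) :
    LC.ind α m • GammaPlus.delta (res le_top f : Γ(X, U.1)) x =
      GammaPlus.frac p (res le_top f : Γ(X, U.1)) m (α.appr m)
        ((res le_top (f ^ α.appr m) : Γ(X, U.1)) • x) := by
  have h := ind_smul_gammaEnd_delta (f := (res le_top f : Γ(X, U.1)))
    (T := (1 : pLinEnd p Γ(X, U.1) Γ(𝓜, U.1))) (m := m) (fun _ _ => rfl) α x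
  rw [map_one, map_one] at h
  rw [map_pow (res le_top)]
  exact h

/-- Partial fractions with numerator in `𝓓_X^{(m)} f ^ n N`, with `n` the residue of `α` modulo
`p ^ m`, are sections of `N_f(N)`. -/
theorem frac_mem_graphSpan {U : X.affineOpens} {α : ℤ_[p]} {z : Γ(𝓜, U.1)}
    (hz : z ∈ D.genSubgroup p m (f ^ α.appr m) N U) :
    GammaPlus.frac p (res le_top f) m (α.appr m) z ∈ D.graphSpan p f N U := by
  suffices D.genSubgroup p m (f ^ α.appr m) N U ≤ (D.graphSpan p f N U).toAddSubgroup.comap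
    (GammaPlus.frac p (res le_top f) m (α.appr m)) from this hz
  refine (AddSubgroup.closure_le _).2 ?_
  rintro _ ⟨P, hP, x, hx, rfl⟩
  change GammaPlus.frac p _ m _ _ ∈ D.graphSpan p f N U
  rw [← ind_smul_gammaEnd_polyAct hP]
  exact Submodule.smul_mem _ _ (Submodule.subset_span ⟨P, x, hx, rfl⟩)

/-- Near `α`, the sections of `N_f(N)` are partial fractions with numerators in
`𝓓_X^{(m)} f ^ n N`, for `m` large and `n ≡ α` modulo `p ^ m`. -/
theorem exists_frac_of_mem_graphSpan {U : X.affineOpens} (α : ℤ_[p])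
    {w : GammaPlus (res (le_top : U.1 ≤ ⊤) f) Γ(𝓜, U.1)} (hw : w ∈ D.graphSpan p f N U) :
    ∃ m₀, ∀ m, m₀ ≤ m → ∃ z ∈ D.genSubgroup p m (f ^ α.appr m) N U,
      LC.ind α m • w = GammaPlus.frac p (res le_top f) m (α.appr m) z := by
  induction hw using Submodule.span_induction with
  | mem w hw =>
    obtain ⟨P, x, hx, rfl⟩ := hw
    obtain ⟨m₀, hm₀⟩ := diffOps.exists_level p P
    exact ⟨m₀, fun m hm => ⟨_, act_smul_mem_genSubgroup (hm₀.mono hm) hx,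
      ind_smul_gammaEnd_polyAct (hm₀.mono hm) α x⟩⟩
  | zero => exact ⟨0, fun m _ => ⟨0, zero_mem _, by rw [smul_zero, map_zero]⟩⟩
  | add v w _ _ hv hw =>
    obtain ⟨k, hk⟩ := hv
    obtain ⟨l, hl⟩ := hw
    refine ⟨max k l, fun m hm => ?_⟩
    obtain ⟨y, hy, ey⟩ := hk m ((le_max_left _ _).trans hm)
    obtain ⟨z, hz, ez⟩ := hl m ((le_max_right _ _).trans hm)
    exact ⟨y + z, add_mem hy hz, by rw [smul_add, ey, ez, map_add]⟩
  | smul φ w _ hw =>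
    obtain ⟨k, hk⟩ := hw
    obtain ⟨l, hl⟩ := LC.exists_level φ
    refine ⟨max k l, fun m hm => ?_⟩
    obtain ⟨z, hz, ez⟩ := hk m ((le_max_left _ _).trans hm)
    refine ⟨(φ α).val • z, AddSubgroup.nsmul_mem _ hz _, ?_⟩
    rw [LC.ind_smul_smul α fun a b h => hl a b
      ((pow_dvd_pow _ ((le_max_right _ _).trans hm)).trans h), ez, map_nsmul]

theorem fibreRes_toFibre (α : ℤ_[p]) (U V : X.affineOpens) (h : V.1 ≤ U.1)
    (w : GammaPlus (res (le_top : U.1 ≤ ⊤) f) Γ(𝓜, U.1)) :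
    fibreRes 𝓜 f α U V h (toFibre α w) =
      toFibre α (gammaMap p (res h) (mres h) (mres_smul h) (res_res le_top h f) w) := rfl

theorem fibreRes_fibreRes (α : ℤ_[p]) (U V W : X.affineOpens) (h : V.1 ≤ U.1) (h' : W.1 ≤ V.1)
    (s : GammaFibre α (res (le_top : U.1 ≤ ⊤) f) Γ(𝓜, U.1)) :
    fibreRes 𝓜 f α V W h' (fibreRes 𝓜 f α U V h s) = fibreRes 𝓜 f α U W (h'.trans h) s := by
  obtain ⟨w, rfl⟩ := toFibre_surjective α s
  rw [fibreRes_toFibre, fibreRes_toFibre, fibreRes_toFibre]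
  exact congrArg _ (gammaMap_gammaMap _ _ _ _ _ _ (fun a => res_res h h' a)
    (fun x => mres_mres h h' x) w)

theorem smul_le (M : SubmoduleSheaf 𝓜) (f : Γ(X, ⊤)) (U : X.Opens) :
    (M.smul f).carrier U ≤ M.carrier U := by
  refine fun x hx => M.glue fun z hz => ?_
  obtain ⟨V, hV, hzV, y, hy, e⟩ := hx z hz
  exact ⟨V, hV, hzV, e ▸ Submodule.smul_mem _ _ hy⟩

theorem graphFibre_smul_le (α : ℤ_[p]) : D.graphFibre f (M.smul f) α ≤ D.graphFibre f M α := by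
  intro U s hs x hx
  obtain ⟨V, hV, hxV, t, ht⟩ := hs x hx
  refine ⟨V, hV, hxV, ?_⟩
  obtain ⟨w, hw⟩ := toFibre_surjective α (fibreRes 𝓜 f α U V hV s)
  have h1 : fibreRes 𝓜 f α U V hV s ∈
      Set.range ((D.graphSpan p f (M.smul f) V).subtype.lTensor (EvalPt p α)) := ⟨t, ht⟩
  rw [← hw] at h1 ⊢
  obtain ⟨m, hm⟩ := (toFibre_mem_range α).1 h1
  refine (toFibre_mem_range α).2 ⟨m, Submodule.span_mono ?_ hm⟩
  rintro _ ⟨P, x, hx, rfl⟩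
  exact ⟨P, x, smul_le M f V.1 hx, rfl⟩

/-- A root is congruent modulo `p ^ m` to some root of level `m`: otherwise the inclusions
`𝓓_X^{(m')} f ^ n M ⊆ 𝓓_X^{(m')} f ^ (n + 1) M` hold for `n ≡ α` and all `m' ≥ m`, and they compare
the numerators of the sections of `N_f(M)` and `N_f(f M)` near `α`. -/
theorem exists_mem_bsrLevel_of_mem_bsr {α : ℤ_[p]} (hα : α ∈ D.bsr f M) (m : ℕ) :
    ∃ n ∈ D.bsrLevel p f M m, (p : ℤ_[p]) ^ m ∣ α - n := by
  by_contra! hcon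
  refine (show D.graphFibre f (M.smul f) α < D.graphFibre f M α from hα).not_ge ?_
  intro U s hs x hx
  obtain ⟨V, hV, hxV, hsV⟩ := hs x hx
  obtain ⟨w, hw⟩ := toFibre_surjective α (fibreRes 𝓜 f α U V hV s)
  rw [← hw] at hsV
  obtain ⟨k, hk⟩ := (toFibre_mem_range α).1 hsV
  obtain ⟨l, hl⟩ := exists_frac_of_mem_graphSpan α hk
  obtain ⟨m', hm, hk', hl'⟩ : ∃ m', m ≤ m' ∧ k ≤ m' ∧ l ≤ m' := ⟨m + k + l, by lia, by lia, by lia⟩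
  obtain ⟨z, hz, ez⟩ := hl m' hl'
  rw [LC.ind_smul_ind_smul α hk'] at ez
  have hn : α.appr m' ∉ D.bsrLevel p f M m := fun h => hcon _ h <| by
    rw [← dvd_neg, neg_sub]
    exact (pow_dvd_pow _ hm).trans (appr_sub_dvd α m')
  have hle := levelSpan_le_of_le hm (notMem_bsrLevel.1 hn)
  rw [levelSpan_smul_eq, levelSpan_smul_mul_eq] at hle
  obtain ⟨W, hW, hxW, hzW⟩ := hle V (subset_localClosure (r := fun _ _ h => mres h)
    (G := fun U => (D.genSubgroup p m' (f ^ α.appr m') M U : Set Γ(𝓜, U.1)))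
    fun Z hZ => mres_mem_genSubgroup hZ hz) x hxV
  refine ⟨W, hW.trans hV, hxW, ?_⟩
  rw [← fibreRes_fibreRes α U V W hV hW, ← hw, fibreRes_toFibre]
  refine (toFibre_mem_range α).2 ⟨m', ?_⟩
  rw [← map_smul, ez, gammaMap_frac]
  exact frac_mem_graphSpan hzW

/-- If `α` is not a root, then each section `x` of `M` satisfies `f ^ n x ∈ 𝓓_X^{(m)} f ^ (n + 1) M`
locally, for `m` large and `n` the residue of `α` modulo `p ^ m`. -/
theorem exists_smul_mem_of_notMem_bsr {α : ℤ_[p]} (hα : α ∉ D.bsr f M) {U : X.affineOpens}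
    {y : Γ(𝓜, U.1)} (hy : y ∈ M.carrier U.1) {x : X} (hx : x ∈ U.1) :
    ∃ (V : X.affineOpens) (hV : V.1 ≤ U.1), x ∈ V.1 ∧ ∃ m₀, ∀ m, m₀ ≤ m →
      (res le_top (f ^ α.appr m) : Γ(X, V.1)) • mres hV y ∈
        D.genSubgroup p m (f ^ α.appr m) (M.smul f) V := by
  have hle : D.graphFibre f M α ≤ D.graphFibre f (M.smul f) α := by
    by_contra h
    exact hα (lt_of_le_not_ge (graphFibre_smul_le α) h)
  have hmem : toFibre α (GammaPlus.delta _ y) ∈ D.graphFibre f M α U := by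
    refine fun x hx => ⟨U, le_rfl, hx, ?_⟩
    rw [fibreRes_toFibre]
    refine (toFibre_mem_range α).2 ⟨0, ?_⟩
    rw [← map_smul, ind_smul_delta, gammaMap_frac]
    refine frac_mem_graphSpan ?_
    have h := act_smul_mem_genSubgroup (D := D) (g := f ^ α.appr 0)
      (IsLevel.one (p := p) (m := 0)) (M.res_mem le_rfl hy)
    rw [map_one] at h
    rw [mres_smul, res_res]
    exact h
  obtain ⟨V, hV, hxV, hyV⟩ := hle U hmem x hx
  refine ⟨V, hV, hxV, ?_⟩
  rw [fibreRes_toFibre] at hyV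
  obtain ⟨k, hk⟩ := (toFibre_mem_range α).1 hyV
  obtain ⟨l, hl⟩ := exists_frac_of_mem_graphSpan α hk
  refine ⟨max k l, fun m hm => ?_⟩
  obtain ⟨z, hz, ez⟩ := hl m ((le_max_right _ _).trans hm)
  rw [LC.ind_smul_ind_smul α ((le_max_left _ _).trans hm), ← map_smul, ind_smul_delta,
    gammaMap_frac, mres_smul, res_res] at ez
  rwa [GammaPlus.frac_injective ez]

/-- If `α` is not a root, each point has a neighbourhood on which all sections `y` of a locally
finitely generated `M` satisfy `f ^ n y ∈ 𝓓_X^{(m)} f ^ (n + 1) M`, where `n` is the residue of `α`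
modulo `p ^ m`, as soon as `m` exceeds a bound independent of `y`. -/
theorem exists_nhds_of_notMem_bsr {α : ℤ_[p]} (hα : α ∉ D.bsr f M) (hM : M.LocallyFG) (x : X) :
    ∃ U : X.affineOpens, x ∈ U.1 ∧ ∃ m₀, ∀ m, m₀ ≤ m → ∀ (V : X.affineOpens), V.1 ≤ U.1 →
      ∀ y ∈ M.carrier V.1, ∀ z ∈ V.1, ∃ (W : X.affineOpens) (hW : W.1 ≤ V.1), z ∈ W.1 ∧
        (res le_top (f ^ α.appr m) : Γ(X, W.1)) • mres hW y ∈
          D.genSubgroup p m (f ^ α.appr m) (M.smul f) W := by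
  classical
  obtain ⟨U, hxU, S, hS, hgen⟩ := hM x
  obtain ⟨U', hxU', hU'⟩ := exists_affineOpens_le hxU
  have key : ∀ T : Finset Γ(𝓜, U), T ⊆ S → ∃ (V : X.affineOpens) (hV : V.1 ≤ U), x ∈ V.1 ∧ ∃ m₀,
      ∀ m, m₀ ≤ m → ∀ s ∈ T, (res le_top (f ^ α.appr m) : Γ(X, V.1)) • mres hV s ∈
        D.genSubgroup p m (f ^ α.appr m) (M.smul f) V := by
    intro T
    induction T using Finset.induction_on with
    | empty => exact fun _ => ⟨U', hU', hxU', 0, fun _ _ _ h => absurd h (Finset.notMem_empty _)⟩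
    | insert s T _ ih =>
      intro hT
      obtain ⟨V, hV, hxV, k, hk⟩ := ih ((Finset.subset_insert _ _).trans hT)
      have hs : s ∈ M.carrier U := hS _ (hT (Finset.mem_insert_self _ _))
      obtain ⟨V', hV', hxV', l, hl⟩ := exists_smul_mem_of_notMem_bsr hα (M.res_mem hV hs) hxV
      refine ⟨V', hV'.trans hV, hxV', max k l, fun m hm t ht => ?_⟩
      rcases Finset.mem_insert.1 ht with rfl | ht
      · have := hl m ((le_max_right _ _).trans hm)
        rwa [mres_mres] at this
      · have := mres_mem_genSubgroup hV' (hk m ((le_max_left _ _).trans hm) t ht)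
        rwa [mres_smul, mres_mres, res_res] at this
  obtain ⟨V₀, hV₀, hxV₀, m₀, hm₀⟩ := key S subset_rfl
  refine ⟨V₀, hxV₀, m₀, fun m hm V hV y hy z hz => ?_⟩
  obtain ⟨W', hW', hzW', hyW'⟩ := hgen V.1 (hV.trans hV₀) y hy z hz
  obtain ⟨W, hzW, hW⟩ := exists_affineOpens_le hzW'
  refine ⟨W, hW.trans hW', hzW, ?_⟩
  rw [← mres_mres hW' hW]
  generalize mres hW' y = y' at hyW'
  induction hyW' using Submodule.span_induction with
  | mem t ht =>
    obtain ⟨s, hs, rfl⟩ := ht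
    have := mres_mem_genSubgroup ((hW.trans hW').trans hV) (hm₀ m hm s hs)
    rw [mres_smul, mres_mres, res_res] at this
    rwa [mres_mres]
  | zero => rw [map_zero, smul_zero]; exact zero_mem _
  | add s t _ _ hs ht => rw [map_add, smul_add]; exact add_mem hs ht
  | smul a t _ ht =>
    rw [mres_smul, smul_comm, ← D.act_mulOp]
    exact act_mem_genSubgroup (IsLevel.mulOp _) ht

/-- If `M` is locally finitely generated and `α` is congruent to a root of level `m` modulo `p ^ m`
for each `m` in an unbounded set, then `α` is a root. -/
theorem mem_bsr_of_forall_exists [CompactSpace X] (hM : M.LocallyFG) {α : ℤ_[p]} {I : Set ℕ}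
    (hI : ∀ k, ∃ m ∈ I, k ≤ m)
    (h : ∀ m ∈ I, ∃ n ∈ D.bsrLevel p f M m, (p : ℤ_[p]) ^ m ∣ α - n) : α ∈ D.bsr f M := by
  by_contra hα
  choose U hxU m₀ hm₀ using exists_nhds_of_notMem_bsr hα hM
  obtain ⟨t, ht⟩ := isCompact_univ.elim_finite_subcover (fun x : X => ((U x).1 : Set X))
    (fun x => (U x).1.2) fun x _ => Set.mem_iUnion.2 ⟨x, hxU x⟩
  obtain ⟨m, hm, hle⟩ := hI (t.sup m₀)
  obtain ⟨n, hn, hdvd⟩ := h m hm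
  -- Operators of level `m` commute with `f ^ (p ^ m * k)`, so only the residue of `n` matters.
  obtain ⟨k, rfl⟩ : ∃ k, n = p ^ m * k + α.appr m := by
    refine ⟨n / p ^ m, ?_⟩
    rw [← eq_appr (Nat.mod_lt n (pow_pos hp.out.pos m)), Nat.div_add_mod]
    have h1 : (p : ℤ_[p]) ^ m ∣ ((n % p ^ m : ℕ) : ℤ_[p]) - n := by
      refine ⟨-((n / p ^ m : ℕ) : ℤ_[p]), ?_⟩
      conv_lhs => rw [← Nat.div_add_mod n (p ^ m)]
      push_cast
      simp
    have h2 := dvd_sub h1 hdvd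
    rwa [show ((n % p ^ m : ℕ) : ℤ_[p]) - n - (α - n) = ((n % p ^ m : ℕ) : ℤ_[p]) - α by ring] at h2
  refine notMem_bsrLevel.2 ?_ hn
  rw [levelSpan_smul_eq, levelSpan_smul_mul_eq]
  refine localClosure_mono (fun _ _ _ h h' s => mres_mres h h' s) fun V => ?_
  refine (AddSubgroup.closure_le (localSubgroup (fun _ _ h => mres h)
    (D.genSubgroup p m (f ^ (p ^ m * k + α.appr m)) (M.smul f))
    (fun _ _ _ h h' s => mres_mres h h' s) (fun _ _ h _ hs => mres_mem_genSubgroup h hs) V)).2 ?_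
  rintro _ ⟨P, hP, y, hy, rfl⟩ z hz
  obtain ⟨x, hx, hzx⟩ : ∃ x ∈ t, z ∈ (U x).1 := by
    simpa using ht (Set.mem_univ z)
  obtain ⟨V', hzV', hV'⟩ := exists_affineOpens_le (U := V.1 ⊓ (U x).1) ⟨hz, hzx⟩
  obtain ⟨W, hW, hzW, hyW⟩ := hm₀ x m ((Finset.le_sup hx).trans hle) V' (hV'.trans inf_le_right)
    _ (M.res_mem (hV'.trans inf_le_left) hy) z hzV'
  have hWV := hW.trans (hV'.trans inf_le_left)
  refine ⟨W, hWV, hzW, ?_⟩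
  change mres hWV _ ∈ _
  rw [D.act_res, mres_smul, res_res, pow_add, pow_mul', map_mul (res le_top), mul_smul]
  rw [mres_mres] at hyW
  exact act_mem_genSubgroup (fun Z => hP ⟨Z.1, Z.2.trans hWV⟩)
    (pow_smul_mem_genSubgroup hyW (f ^ k))

end DModuleStr

end Roots

end BSRoots

end

theorem theorem4p19 (p : ℕ) [Fact p.Prime]
    (X : Scheme.{u}) [AlgebraicGeometry.IsNoetherian X] [BSRoots.IsFpScheme p X]
    (hreg : BSRoots.IsRegular X) (hfin : BSRoots.IsFFinite X p)
    (e : ℕ) (he : 0 < e)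
    (η : BSRoots.TraceMap X p e) (hη : η.IsGenerator)
    (𝓜 : X.Modules) [𝓜.IsQuasicoherent]
    (Φ : BSRoots.FModule 𝓜 p e) (hΦ : Φ.IsUnit)
    (M : BSRoots.SubmoduleSheaf 𝓜) (f : Γ(X, ⊤)) :
    (∀ m : ℕ, 1 ≤ m →
      (Φ.toCartier hΦ η).nu f M m = (Φ.toDModule he hΦ).bsrLevel p f M (e * m)) ∧
    (Φ.toDModule he hΦ).bsr f M ⊆ (Φ.toCartier hΦ η).nuInfty f M ∧
    (M.LocallyFG → (Φ.toDModule he hΦ).bsr f M = (Φ.toCartier hΦ η).nuInfty f M) := by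
  have hb := hη.hasDualBasis hreg hfin
  have hnu : ∀ m, (Φ.toCartier hΦ η).nu f M m = (Φ.toDModule he hΦ).bsrLevel p f M (e * m) :=
    fun m => Φ.nu_eq_bsrLevel he hΦ hb M f m
  have hsub : (Φ.toDModule he hΦ).bsr f M ⊆ (Φ.toCartier hΦ η).nuInfty f M := fun α hα m _ => by
    rw [hnu]
    exact BSRoots.DModuleStr.exists_mem_bsrLevel_of_mem_bsr hα (e * m)
  refine ⟨fun m _ => hnu m, hsub, fun hM => hsub.antisymm fun α hα => ?_⟩
  refine BSRoots.DModuleStr.mem_bsr_of_forall_exists hM (I := {k | ∃ m, 1 ≤ m ∧ e * m = k})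
    (fun k => ⟨e * (k + 1), ⟨k + 1, Nat.le_add_left _ _, rfl⟩,
      (Nat.le_succ k).trans (Nat.le_mul_of_pos_left _ he)⟩) ?_
  rintro _ ⟨m, hm, rfl⟩
  rw [← hnu]
  exact hα m hm
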